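/- **Setting.** Fix $d\ge 1$. For every $n\ge 0$ let $\mathcal L_n$ be a non-empty compact metric space with its Borel $\sigma$-algebra. A *fusion rule* $\mathcal R$ in $\mathbb R^d$ with label spaces $\mathcal L_n$ consists of the following. * For each $c\in\mathcal L_0$, a prototile $P_0(c)$ with label $c$, whose support is a closed set homeomorphic to a closed ball of $\mathbb R^d$ and has a boundary of Lebesgue measure zero; the support depends continuously on $c$ in the Hausdorff metric. * For each $n\ge 0$ and $c\in\mathcal L_{n+1}$, a supertile $P_{n+1}(c)$, which is a finite non-empty set of translates $P_n(c')+x$ of $n$-supertiles that intersect only on their boundaries and have a connected union (the support of $P_{n+1}(c)$). For each $c$ and $\varepsilon>0$ there is $\delta>0$ such that for every label within $\delta$ of $c$ the constituents of the two supertiles are in one-to-one correspondence with corresponding supports within $\varepsilon$ in the Hausdorff metric and corresponding labels within $\varepsilon$. Write $\mathcal P_n=\{P_n(c):c\in\mathcal L_n\}$, identified with $\mathcal L_n$. A translate $P_n(c)+x$ has *control point* $x$. A ($\mathcal P_n$-)*patch* is a finite non-empty set of translates of elements of $\mathcal P_n$ that intersect only on their boundaries and have connected union; a ($\mathcal P_n$-)*tiling*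 is a set of such translates that intersect only on their boundaries and cover $\mathbb R^d$. A $\mathcal P_n$-patch is *admitted* if, for every $\varepsilon>0$, it is in one-to-one correspondence with a subset of the decomposition into $n$-supertiles of a translate of some $N$-supertile, $N\ge n$, with corresponding members $\varepsilon$-close in label and in Hausdorff distance of supports. $\Omega^{(n)}_{\mathcal R}$ is the set of $\mathcal P_n$-tilings all of whose patches are admitted, and $\Omega_{\mathcal R}=\Omega^{(0)}_{\mathcal R}$, with the tiling metric: two tilings are $\varepsilon$-close if they have patches containing the ball of radius $1/\varepsilon$ around $0$ that are in one-to-one correspondence with corresponding tiles $\varepsilon$-close. Assume that * each $\mathcal P_n$ is trim: there is a non-empty open $U\subset\mathbb R^d$ such that each tiling in $\Omega^{(n)}_{\mathcal R}$ contains at most one supertile with control point in $U$; * $\mathcal R$ is *van Hove*: if $A_n$ is the support of an $n$-supertile for each $n$, then $\mathrm{Vol}\{x:\mathrm{dist}(x,\partial A_n)\le r\}/\mathrm{Vol}(A_n)\to 0$ for each $r\ge 0$; * $\mathcal R$ is *recognizable*: for every $n$, each tiling in $\Omega^{(n)}_{\mathcal R}$ is obtained by subdivision from exactly one tiling in $\Omega^{(n+1)}_{\mathcal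 R}$. **Notation.** Let $\mu$ be a translation-invariant Borel probability measure on $\Omega_{\mathcal R}$. * Let $I$ be a measurable set of patches (of tiles), no two of which are translates of each other. $I$ is *trim* if there is a non-empty open $U\subset\mathbb R^d$ such that for every $T\in\Omega_{\mathcal R}$ there is at most one $(P,v)\in I\times U$ with $P\subset T-v$. For any such $U$ let $\mathrm{freq}_\mu(I)=\mu(\Omega_{I,U})/\mathrm{Vol}(U)$, where $\Omega_{I,U}$ is the set of $T\in\Omega_{\mathcal R}$ such that $P\subset T-v$ for some $(P,v)\in I\times U$. For a supertile $P$, $\#(I\text{ in }P)$ is the number of translates of members of $I$ that are contained in $P$ as sets of tiles. * A measure $\rho_n$ on $\mathcal P_n$ is the *frequency measure of $\mu$ on $\mathcal P_n$* if, for all measurable $I\subset\mathcal P_n$ and all non-empty open $U$ such that each tiling in $\Omega^{(n)}_{\mathcal R}$ contains at most one $P+v$ with $(P,v)\in I\times U$, $\rho_n(I)=\mu(\Omega_{I,U})/\mathrm{Vol}(U)$, where $\Omega_{I,U}$ is the set of $T$ whose decomposition into $n$-supertiles contains $P+v$ for some $(P,v)\in I\times U$. * A sequence of Borel measures $\rho_n$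 on $\mathcal P_n$ ($n\ge 0$) is *volume normalized* if $\int_{\mathcal P_n}\mathrm{Vol}(P)\,d\rho_n=1$ for all $n$, and *transition consistent* if for all $n<N$ and measurable $I\subset\mathcal P_n$, $\rho_n(I)=\int_{Q\in\mathcal P_N}\#(I\text{ in }Q)\,d\rho_N$, where here $\#(I\text{ in }Q)$ is the number of $n$-supertiles with label in $I$ in the decomposition of $Q$. **Theorem.** Each translation-invariant Borel probability measure $\mu$ on $\Omega_{\mathcal R}$ gives rise to a sequence $\{\rho_n\}$ of measures on the spaces $\mathcal P_n$, namely its frequency measures, which is volume normalized and transition consistent and satisfies, for every trim set $I$ of patches, $$\mathrm{freq}_\mu(I)=\lim_{n\to\infty}\int_{P\in\mathcal P_n}\#(I\text{ in }P)\,d\rho_n .\qquad(*)$$ Conversely, for each volume normalized and transition consistent sequence $\{\rho_n\}$ there is exactly one translation-invariant Borel probability measure $\mu$ on $\Omega_{\mathcal R}$ that satisfies $(*)$ for every trim set $I$ of patches, and $\{\rho_n\}$ is its sequence of frequency measures. -/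

import Mathlib

open MeasureTheory Filter Topology Set TopologicalSpace
open scoped ENNReal

noncomputable section

namespace Fusion

/-- Euclidean space `ℝ^d`. -/
abbrev Euc (d : ℕ) : Type := EuclideanSpace ℝ (Fin d)

/-- Translation by `v` of labelled objects: a pair `(c, x)` stands for the prototile (or supertile)
with label `c` translated by `x`, so that its control point is at `x`. -/
def shift {d : ℕ} {X : Type*} (v : Euc d) : X × Euc d ≃ X × Euc d :=
  Equiv.prodCongr (Equiv.refl X) (Equiv.addRight v)

/-- The combinatorial data of a fusion rule in `ℝ^d` whose `n`-supertiles are labelled by `L n`: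
the support of the prototile with a given label, and for each label `c` of level `n + 1` the finite
set of translated `n`-supertiles whose fusion is the `(n + 1)`-supertile `P_{n+1}(c)`. -/
structure FusionData (d : ℕ) (L : ℕ → Type*) where
  proto : L 0 → NonemptyCompacts (Euc d)
  pieces : ∀ n : ℕ, L (n + 1) → Finset (L n × Euc d)

namespace FusionData

variable {d : ℕ} {L : ℕ → Type*}

/-- The support of the `n`-supertile `P_n(c)`. -/
def supp (R : FusionData d L) : ∀ n : ℕ, L n → Set (Euc d)
  | 0, c => (R.proto c : Set (Euc d))
  | n + 1, c => ⋃ t ∈ R.pieces n c, (fun y => y + t.2) '' supp R n t.1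

/-- The support of a translated `n`-supertile. -/
def placedSupp (R : FusionData d L) (n : ℕ) (t : L n × Euc d) : Set (Euc d) :=
  (fun y => y + t.2) '' R.supp n t.1

/-- The region occupied by a set of translated `n`-supertiles. -/
def region (R : FusionData d L) (n : ℕ) (T : Set (L n × Euc d)) : Set (Euc d) :=
  ⋃ t ∈ T, R.placedSupp n t

/-- Distinct members intersect only on their boundaries. -/
def NonOverlapping (R : FusionData d L) (n : ℕ) (T : Set (L n × Euc d)) : Prop :=
  ∀ t ∈ T, ∀ t' ∈ T, t ≠ t' → R.placedSupp n t ∩ R.placedSupp n t' ⊆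
    frontier (R.placedSupp n t) ∩ frontier (R.placedSupp n t')

/-- Finite patches whose tiles are `n`-supertiles. -/
def IsPatch (R : FusionData d L) (n : ℕ) (P : Finset (L n × Euc d)) : Prop :=
  P.Nonempty ∧ R.NonOverlapping n P ∧ IsConnected (R.region n P)

/-- Tilings of `ℝ^d` whose tiles are `n`-supertiles. -/
def IsTiling (R : FusionData d L) (n : ℕ) (T : Set (L n × Euc d)) : Prop :=
  R.NonOverlapping n T ∧ R.region n T = univ

open Classical in
/-- For `n ≤ N`, the set of translated `n`-supertiles that make up the `N`-supertile `P_N(c)`. -/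
def decomp (R : FusionData d L) {n N : ℕ} (h : n ≤ N) : L N → Finset (L n × Euc d) :=
  Nat.leRec (motive := fun N _ => L N → Finset (L n × Euc d))
    (fun c => {(c, 0)})
    (fun k _ D c => (R.pieces k c).biUnion fun t => (D t.1).map (shift t.2).toEmbedding) h

theorem decomp_self (R : FusionData d L) (n : ℕ) (c : L n) :
    R.decomp (le_refl n) c = {(c, 0)} := by
  simp [decomp, Nat.leRec_self]

open Classical in
theorem decomp_succ (R : FusionData d L) {n N : ℕ} (h : n ≤ N) (c : L (N + 1)) :
    R.decomp (Nat.le_succ_of_le h) c =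
      (R.pieces N c).biUnion fun t => (R.decomp h t.1).map (shift t.2).toEmbedding := by
  exact congrFun (Nat.leRec_succ (motive := fun N _ => L N → Finset (L n × Euc d)) _ _ h) c

/-- The number `#(I in P_N(c))` of `n`-supertiles in `P_N(c)` with label in `I`. For `I = {P}`
this is the entry `M_{n,N}(P, P_N(c))` of the transition map. -/
def labelCount (R : FusionData d L) {n N : ℕ} (h : n ≤ N) (I : Set (L n)) (c : L N) : ℕ :=
  {t ∈ (R.decomp h c : Set (L n × Euc d)) | t.1 ∈ I}.ncard

/-- The subdivision of a collection of `N`-supertiles into `n`-supertiles. -/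
def subdivide (R : FusionData d L) {n N : ℕ} (h : n ≤ N) (T : Set (L N × Euc d)) :
    Set (L n × Euc d) :=
  ⋃ t ∈ T, shift t.2 '' (R.decomp h t.1 : Set (L n × Euc d))

/-! Compatibility with translation. -/

theorem placedSupp_shift (R : FusionData d L) (n : ℕ) (v : Euc d) (t : L n × Euc d) :
    R.placedSupp n (shift v t) = Homeomorph.addRight v '' R.placedSupp n t := by
  simp only [placedSupp, shift, Set.image_image]
  ext y
  simp [add_assoc]

theorem region_shift (R : FusionData d L) (n : ℕ) (v : Euc d) (T : Set (L n × Euc d)) :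
    R.region n (shift v '' T) = Homeomorph.addRight v '' R.region n T := by
  simp only [region, Set.biUnion_image, placedSupp_shift, Set.image_iUnion]

theorem NonOverlapping.shift {R : FusionData d L} {n : ℕ} {T : Set (L n × Euc d)}
    (hT : R.NonOverlapping n T) (v : Euc d) : R.NonOverlapping n (shift v '' T) := by
  rintro _ ⟨t, ht, rfl⟩ _ ⟨t', ht', rfl⟩ hne
  rw [placedSupp_shift, placedSupp_shift, ← Homeomorph.image_frontier,
    ← Homeomorph.image_frontier, ← Set.image_inter (Homeomorph.injective _),
    ← Set.image_inter (Homeomorph.injective _)]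
  exact Set.image_mono (hT t ht t' ht' fun h => hne (by rw [h]))

theorem IsPatch.shift {R : FusionData d L} {n : ℕ} {P : Finset (L n × Euc d)}
    (hP : R.IsPatch n P) (v : Euc d) : R.IsPatch n (P.map (shift v).toEmbedding) := by
  obtain ⟨h1, h2, h3⟩ := hP
  refine ⟨h1.map, ?_, ?_⟩
  · rw [Finset.coe_map]
    exact h2.shift v
  · rw [Finset.coe_map]
    change IsConnected (R.region n (Fusion.shift v '' (P : Set (L n × Euc d))))
    rw [region_shift]
    exact h3.image _ (Homeomorph.continuous _).continuousOn

theorem map_shift_shift {X : Type*} (u v : Euc d) (P : Finset (X × Euc d)) :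
    (P.map (shift u).toEmbedding).map (shift v).toEmbedding =
      P.map (shift (u + v)).toEmbedding := by
  rw [Finset.map_map]
  congr 1
  ext t <;> simp [shift, add_assoc]

theorem map_shift_zero {X : Type*} (P : Finset (X × Euc d)) :
    P.map (shift (0 : Euc d)).toEmbedding = P := by
  have : shift (0 : Euc d) = Equiv.refl (X × Euc d) := by
    ext t <;> simp [shift]
  rw [this]
  exact Finset.map_refl

section Metric

variable [∀ n, MetricSpace (L n)]

/-- The distance between two translated `n`-supertiles. -/
def tileDist (R : FusionData d L) (n : ℕ) (t t' : L n × Euc d) : ℝ :=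
  max (Metric.hausdorffDist (R.placedSupp n t) (R.placedSupp n t')) (dist t.1 t'.1)

/-- Two finite sets of translated `n`-supertiles differ by at most `ε`: there is a one-to-one
correspondence between their members that moves each member by at most `ε`. -/
def DifferAtMost (R : FusionData d L) (n : ℕ) (ε : ℝ) (P P' : Finset (L n × Euc d)) : Prop :=
  ∃ e : P ≃ P', ∀ t : P, R.tileDist n t (e t) ≤ ε

/-- The axioms of a (compact) fusion rule. In the first one, the homeomorphism with the closed unit
ball matches the interior of the support with the open ball, which is automatic by invariance of
domain. -/
structure IsFusionRule (R : FusionData d L) : Prop where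
  proto_ball : ∀ c : L 0, ∃ e : (R.proto c : Set (Euc d)) ≃ₜ Metric.closedBall (0 : Euc d) 1,
    ∀ x : (R.proto c : Set (Euc d)),
      (x : Euc d) ∈ interior (R.proto c : Set (Euc d)) ↔ (e x : Euc d) ∈ Metric.ball 0 1
  proto_frontier : ∀ c : L 0, volume (frontier (R.proto c : Set (Euc d))) = 0
  proto_continuous : Continuous R.proto
  pieces_patch : ∀ (n : ℕ) (c : L (n + 1)), R.IsPatch n (R.pieces n c)
  pieces_continuous : ∀ (n : ℕ) (c : L (n + 1)), ∀ ε > 0, ∃ δ > 0, ∀ c' : L (n + 1),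
    dist c c' < δ → R.DifferAtMost n ε (R.pieces n c) (R.pieces n c')

/-- A finite patch of `n`-supertiles is admitted if it can be approximated arbitrarily well by
subsets of (translates of) supertiles of level at least `n`. -/
def Admitted (R : FusionData d L) (n : ℕ) (P : Finset (L n × Euc d)) : Prop :=
  ∀ ε > 0, ∃ (N : ℕ) (h : n ≤ N) (c : L N) (v : Euc d) (F : Finset (L n × Euc d)),
    F ⊆ (R.decomp h c).map (shift v).toEmbedding ∧ R.DifferAtMost n ε P F

/-- The space `Ω^{(n)}` of fusion tilings with prototile set `P_n`; `R.Omega 0` is the space of all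
fusion tilings of the fusion rule. -/
def Omega (R : FusionData d L) (n : ℕ) : Set (Set (L n × Euc d)) :=
  {T | R.IsTiling n T ∧
    ∀ P : Finset (L n × Euc d), (P : Set (L n × Euc d)) ⊆ T → R.IsPatch n P → R.Admitted n P}

/-! The spaces `Ω^{(n)}` are invariant under translation. -/

theorem tileDist_shift (R : FusionData d L) (n : ℕ) (v : Euc d) (t t' : L n × Euc d) :
    R.tileDist n (shift v t) (shift v t') = R.tileDist n t t' := by
  unfold tileDist
  rw [placedSupp_shift, placedSupp_shift]
  congr 1
  exact Metric.hausdorffDist_image (Φ := fun y : Euc d => y + v) (isometry_add_right v)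

theorem DifferAtMost.shift {R : FusionData d L} {n : ℕ} {ε : ℝ} {P P' : Finset (L n × Euc d)}
    (h : R.DifferAtMost n ε P P') (v : Euc d) :
    R.DifferAtMost n ε (P.map (shift v).toEmbedding) (P'.map (shift v).toEmbedding) := by
  obtain ⟨e, he⟩ := h
  have key : ∀ (Q : Finset (L n × Euc d)) (t : L n × Euc d),
      t ∈ Q ↔ Fusion.shift v t ∈ Q.map (Fusion.shift v).toEmbedding := fun Q t =>
    (Finset.mem_map' (Fusion.shift v).toEmbedding).symm
  refine ⟨((Equiv.subtypeEquiv (Fusion.shift v) (key P)).symm.trans e).trans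
    (Equiv.subtypeEquiv (Fusion.shift v) (key P')), ?_⟩
  intro t
  obtain ⟨s, rfl⟩ := (Equiv.subtypeEquiv (Fusion.shift v) (key P)).surjective t
  simpa [tileDist_shift] using he s

theorem Admitted.shift {R : FusionData d L} {n : ℕ} {P : Finset (L n × Euc d)}
    (hP : R.Admitted n P) (v : Euc d) : R.Admitted n (P.map (shift v).toEmbedding) := by
  intro ε hε
  obtain ⟨N, h, c, u, F, hF, hd⟩ := hP ε hε
  refine ⟨N, h, c, u + v, F.map (Fusion.shift v).toEmbedding, ?_, hd.shift v⟩
  rw [← map_shift_shift]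
  exact Finset.map_subset_map.2 hF

theorem shift_mem_Omega {R : FusionData d L} {n : ℕ} {T : Set (L n × Euc d)}
    (hT : T ∈ R.Omega n) (v : Euc d) : shift v '' T ∈ R.Omega n := by
  obtain ⟨⟨h1, h2⟩, h3⟩ := hT
  refine ⟨⟨h1.shift v, ?_⟩, ?_⟩
  · rw [region_shift, h2, Set.image_univ, (Homeomorph.surjective _).range_eq]
  · intro P hPT hP
    have hsub : ((P.map (shift (-v)).toEmbedding : Finset _) : Set (L n × Euc d)) ⊆ T := by
      intro s hs
      rw [Finset.coe_map] at hs
      obtain ⟨p, hp, rfl⟩ := hs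
      obtain ⟨t, ht, rfl⟩ := hPT hp
      have hst : shift (-v) (shift v t) = t := by
        ext <;> simp [shift]
      change shift (-v) (shift v t) ∈ T
      rwa [hst]
    have := (h3 _ hsub (hP.shift (-v))).shift v
    rwa [map_shift_shift, neg_add_cancel, map_shift_zero] at this

/-- The fusion tiling space `Ω_R`, as a type. -/
def Hull (R : FusionData d L) : Type _ := {T : Set (L 0 × Euc d) // T ∈ R.Omega 0}

/-- The translate `T - v` of a fusion tiling `T`. -/
def translate (R : FusionData d L) (v : Euc d) (T : R.Hull) : R.Hull :=
  ⟨shift (-v) '' T.1, shift_mem_Omega T.2 (-v)⟩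

/-- The tiling metric: the infimum of all `ε ≤ 1` such that the two tilings have finite patches that
contain the ball of radius `1 / ε` around the origin and differ by at most `ε`, and `1` if there is
no such `ε`. -/
def tilingDist (R : FusionData d L) (T T' : R.Hull) : ℝ :=
  sInf (insert 1 {ε : ℝ | 0 < ε ∧ ε ≤ 1 ∧ ∃ P P' : Finset (L 0 × Euc d),
    (P : Set (L 0 × Euc d)) ⊆ T.1 ∧ (P' : Set (L 0 × Euc d)) ⊆ T'.1 ∧
    R.IsPatch 0 P ∧ R.IsPatch 0 P' ∧
    Metric.closedBall 0 (1 / ε) ⊆ R.region 0 P ∧ Metric.closedBall 0 (1 / ε) ⊆ R.region 0 P' ∧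
    R.DifferAtMost 0 ε P P'})

/-- The topology of the tiling metric. -/
instance (R : FusionData d L) : TopologicalSpace R.Hull where
  IsOpen V := ∀ T ∈ V, ∃ ε > 0, ∀ T', R.tilingDist T T' < ε → T' ∈ V
  isOpen_univ := fun _ _ => ⟨1, one_pos, fun _ _ => Set.mem_univ _⟩
  isOpen_inter := by
    intro V W hV hW T hT
    obtain ⟨ε, hε, h1⟩ := hV T hT.1
    obtain ⟨η, hη, h2⟩ := hW T hT.2
    exact ⟨min ε η, lt_min hε hη, fun T' h =>
      ⟨h1 T' (h.trans_le (min_le_left _ _)), h2 T' (h.trans_le (min_le_right _ _))⟩⟩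
  isOpen_sUnion := by
    rintro s hs T ⟨V, hVs, hTV⟩
    obtain ⟨ε, hε, h⟩ := hs V hVs T hTV
    exact ⟨ε, hε, fun T' h' => ⟨V, hVs, h T' h'⟩⟩

instance (R : FusionData d L) : MeasurableSpace R.Hull := borel _

instance (R : FusionData d L) : BorelSpace R.Hull := ⟨rfl⟩

/-- Every sequence of supports of one `n`-supertile for each `n` is a van Hove sequence. -/
def VanHove (R : FusionData d L) : Prop :=
  ∀ c : ∀ n, L n, ∀ r : ℝ, 0 ≤ r →
    Tendsto (fun n => volume (Metric.cthickening r (frontier (R.supp n (c n)))) /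
      volume (R.supp n (c n))) atTop (𝓝 0)

/-- Recognizability: every tiling by `n`-supertiles can be decomposed in a unique way into
`(n + 1)`-supertiles, that is, the subdivision map from `Ω^{(n+1)}` to `Ω^{(n)}` is one-to-one
and onto. -/
def Recognizable (R : FusionData d L) : Prop :=
  ∀ n : ℕ, ∀ T ∈ R.Omega n, ∃! T' : Set (L (n + 1) × Euc d),
    T' ∈ R.Omega (n + 1) ∧ R.subdivide (Nat.le_succ n) T' = T

/-- The set of all `n`-supertiles is trim: for some non-empty open set `U`, a tiling in `Ω^{(n)}`
has at most one supertile whose control point lies in `U`. -/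
def SupertilesTrim (R : FusionData d L) : Prop :=
  ∀ n : ℕ, ∃ U : Set (Euc d), IsOpen U ∧ U.Nonempty ∧ ∀ T ∈ R.Omega n, ∀ t ∈ T, ∀ t' ∈ T,
    t.2 ∈ U → t'.2 ∈ U → t = t'

/-- Translation invariance of a measure on the tiling space. -/
def Invariant (R : FusionData d L) (μ : Measure R.Hull) : Prop :=
  ∀ (v : Euc d) (A : Set R.Hull), MeasurableSet A → μ (R.translate v ⁻¹' A) = μ A

/-- The cylinder set `Ω_{I,U}` of a set `I` of patches. -/
def cylinder (R : FusionData d L) (I : Set (Finset (L 0 × Euc d))) (U : Set (Euc d)) :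
    Set R.Hull :=
  {T | ∃ P ∈ I, ∃ v ∈ U, (P : Set (L 0 × Euc d)) ⊆ (R.translate v T).1}

/-- `I` is trim, and `U` is a non-empty open set that witnesses this: for every tiling `T` there is
at most one `(P, v) ∈ I × U` such that `T - v` contains `P`. -/
def IsTrimWith (R : FusionData d L) (I : Set (Finset (L 0 × Euc d))) (U : Set (Euc d)) : Prop :=
  IsOpen U ∧ U.Nonempty ∧ ∀ T : R.Hull, ∀ P ∈ I, ∀ Q ∈ I, ∀ u ∈ U, ∀ v ∈ U,
    (P : Set (L 0 × Euc d)) ⊆ (R.translate u T).1 →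
    (Q : Set (L 0 × Euc d)) ⊆ (R.translate v T).1 → P = Q ∧ u = v

/-- The number `#(I in P_n(c))` of translates of patches in `I` that are subsets of `P_n(c)`. -/
def patchCount (R : FusionData d L) (I : Set (Finset (L 0 × Euc d))) (n : ℕ) (c : L n) : ℕ :=
  {S : Finset (L 0 × Euc d) | S ⊆ R.decomp (Nat.zero_le n) c ∧
    ∃ P ∈ I, ∃ v : Euc d, S = P.map (shift v).toEmbedding}.ncard

/-- The set of `T ∈ Ω_R` such that, for some `(c, v) ∈ I × U`, the decomposition of `T - v` into
`n`-supertiles contains `P_n(c)`. -/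
def supertileCylinder (R : FusionData d L) (n : ℕ) (I : Set (L n)) (U : Set (Euc d)) :
    Set R.Hull :=
  {T | ∃ T' ∈ R.Omega n, R.subdivide (Nat.zero_le n) T' = T.1 ∧ ∃ c ∈ I, ∃ v ∈ U, (c, v) ∈ T'}

variable [∀ n, MeasurableSpace (L n)]

open Classical in
/-- A measurable set of finite patches modulo translation: the members of `I` represent distinct
translation classes, and for each `k` the members with `k` tiles form a measurable set in the space
of unordered `k`-tuples of tiles. -/
structure IsPatchFamily (R : FusionData d L) (I : Set (Finset (L 0 × Euc d))) : Prop where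
  patch : ∀ P ∈ I, R.IsPatch 0 P
  inequivalent : ∀ P ∈ I, ∀ v : Euc d, P.map (shift v).toEmbedding ∈ I → v = 0
  measurable : ∀ k : ℕ, MeasurableSet
    {f : Fin k → L 0 × Euc d | Function.Injective f ∧ Finset.univ.image f ∈ I}

/-- `ρ` is the frequency measure induced by `μ` on the space of `n`-supertiles:
`ρ(I) = μ(Ω_{I,U}) / Vol(U)` for all open sets `U` that are so small that a tiling has at most one
supertile from `I` with control point in `U`. -/
def IsFrequencyMeasure (R : FusionData d L) (μ : Measure R.Hull) (n : ℕ) (ρ : Measure (L n)) :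
    Prop :=
  ∀ I : Set (L n), MeasurableSet I → ∀ U : Set (Euc d), IsOpen U → U.Nonempty →
    (∀ T ∈ R.Omega n, ∀ t ∈ T, ∀ t' ∈ T, t.1 ∈ I → t'.1 ∈ I → t.2 ∈ U → t'.2 ∈ U → t = t') →
    ρ I = μ (R.supertileCylinder n I U) / volume U

/-- Each `ρ_n` satisfies `∫ Vol(P) dρ_n = 1`. -/
def VolumeNormalized (R : FusionData d L) (ρ : ∀ n, Measure (L n)) : Prop :=
  ∀ n, ∫⁻ c, volume (R.supp n c) ∂(ρ n) = 1

/-- `ρ_n = M_{n,N} ρ_N` for all `n < N`. -/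
def TransitionConsistent (R : FusionData d L) (ρ : ∀ n, Measure (L n)) : Prop :=
  ∀ (n N : ℕ) (h : n < N) (I : Set (L n)), MeasurableSet I →
    ρ n I = ∫⁻ c, (R.labelCount h.le I c : ℝ≥0∞) ∂(ρ N)

/-- For every trim set `I` of patches, the frequency `μ(Ω_{I,U}) / Vol(U)` of `I` is the limit of
`∫ #(I in P) dρ_n`. -/
def FrequencyFormula (R : FusionData d L) (μ : Measure R.Hull) (ρ : ∀ n, Measure (L n)) : Prop :=
  ∀ I : Set (Finset (L 0 × Euc d)), R.IsPatchFamily I → ∀ U : Set (Euc d), R.IsTrimWith I U →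
    Tendsto (fun n => ∫⁻ c, (R.patchCount I n c : ℝ≥0∞) ∂(ρ n)) atTop
      (𝓝 (μ (R.cylinder I U) / volume U))

end Metric

end FusionData

end Fusion

end

/-!
A fusion tiling is studied through its hierarchy of supertiles. By recognizability a tiling `T` has
exactly one decomposition `level n T` into `n`-supertiles (`existsUnique_subdivide`). Trimness makes
control points uniformly discrete, so that the tiles of a tiling can be enumerated measurably, and
the Borel structure of the tiling metric is generated by the events that a tile lies in a given open
set (`measurable_of_hitMeasurable`). Since subdivision is injective, the Lusin–Souslin theorem shows
that `level n T` depends measurably on `T` (`hitMeasurable_level`).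

*From measures to sequences.* For an invariant `μ`, the expected number of `n`-supertiles with given
labels and control points is a translation invariant measure on `ℒ_n × ℝ^d`, hence a product of some
`ρ n` with Lebesgue measure (`exists_eq_prod_volume`, `exists_isIntensity`). All properties of `ρ`
are evaluations of this identity: at the supertile around the origin for the volume normalization
(`lintegral_volume_supp`), at the constituents of supertiles for transition consistency
(`transition`), and at the patches that lie inside a single supertile for the frequency formula
(`lintegral_patchCount`). The van Hove property ensures that almost surely every ball around the
origin is contained in one supertile (`ae_exists_closedBall_subset`), so that no patch is lost in
the limit (`frequencyFormula`).

*From sequences to measures.* For a given sequence `ρ`, restricting `ρ n × Lebesgue` to the placed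
supertiles that contain the origin gives a probability measure `rootMeasure`, by the volume
normalization. Transition consistency says that the laws of consecutive levels are the marginals of
a law of pairs of which the first member is a constituent of the second (`exists_coupling`). The
Markov chain with these transitions (`exists_measure_map_eq`) is a random sequence of growing
supertiles around the origin. By the van Hove property they almost surely exhaust the space
(`ae_mem_goodPaths`), and their union is a random tiling (`pathHull`). A translation affects the law
of the supertile around the origin only near the boundary (`rootMeasure_subHitSet_image_le`), which
makes the law of the tiling invariant (`invariant_map_pathHull`); its intensities are the given
measures (`isIntensity_map_pathHull`).

*Uniqueness.* An invariant measure is determined by its Palm measure, the law of the tiling as seen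
from a typical control point (`IsPalm.apply_eq`). The Palm measure of the event that one of a trim
set of patches with a control point at the origin occurs is the frequency of this set
(`IsPalm.mul_volume_eq`), so it remains to see that such events determine a measure. The collections
of tiles that meet a large ball and hit given open sets (`blocks`) would suffice, were they not
translates of each other in general. Sorting them by the rank of the origin among their control
points in the lexicographic order removes this obstruction: a nontrivial translation that replaces the
control point at the origin by another one changes the rank (`eq_zero_of_rank_map_eq`,
`IsPalm.eq_of_frequencyFormula`).
-/

noncomputable section

namespace Fusion

namespace FusionData

set_option linter.unusedSectionVars false

variable {d : ℕ} {L : ℕ → Type*} {R : FusionData d L}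

/-! ### Supports of supertiles -/

@[simp] theorem shift_apply {X : Type*} (v : Euc d) (t : X × Euc d) :
    shift v t = (t.1, t.2 + v) := rfl

theorem supp_succ (n : ℕ) (c : L (n + 1)) :
    R.supp (n + 1) c = R.region n (R.pieces n c : Set (L n × Euc d)) := by
  simp [supp, region, placedSupp]

theorem mem_placedSupp {n : ℕ} {t : L n × Euc d} {y : Euc d} :
    y ∈ R.placedSupp n t ↔ y - t.2 ∈ R.supp n t.1 := by
  constructor
  · rintro ⟨z, hz, rfl⟩
    simpa using hz
  · intro h
    exact ⟨_, h, by simp⟩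

theorem mem_region {n : ℕ} {T : Set (L n × Euc d)} {y : Euc d} :
    y ∈ R.region n T ↔ ∃ t ∈ T, y ∈ R.placedSupp n t := by
  simp [region]

theorem placedSupp_eq_image (n : ℕ) (t : L n × Euc d) :
    R.placedSupp n t = Homeomorph.addRight t.2 '' R.supp n t.1 := rfl

theorem placedSupp_subset_region {n : ℕ} {T : Set (L n × Euc d)} {t : L n × Euc d} (ht : t ∈ T) :
    R.placedSupp n t ⊆ R.region n T := fun _ hy => mem_region.2 ⟨t, ht, hy⟩

theorem isCompact_supp (n : ℕ) (c : L n) : IsCompact (R.supp n c) := by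
  induction n with
  | zero => exact (R.proto c).isCompact
  | succ n ih =>
    rw [supp_succ]
    exact (R.pieces n c).finite_toSet.isCompact_biUnion fun t _ =>
      (ih t.1).image (Homeomorph.addRight t.2).continuous

theorem isCompact_placedSupp (n : ℕ) (t : L n × Euc d) : IsCompact (R.placedSupp n t) :=
  (isCompact_supp n t.1).image (Homeomorph.addRight t.2).continuous

theorem isClosed_placedSupp (n : ℕ) (t : L n × Euc d) : IsClosed (R.placedSupp n t) :=
  (isCompact_placedSupp n t).isClosed

theorem volume_placedSupp (n : ℕ) (t : L n × Euc d) :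
    volume (R.placedSupp n t) = volume (R.supp n t.1) := by
  rw [placedSupp, ← measure_preimage_add_right volume t.2 ((fun y => y + t.2) '' R.supp n t.1),
    preimage_image_eq _ (add_left_injective t.2)]

theorem frontier_placedSupp (n : ℕ) (t : L n × Euc d) :
    frontier (R.placedSupp n t) = (fun y => y + t.2) '' frontier (R.supp n t.1) := by
  rw [placedSupp_eq_image, ← Homeomorph.image_frontier]
  rfl

theorem volume_frontier_placedSupp (n : ℕ) (t : L n × Euc d) :
    volume (frontier (R.placedSupp n t)) = volume (frontier (R.supp n t.1)) := by
  rw [frontier_placedSupp, ← measure_preimage_add_right volume t.2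
    ((fun y => y + t.2) '' frontier (R.supp n t.1)), preimage_image_eq _ (add_left_injective t.2)]

/-- The frontier of a finite union is covered by the frontiers of its members. -/
theorem frontier_region_subset (n : ℕ) (P : Finset (L n × Euc d)) :
    frontier (R.region n (P : Set (L n × Euc d))) ⊆ ⋃ t ∈ P, frontier (R.placedSupp n t) := by
  intro y hy
  have hcl : IsClosed (R.region n (P : Set (L n × Euc d))) :=
    P.finite_toSet.isClosed_biUnion fun t _ => isClosed_placedSupp n t
  rw [hcl.frontier_eq] at hy
  obtain ⟨t, ht, hyt⟩ := mem_region.1 hy.1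
  refine mem_biUnion ht ?_
  rw [(isClosed_placedSupp n t).frontier_eq]
  exact ⟨hyt, fun h => hy.2 (interior_mono (placedSupp_subset_region ht) h)⟩

theorem closure_interior_placedSupp_of {n : ℕ} {t : L n × Euc d}
    (h : closure (interior (R.supp n t.1)) = R.supp n t.1) :
    closure (interior (R.placedSupp n t)) = R.placedSupp n t := by
  rw [placedSupp_eq_image, ← Homeomorph.image_interior, ← Homeomorph.image_closure, h]

theorem volume_supp_ne_top (n : ℕ) (c : L n) : volume (R.supp n c) ≠ ∞ :=
  (isCompact_supp n c).measure_lt_top.ne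

section Metric

variable [∀ n, MetricSpace (L n)]

theorem IsFusionRule.supp_nonempty (hR : R.IsFusionRule) (n : ℕ) (c : L n) :
    (R.supp n c).Nonempty := by
  cases n with
  | zero => exact (R.proto c).nonempty
  | succ n => rw [supp_succ]; exact (hR.pieces_patch n c).2.2.nonempty

theorem IsFusionRule.placedSupp_nonempty (hR : R.IsFusionRule) (n : ℕ) (t : L n × Euc d) :
    (R.placedSupp n t).Nonempty := (hR.supp_nonempty n t.1).image _

theorem IsFusionRule.isConnected_supp (hR : R.IsFusionRule) (n : ℕ) (c : L n) :
    IsConnected (R.supp n c) := by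
  cases n with
  | zero =>
    obtain ⟨e, -⟩ := hR.proto_ball c
    have hb : IsConnected (Metric.closedBall (0 : Euc d) 1) :=
      (convex_closedBall 0 1).isConnected ⟨0, by simp⟩
    have : ConnectedSpace (Metric.closedBall (0 : Euc d) 1) :=
      isConnected_iff_connectedSpace.1 hb
    have := isConnected_range (f := fun x => ((e.symm x : (R.proto c : Set (Euc d))) : Euc d))
      (by fun_prop)
    convert this using 1
    ext y
    constructor
    · intro hy
      exact ⟨e ⟨y, hy⟩, by simp⟩
    · rintro ⟨x, rfl⟩
      exact (e.symm x).2
  | succ n => rw [supp_succ]; exact (hR.pieces_patch n c).2.2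

theorem IsFusionRule.isConnected_placedSupp (hR : R.IsFusionRule) (n : ℕ) (t : L n × Euc d) :
    IsConnected (R.placedSupp n t) :=
  (hR.isConnected_supp n t.1).image _ (Homeomorph.addRight t.2).continuous.continuousOn

/-- Supports are regular closed sets. -/
theorem IsFusionRule.closure_interior_supp (hR : R.IsFusionRule) (n : ℕ) (c : L n) :
    closure (interior (R.supp n c)) = R.supp n c := by
  induction n with
  | zero =>
    refine subset_antisymm (closure_minimal interior_subset (isCompact_supp 0 c).isClosed) ?_
    intro y hy
    obtain ⟨e, he⟩ := hR.proto_ball c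
    have h1 : ((e ⟨y, hy⟩ : Metric.closedBall (0 : Euc d) 1) : Euc d) ∈
        closure (Metric.ball (0 : Euc d) 1) := by
      rw [closure_ball _ one_ne_zero]
      exact (e ⟨y, hy⟩).2
    have h2 : e ⟨y, hy⟩ ∈ closure {x : Metric.closedBall (0 : Euc d) 1 |
        (x : Euc d) ∈ Metric.ball (0 : Euc d) 1} := by
      rw [closure_subtype]
      convert h1 using 2
      ext z
      constructor
      · rintro ⟨x, hx, rfl⟩
        exact hx
      · intro hz
        exact ⟨⟨z, Metric.ball_subset_closedBall hz⟩, hz, rfl⟩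
    have hcont : Continuous fun x => ((e.symm x : (R.proto c : Set (Euc d))) : Euc d) := by
      fun_prop
    have h3 := image_closure_subset_closure_image hcont (mem_image_of_mem _ h2)
    simp only [Homeomorph.symm_apply_apply] at h3
    refine closure_mono ?_ h3
    rintro _ ⟨x, hx, rfl⟩
    refine (he (e.symm x)).2 ?_
    simpa using hx
  | succ n ih =>
    refine subset_antisymm (closure_minimal interior_subset (isCompact_supp _ c).isClosed) ?_
    intro y hy
    have hy' := hy
    rw [supp_succ] at hy'
    obtain ⟨t, ht, hyt⟩ := mem_region.1 hy'
    rw [← closure_interior_placedSupp_of (ih t.1)] at hyt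
    refine closure_mono (interior_mono ?_) hyt
    rw [supp_succ]
    exact placedSupp_subset_region ht

theorem IsFusionRule.closure_interior_placedSupp (hR : R.IsFusionRule) (n : ℕ)
    (t : L n × Euc d) : closure (interior (R.placedSupp n t)) = R.placedSupp n t :=
  closure_interior_placedSupp_of (hR.closure_interior_supp n t.1)

theorem IsFusionRule.interior_placedSupp_nonempty (hR : R.IsFusionRule) (n : ℕ)
    (t : L n × Euc d) : (interior (R.placedSupp n t)).Nonempty := by
  rw [← closure_nonempty_iff, hR.closure_interior_placedSupp]
  exact hR.placedSupp_nonempty n t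

theorem IsFusionRule.volume_frontier_supp (hR : R.IsFusionRule) (n : ℕ) (c : L n) :
    volume (frontier (R.supp n c)) = 0 := by
  induction n with
  | zero => exact hR.proto_frontier c
  | succ n ih =>
    rw [supp_succ]
    refine measure_mono_null (frontier_region_subset n _) ?_
    refine (measure_biUnion_null_iff (R.pieces n c).countable_toSet).2 fun t _ => ?_
    rw [volume_frontier_placedSupp, ih]

theorem IsFusionRule.volume_supp_pos (hR : R.IsFusionRule) (n : ℕ) (c : L n) :
    0 < volume (R.supp n c) := by
  have h := hR.interior_placedSupp_nonempty n (c, 0)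
  rw [← volume_placedSupp (R := R) n (c, 0)]
  exact (isOpen_interior.measure_pos volume h).trans_le (measure_mono interior_subset)

/-! ### The tile distance and the product topology -/

theorem IsFusionRule.hausdorffEDist_ne_top (hR : R.IsFusionRule) (n : ℕ) (t s : L n × Euc d) :
    Metric.hausdorffEDist (R.placedSupp n t) (R.placedSupp n s) ≠ ∞ :=
  Metric.hausdorffEDist_ne_top_of_nonempty_of_bounded (hR.placedSupp_nonempty n t)
    (hR.placedSupp_nonempty n s) (isCompact_placedSupp n t).isBounded
    (isCompact_placedSupp n s).isBounded

theorem hausdorffDist_le_tileDist (n : ℕ) (t s : L n × Euc d) :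
    Metric.hausdorffDist (R.placedSupp n t) (R.placedSupp n s) ≤ R.tileDist n t s :=
  le_max_left _ _

theorem dist_le_tileDist (n : ℕ) (t s : L n × Euc d) :
    dist t.1 s.1 ≤ R.tileDist n t s := le_max_right _ _

theorem tileDist_comm (n : ℕ) (t s : L n × Euc d) : R.tileDist n t s = R.tileDist n s t := by
  unfold tileDist
  rw [Metric.hausdorffDist_comm, dist_comm]

@[simp] theorem tileDist_self (n : ℕ) (t : L n × Euc d) : R.tileDist n t t = 0 := by
  simp [tileDist, Metric.hausdorffDist_self_zero]

theorem IsFusionRule.tileDist_triangle (hR : R.IsFusionRule) (n : ℕ) (s t u : L n × Euc d) :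
    R.tileDist n s u ≤ R.tileDist n s t + R.tileDist n t u := by
  refine max_le ?_ ?_
  · exact (Metric.hausdorffDist_triangle (hR.hausdorffEDist_ne_top n s t)).trans
      (add_le_add (hausdorffDist_le_tileDist n s t) (hausdorffDist_le_tileDist n t u))
  · exact (dist_triangle _ _ _).trans
      (add_le_add (dist_le_tileDist n s t) (dist_le_tileDist n t u))

theorem IsFusionRule.exists_mem_dist_lt (hR : R.IsFusionRule) {n : ℕ} {t s : L n × Euc d}
    {ε : ℝ} (h : R.tileDist n t s < ε) {y : Euc d} (hy : y ∈ R.placedSupp n t) :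
    ∃ z ∈ R.placedSupp n s, dist y z < ε :=
  Metric.exists_dist_lt_of_hausdorffDist_lt hy
    ((hausdorffDist_le_tileDist n t s).trans_lt h) (hR.hausdorffEDist_ne_top n t s)

/-- Translating a compact set moves it in the Hausdorff distance by the length of the translation:
compare the points that are extremal in the direction of the translation. -/
theorem dist_le_hausdorffDist_translate {K : Set (Euc d)} (hK : IsCompact K) (hne : K.Nonempty)
    (x y : Euc d) :
    dist x y ≤ Metric.hausdorffDist ((fun z => z + x) '' K) ((fun z => z + y) '' K) := by
  have hKx : IsCompact ((fun z => z + x) '' K) := hK.image (by fun_prop)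
  have hKy : IsCompact ((fun z => z + y) '' K) := hK.image (by fun_prop)
  have hfin := Metric.hausdorffEDist_ne_top_of_nonempty_of_bounded (hne.image (fun z => z + y))
    (hne.image (fun z => z + x)) hKy.isBounded hKx.isBounded
  rw [Metric.hausdorffDist_comm]
  obtain ⟨p, hpK, hp⟩ := hK.exists_isMaxOn hne
    (f := fun z => inner ℝ z (y - x)) (by fun_prop)
  refine le_of_forall_gt fun r hr => ?_
  obtain ⟨_, ⟨q, hq, rfl⟩, hqr⟩ := Metric.exists_dist_lt_of_hausdorffDist_lt
    (mem_image_of_mem (fun z => z + y) hpK) hr hfin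
  refine lt_of_le_of_lt ?_ hqr
  have h1 : inner ℝ q (y - x) ≤ inner ℝ p (y - x) := hp hq
  have h2 : ‖y - x‖ * ‖y - x‖ ≤ ‖(p + y) - (q + x)‖ * ‖y - x‖ := by
    refine le_trans ?_ (real_inner_le_norm _ _)
    have : (p + y) - (q + x) = (p - q) + (y - x) := by abel
    rw [this, inner_add_left, inner_sub_left, real_inner_self_eq_norm_mul_norm]
    linarith
  rw [dist_comm, dist_eq_norm, dist_eq_norm]
  rcases (norm_nonneg (y - x)).eq_or_lt with h | h
  · rw [← h]; positivity
  · exact le_of_mul_le_mul_right h2 h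

theorem hausdorffDist_translate_le {K : Set (Euc d)} (x y : Euc d) :
    Metric.hausdorffDist ((fun z => z + x) '' K) ((fun z => z + y) '' K) ≤ dist x y := by
  refine Metric.hausdorffDist_le_of_mem_dist dist_nonneg ?_ ?_
  · rintro _ ⟨z, hz, rfl⟩
    exact ⟨z + y, ⟨z, hz, rfl⟩, by simp⟩
  · rintro _ ⟨z, hz, rfl⟩
    exact ⟨z + x, ⟨z, hz, rfl⟩, by simp [dist_comm]⟩

theorem tileDist_zero_le_of_hausdorffDist {n : ℕ} {c c' : L n} {ε : ℝ}
    (h1 : Metric.hausdorffDist (R.supp n c) (R.supp n c') ≤ ε) (h2 : dist c c' ≤ ε) (x : Euc d) :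
    R.tileDist n (c, x) (c', x) ≤ ε := by
  refine max_le ?_ h2
  unfold placedSupp
  rwa [Metric.hausdorffDist_image (Φ := fun y : Euc d => y + x) (isometry_add_right x)]

/-- The support of a supertile depends continuously on the label. -/
theorem IsFusionRule.exists_hausdorffDist_supp_le (hR : R.IsFusionRule) (n : ℕ) (c : L n)
    {ε : ℝ} (hε : 0 < ε) :
    ∃ δ > 0, ∀ c', dist c c' < δ → Metric.hausdorffDist (R.supp n c) (R.supp n c') ≤ ε := by
  cases n with
  | zero =>
    obtain ⟨δ, hδ, h⟩ := Metric.continuous_iff.1 hR.proto_continuous c ε hε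
    refine ⟨δ, hδ, fun c' hc' => ?_⟩
    have := (h c' (by rwa [dist_comm])).le
    rwa [dist_comm, Metric.NonemptyCompacts.dist_eq] at this
  | succ n =>
    obtain ⟨δ, hδ, h⟩ := hR.pieces_continuous n c (ε / 2) (by positivity)
    refine ⟨δ, hδ, fun c' hc' => ?_⟩
    obtain ⟨e, he⟩ := h c' hc'
    rw [supp_succ, supp_succ]
    refine Metric.hausdorffDist_le_of_mem_dist hε.le ?_ ?_
    · intro y hy
      obtain ⟨t, ht, hyt⟩ := mem_region.1 hy
      obtain ⟨z, hz, hyz⟩ := hR.exists_mem_dist_lt ((he ⟨t, ht⟩).trans_lt (half_lt_self hε)) hyt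
      exact ⟨z, mem_region.2 ⟨_, (e ⟨t, ht⟩).2, hz⟩, hyz.le⟩
    · intro y hy
      obtain ⟨t, ht, hyt⟩ := mem_region.1 hy
      have h1 := he (e.symm ⟨t, ht⟩)
      rw [tileDist_comm, Equiv.apply_symm_apply] at h1
      obtain ⟨z, hz, hyz⟩ := hR.exists_mem_dist_lt (h1.trans_lt (half_lt_self hε)) hyt
      exact ⟨z, mem_region.2 ⟨_, (e.symm ⟨t, ht⟩).2, hz⟩, hyz.le⟩

theorem IsFusionRule.exists_tileDist_label_le (hR : R.IsFusionRule) (n : ℕ) (c : L n)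
    {ε : ℝ} (hε : 0 < ε) :
    ∃ δ > 0, ∀ c', dist c c' < δ → ∀ x : Euc d, R.tileDist n (c, x) (c', x) ≤ ε := by
  obtain ⟨δ, hδ, h⟩ := hR.exists_hausdorffDist_supp_le n c hε
  exact ⟨min δ ε, lt_min hδ hε, fun c' hc' x => tileDist_zero_le_of_hausdorffDist
    (h c' (hc'.trans_le (min_le_left _ _))) (hc'.le.trans (min_le_right _ _)) x⟩

theorem tileDist_translate_le (n : ℕ) (c : L n) (x y : Euc d) :
    R.tileDist n (c, x) (c, y) ≤ dist x y :=
  max_le (hausdorffDist_translate_le x y) (by simp)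

theorem IsFusionRule.dist_le_tileDist_translate (hR : R.IsFusionRule) (n : ℕ) (c : L n)
    (x y : Euc d) : dist x y ≤ R.tileDist n (c, x) (c, y) :=
  (dist_le_hausdorffDist_translate (isCompact_supp n c) (hR.supp_nonempty n c) x y).trans
    (hausdorffDist_le_tileDist n (c, x) (c, y))

/-- Tiles that are close in the tile distance are close in the product topology. -/
theorem IsFusionRule.exists_tileDist_le_imp_mem (hR : R.IsFusionRule) {n : ℕ} {t : L n × Euc d}
    {V : Set (L n × Euc d)} (hV : V ∈ 𝓝 t) :
    ∃ ε > 0, ∀ s, R.tileDist n t s ≤ ε → s ∈ V := by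
  obtain ⟨η, hη, hηV⟩ := Metric.mem_nhds_iff.1 hV
  obtain ⟨δ, hδ, h⟩ := hR.exists_tileDist_label_le n t.1 (ε := η / 3) (by positivity)
  refine ⟨min (δ / 2) (η / 3), by positivity, fun s hs => hηV ?_⟩
  have h1 : dist t.1 s.1 ≤ min (δ / 2) (η / 3) := (dist_le_tileDist n t s).trans hs
  have h2 : dist t.1 s.1 < δ := lt_of_le_of_lt (h1.trans (min_le_left _ _)) (half_lt_self hδ)
  have h3 : dist t.2 s.2 ≤ η / 3 + η / 3 := by
    refine (hR.dist_le_tileDist_translate n t.1 t.2 s.2).trans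
      ((hR.tileDist_triangle n _ s _).trans (add_le_add (hs.trans (min_le_right _ _)) ?_))
    have := h s.1 h2 s.2
    rwa [tileDist_comm] at this
  rw [Metric.mem_ball, Prod.dist_eq, dist_comm s.1, dist_comm s.2]
  exact max_lt (by linarith [h1.trans (min_le_right _ _)]) (by linarith)

theorem IsFusionRule.eventually_tileDist_lt (hR : R.IsFusionRule) {n : ℕ} (t : L n × Euc d)
    {ε : ℝ} (hε : 0 < ε) : ∀ᶠ s in 𝓝 t, R.tileDist n t s < ε := by
  obtain ⟨δ, hδ, h⟩ := hR.exists_tileDist_label_le n t.1 (ε := ε / 3) (by positivity)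
  refine Metric.eventually_nhds_iff.2 ⟨min δ (ε / 3), by positivity, fun s hs => ?_⟩
  rw [Prod.dist_eq, dist_comm s.1, dist_comm s.2, max_lt_iff, lt_min_iff, lt_min_iff] at hs
  have h1 := h s.1 hs.1.1 t.2
  have h2 := tileDist_translate_le (R := R) n s.1 t.2 s.2
  have := hR.tileDist_triangle n t (s.1, t.2) s
  have h3 : R.tileDist n t (s.1, t.2) ≤ ε / 3 := h1
  have h4 : R.tileDist n (s.1, t.2) s ≤ dist t.2 s.2 := h2
  linarith [hs.2.2]

theorem IsFusionRule.isOpen_inter_placedSupp_nonempty (hR : R.IsFusionRule) (n : ℕ)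
    {V : Set (Euc d)} (hV : IsOpen V) :
    IsOpen {t : L n × Euc d | (V ∩ R.placedSupp n t).Nonempty} := by
  refine isOpen_iff_mem_nhds.2 fun t ⟨y, hyV, hyt⟩ => ?_
  obtain ⟨ε, hε, h⟩ := Metric.isOpen_iff.1 hV y hyV
  filter_upwards [hR.eventually_tileDist_lt t hε] with s hs
  obtain ⟨z, hz, hyz⟩ := hR.exists_mem_dist_lt hs hyt
  exact ⟨z, h (by rwa [Metric.mem_ball, dist_comm]), hz⟩

theorem IsFusionRule.isClosed_mem_placedSupp (hR : R.IsFusionRule) (n : ℕ) (y : Euc d) :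
    IsClosed {t : L n × Euc d | y ∈ R.placedSupp n t} := by
  refine isOpen_compl_iff.1 (isOpen_iff_mem_nhds.2 fun t ht => ?_)
  obtain ⟨ε, hε, h⟩ := Metric.isOpen_iff.1 (isClosed_placedSupp n t).isOpen_compl y ht
  filter_upwards [hR.eventually_tileDist_lt t hε] with s hs hys
  rw [tileDist_comm] at hs
  obtain ⟨z, hz, hyz⟩ := hR.exists_mem_dist_lt hs hys
  exact h (by rwa [Metric.mem_ball, dist_comm]) hz

/-- The configurations of finitely many tiles that cover a given set form a closed set. -/
theorem IsFusionRule.isClosed_subset_iUnion_placedSupp (hR : R.IsFusionRule) (n : ℕ)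
    {ι : Type*} [Finite ι] (K : Set (Euc d)) :
    IsClosed {f : ι → L n × Euc d | K ⊆ ⋃ i, R.placedSupp n (f i)} := by
  have : {f : ι → L n × Euc d | K ⊆ ⋃ i, R.placedSupp n (f i)} =
      ⋂ y ∈ K, ⋃ i, {f : ι → L n × Euc d | y ∈ R.placedSupp n (f i)} := by
    ext f
    simp [subset_def]
  rw [this]
  exact isClosed_biInter fun y _ => isClosed_iUnion_of_finite fun i =>
    (hR.isClosed_mem_placedSupp n y).preimage (f := fun f : ι → L n × Euc d => f i)
      (continuous_apply i)

theorem IsFusionRule.isClosed_subset_placedSupp (hR : R.IsFusionRule) (n : ℕ)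
    (K : Set (Euc d)) : IsClosed {t : L n × Euc d | K ⊆ R.placedSupp n t} := by
  have : {t : L n × Euc d | K ⊆ R.placedSupp n t} =
      ⋂ y ∈ K, {t : L n × Euc d | y ∈ R.placedSupp n t} := by
    ext t
    simp [subset_def]
  rw [this]
  exact isClosed_biInter fun y _ => hR.isClosed_mem_placedSupp n y

/-- A bound for the size of all supports of `n`-supertiles. -/
theorem IsFusionRule.exists_supp_subset_closedBall [∀ n, CompactSpace (L n)]
    (hR : R.IsFusionRule) (n : ℕ) :
    ∃ r : ℝ, 0 < r ∧ ∀ c : L n, R.supp n c ⊆ Metric.closedBall 0 r := by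
  have hloc : ∀ c : L n, ∃ U ∈ 𝓝 c, ∃ r : ℝ, ∀ c' ∈ U, R.supp n c' ⊆ Metric.closedBall 0 r := by
    intro c
    obtain ⟨r, hr⟩ := (isCompact_supp (R := R) n c).isBounded.subset_closedBall 0
    obtain ⟨δ, hδ, h⟩ := hR.exists_tileDist_label_le n c (ε := 1) one_pos
    refine ⟨Metric.ball c δ, Metric.ball_mem_nhds c hδ, r + 2, fun c' hc' y hy => ?_⟩
    have h1 := h c' (by rwa [dist_comm]) 0
    rw [tileDist_comm] at h1
    obtain ⟨z, hz, hyz⟩ := hR.exists_mem_dist_lt (h1.trans_lt one_lt_two) (y := y)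
      (mem_placedSupp.2 (by simpa using hy))
    have h2 := hr (by simpa using mem_placedSupp.1 hz : z ∈ R.supp n c)
    rw [Metric.mem_closedBall] at h2 ⊢
    linarith [dist_triangle y z 0]
  choose U hU r hr using hloc
  obtain ⟨s, hs⟩ := isCompact_univ.elim_nhds_subcover U fun c _ => hU c
  obtain ⟨b, hb⟩ := (s.image r).bddAbove
  refine ⟨max b 1, by positivity, fun c => ?_⟩
  obtain ⟨c', hc's, hc'⟩ := mem_iUnion₂.1 (hs.2 (mem_univ c))
  refine (hr c' c hc').trans (Metric.closedBall_subset_closedBall ?_)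
  exact (hb (Finset.mem_coe.2 (Finset.mem_image_of_mem r hc's))).trans (le_max_left _ _)

end Metric

/-! ### Decompositions of placed supertiles -/

/-- The decomposition of a translated `N`-supertile into `n`-supertiles. -/
def sub (R : FusionData d L) {n N : ℕ} (h : n ≤ N) (t : L N × Euc d) : Finset (L n × Euc d) :=
  (R.decomp h t.1).map (shift t.2).toEmbedding

theorem mem_map_shift {X : Type*} {v : Euc d} {P : Finset (X × Euc d)} {s : X × Euc d} :
    s ∈ P.map (shift v).toEmbedding ↔ shift (-v) s ∈ P := by
  simp only [Finset.mem_map, Equiv.coe_toEmbedding]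
  constructor
  · rintro ⟨t, ht, rfl⟩
    simpa using ht
  · intro h
    exact ⟨_, h, by simp⟩

theorem mem_image_shift {X : Type*} {v : Euc d} {P : Set (X × Euc d)} {s : X × Euc d} :
    s ∈ shift v '' P ↔ shift (-v) s ∈ P := by
  constructor
  · rintro ⟨t, ht, rfl⟩
    simpa using ht
  · intro h
    exact ⟨_, h, by simp⟩

@[simp] theorem shift_shift {X : Type*} (u v : Euc d) (t : X × Euc d) :
    shift u (shift v t) = shift (v + u) t := by simp [add_assoc]

@[simp] theorem shift_zero {X : Type*} (t : X × Euc d) : shift (0 : Euc d) t = t := by simp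

theorem mem_sub {n N : ℕ} {h : n ≤ N} {t : L N × Euc d} {s : L n × Euc d} :
    s ∈ R.sub h t ↔ shift (-t.2) s ∈ R.decomp h t.1 := mem_map_shift

theorem sub_shift {n N : ℕ} (h : n ≤ N) (v : Euc d) (t : L N × Euc d) :
    R.sub h (shift v t) = (R.sub h t).map (shift v).toEmbedding := by
  unfold sub
  rw [map_shift_shift]
  rfl

theorem shift_mem_sub_shift {n N : ℕ} {h : n ≤ N} {v : Euc d} {t : L N × Euc d}
    {s : L n × Euc d} : shift v s ∈ R.sub h (shift v t) ↔ s ∈ R.sub h t := by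
  rw [sub_shift]
  exact Finset.mem_map' _

@[simp] theorem sub_self (n : ℕ) (t : L n × Euc d) : R.sub (le_refl n) t = {t} := by
  simp [sub, decomp_self]

theorem mem_sub_succ {n N : ℕ} {h : n ≤ N} {t : L (N + 1) × Euc d} {s : L n × Euc d} :
    s ∈ R.sub (Nat.le_succ_of_le h) t ↔
      ∃ u ∈ (R.pieces N t.1).map (shift t.2).toEmbedding, s ∈ R.sub h u := by
  classical
  rw [mem_sub, decomp_succ R h, Finset.mem_biUnion]
  constructor
  · rintro ⟨u, hu, hs⟩
    refine ⟨shift t.2 u, Finset.mem_map_of_mem _ hu, ?_⟩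
    rw [mem_map_shift, shift_shift, ← neg_add_rev] at hs
    exact mem_sub.2 hs
  · rintro ⟨u, hu, hs⟩
    rw [mem_map_shift] at hu
    refine ⟨_, hu, ?_⟩
    rw [mem_map_shift]
    rw [mem_sub] at hs
    rw [shift_shift]
    simpa using hs

theorem sub_le_succ (n : ℕ) (t : L (n + 1) × Euc d) :
    R.sub (Nat.le_succ n) t = (R.pieces n t.1).map (shift t.2).toEmbedding := by
  ext s
  refine (mem_sub_succ (h := le_refl n)).trans ?_
  simp

theorem mem_sub_trans {n m N : ℕ} (h : n ≤ m) (h' : m ≤ N) {t : L N × Euc d}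
    {s : L n × Euc d} :
    s ∈ R.sub (h.trans h') t ↔ ∃ u ∈ R.sub h' t, s ∈ R.sub h u := by
  induction N, h' using Nat.le_induction with
  | base => simp
  | succ N h' ih =>
    refine (mem_sub_succ (h := h.trans h')).trans ?_
    simp only [mem_sub_succ (h := h'), ih]
    constructor
    · rintro ⟨w, hw, u, hu, hs⟩
      exact ⟨u, ⟨w, hw, hu⟩, hs⟩
    · rintro ⟨u, ⟨w, hw, hu⟩, hs⟩
      exact ⟨w, hw, u, hu, hs⟩

theorem mem_subdivide {n N : ℕ} {h : n ≤ N} {T : Set (L N × Euc d)} {s : L n × Euc d} :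
    s ∈ R.subdivide h T ↔ ∃ t ∈ T, s ∈ R.sub h t := by
  simp only [subdivide, sub, mem_iUnion, exists_prop, ← Finset.mem_coe, Finset.coe_map]
  rfl

theorem subdivide_singleton {n N : ℕ} (h : n ≤ N) (t : L N × Euc d) :
    R.subdivide h {t} = R.sub h t := by
  ext s
  simp [mem_subdivide]

theorem coe_sub_subset_subdivide {n N : ℕ} {h : n ≤ N} {T : Set (L N × Euc d)}
    {t : L N × Euc d} (ht : t ∈ T) : (R.sub h t : Set (L n × Euc d)) ⊆ R.subdivide h T :=
  fun _ hs => mem_subdivide.2 ⟨t, ht, hs⟩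

theorem subdivide_self (n : ℕ) (T : Set (L n × Euc d)) : R.subdivide (le_refl n) T = T := by
  ext s
  simp [mem_subdivide]

theorem subdivide_subdivide {n m N : ℕ} (h : n ≤ m) (h' : m ≤ N) (T : Set (L N × Euc d)) :
    R.subdivide h (R.subdivide h' T) = R.subdivide (h.trans h') T := by
  ext s
  simp only [mem_subdivide, mem_sub_trans h h']
  constructor
  · rintro ⟨u, ⟨t, ht, hu⟩, hs⟩
    exact ⟨t, ht, u, hu, hs⟩
  · rintro ⟨t, ht, u, hu, hs⟩
    exact ⟨u, ⟨t, ht, hu⟩, hs⟩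

theorem subdivide_shift {n N : ℕ} (h : n ≤ N) (v : Euc d) (T : Set (L N × Euc d)) :
    R.subdivide h (shift v '' T) = shift v '' R.subdivide h T := by
  ext s
  rw [mem_subdivide, mem_image_shift, mem_subdivide, exists_mem_image]
  refine exists_congr fun t => and_congr_right fun _ => ?_
  rw [← shift_mem_sub_shift (v := -v)]
  simp

theorem region_pieces (n : ℕ) (t : L (n + 1) × Euc d) :
    R.region n (R.sub (Nat.le_succ n) t : Set (L n × Euc d)) = R.placedSupp (n + 1) t := by
  rw [sub_le_succ, Finset.coe_map, placedSupp_eq_image, supp_succ]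
  exact region_shift R n t.2 _

theorem region_sub {n N : ℕ} (h : n ≤ N) (t : L N × Euc d) :
    R.region n (R.sub h t : Set (L n × Euc d)) = R.placedSupp N t := by
  induction N, h using Nat.le_induction with
  | base => simp [region]
  | succ N h ih =>
    rw [← region_pieces]
    ext y
    simp only [mem_region, Finset.mem_coe]
    constructor
    · rintro ⟨s, hs, hy⟩
      obtain ⟨u, hu, hsu⟩ := (mem_sub_trans h (Nat.le_succ N)).1 hs
      refine ⟨u, hu, ?_⟩
      rw [← ih]
      exact mem_region.2 ⟨s, hsu, hy⟩
    · rintro ⟨u, hu, hy⟩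
      rw [← ih] at hy
      obtain ⟨s, hs, hy⟩ := mem_region.1 hy
      exact ⟨s, (mem_sub_trans h (Nat.le_succ N)).2 ⟨u, hu, hs⟩, hy⟩

theorem placedSupp_subset_of_mem_sub {n N : ℕ} {h : n ≤ N} {t : L N × Euc d}
    {s : L n × Euc d} (hs : s ∈ R.sub h t) : R.placedSupp n s ⊆ R.placedSupp N t := by
  rw [← region_sub h t]
  exact placedSupp_subset_region hs

theorem region_subdivide {n N : ℕ} (h : n ≤ N) (T : Set (L N × Euc d)) :
    R.region n (R.subdivide h T) = R.region N T := by
  ext y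
  simp only [mem_region, mem_subdivide]
  constructor
  · rintro ⟨s, ⟨t, ht, hs⟩, hy⟩
    exact ⟨t, ht, placedSupp_subset_of_mem_sub hs hy⟩
  · rintro ⟨t, ht, hy⟩
    rw [← region_sub h] at hy
    obtain ⟨s, hs, hy⟩ := mem_region.1 hy
    exact ⟨s, ⟨t, ht, hs⟩, hy⟩

theorem NonOverlapping.mono {n : ℕ} {S T : Set (L n × Euc d)} (hT : R.NonOverlapping n T)
    (h : S ⊆ T) : R.NonOverlapping n S := fun t ht t' ht' => hT t (h ht) t' (h ht')

theorem nonOverlapping_singleton (n : ℕ) (t : L n × Euc d) : R.NonOverlapping n {t} := by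
  rintro _ rfl _ rfl h
  exact absurd rfl h

theorem NonOverlapping.eq_of_mem_interior {n : ℕ} {T : Set (L n × Euc d)}
    (hT : R.NonOverlapping n T) {t t' : L n × Euc d} (ht : t ∈ T) (ht' : t' ∈ T) {y : Euc d}
    (hy : y ∈ interior (R.placedSupp n t)) (hy' : y ∈ R.placedSupp n t') : t = t' := by
  by_contra hne
  exact (hT t ht t' ht' hne ⟨interior_subset hy, hy'⟩).1.2 hy

section Metric

variable [∀ n, MetricSpace (L n)]

/-- A tile determines the member of a non-overlapping collection whose decomposition contains it. -/
theorem IsFusionRule.eq_of_mem_sub (hR : R.IsFusionRule) {n N : ℕ} {h : n ≤ N}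
    {T : Set (L N × Euc d)} (hT : R.NonOverlapping N T) {t t' : L N × Euc d} (ht : t ∈ T)
    (ht' : t' ∈ T) {s : L n × Euc d} (hs : s ∈ R.sub h t) (hs' : s ∈ R.sub h t') : t = t' := by
  obtain ⟨y, hy⟩ := hR.interior_placedSupp_nonempty n s
  exact hT.eq_of_mem_interior ht ht' (interior_mono (placedSupp_subset_of_mem_sub hs) hy)
    (placedSupp_subset_of_mem_sub hs' (interior_subset hy))

theorem IsFusionRule.nonOverlapping_subdivide_succ (hR : R.IsFusionRule) {n : ℕ}
    {T : Set (L (n + 1) × Euc d)} (hT : R.NonOverlapping (n + 1) T) :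
    R.NonOverlapping n (R.subdivide (Nat.le_succ n) T) := by
  intro s hs s' hs' hne
  obtain ⟨t, ht, hst⟩ := mem_subdivide.1 hs
  obtain ⟨t', ht', hst'⟩ := mem_subdivide.1 hs'
  by_cases htt : t = t'
  · subst htt
    have := (hR.pieces_patch n t.1).2.1.shift t.2
    rw [sub_le_succ, Finset.mem_map] at hst hst'
    obtain ⟨u, hu, rfl⟩ := hst
    obtain ⟨u', hu', rfl⟩ := hst'
    exact this _ (mem_image_of_mem _ hu) _ (mem_image_of_mem _ hu') hne
  · rintro y ⟨hy, hy'⟩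
    have h1 := placedSupp_subset_of_mem_sub hst
    have h2 := placedSupp_subset_of_mem_sub hst'
    have h3 := hT t ht t' ht' htt ⟨h1 hy, h2 hy'⟩
    exact ⟨⟨subset_closure hy, fun h => h3.1.2 (interior_mono h1 h)⟩,
      ⟨subset_closure hy', fun h => h3.2.2 (interior_mono h2 h)⟩⟩

theorem IsFusionRule.nonOverlapping_subdivide (hR : R.IsFusionRule) {n N : ℕ} (h : n ≤ N)
    {T : Set (L N × Euc d)} (hT : R.NonOverlapping N T) :
    R.NonOverlapping n (R.subdivide h T) := by
  induction N, h using Nat.le_induction with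
  | base => rwa [subdivide_self]
  | succ N h ih =>
    rw [← subdivide_subdivide h (Nat.le_succ N)]
    exact ih (hR.nonOverlapping_subdivide_succ hT)

theorem IsFusionRule.nonOverlapping_sub (hR : R.IsFusionRule) {n N : ℕ} (h : n ≤ N)
    (t : L N × Euc d) : R.NonOverlapping n (R.sub h t : Set (L n × Euc d)) := by
  rw [← subdivide_singleton]
  exact hR.nonOverlapping_subdivide h (nonOverlapping_singleton N t)

/-! ### Admitted collections and fusion tilings -/

/-- An injective motion of a finite collection by at most `ε`. -/
theorem differAtMost_image {n : ℕ} {ε : ℝ} {P : Finset (L n × Euc d)}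
    (φ : P → L n × Euc d) (hφ : Function.Injective φ) (h : ∀ t : P, R.tileDist n t (φ t) ≤ ε)
    {F : Finset (L n × Euc d)} (hF : ∀ s, s ∈ F ↔ ∃ t, φ t = s) : R.DifferAtMost n ε P F := by
  refine ⟨Equiv.ofBijective (fun t => ⟨φ t, (hF _).2 ⟨t, rfl⟩⟩) ⟨?_, ?_⟩, fun t => h t⟩
  · intro a b hab
    exact hφ (congrArg Subtype.val hab)
  · rintro ⟨s, hs⟩
    obtain ⟨t, ht⟩ := (hF s).1 hs
    exact ⟨t, Subtype.ext ht⟩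

theorem admitted_iff {n : ℕ} {P : Finset (L n × Euc d)} :
    R.Admitted n P ↔ ∀ ε > 0, ∃ (N : ℕ) (h : n ≤ N) (t : L N × Euc d) (φ : P → L n × Euc d),
      Function.Injective φ ∧ ∀ s : P, φ s ∈ R.sub h t ∧ R.tileDist n s (φ s) ≤ ε := by
  classical
  constructor
  · intro hP ε hε
    obtain ⟨N, h, c, v, F, hF, e, he⟩ := hP ε hε
    exact ⟨N, h, (c, v), fun s => e s, fun a b hab => e.injective (Subtype.ext hab),
      fun s => ⟨hF (e s).2, he s⟩⟩
  · intro hP ε hε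
    obtain ⟨N, h, t, φ, hφ, hs⟩ := hP ε hε
    refine ⟨N, h, t.1, t.2, Finset.univ.image φ, ?_, ?_⟩
    · intro s hs'
      obtain ⟨p, -, rfl⟩ := Finset.mem_image.1 hs'
      exact (hs p).1
    · exact differAtMost_image φ hφ (fun s => (hs s).2) (by simp)

theorem Admitted.mono {n : ℕ} {P Q : Finset (L n × Euc d)} (hQ : R.Admitted n Q)
    (h : P ⊆ Q) : R.Admitted n P := by
  rw [admitted_iff] at hQ ⊢
  intro ε hε
  obtain ⟨N, hn, t, φ, hφ, hs⟩ := hQ ε hε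
  exact ⟨N, hn, t, fun s => φ ⟨s, h s.2⟩, fun a b hab => Subtype.ext
    (by simpa using congrArg Subtype.val (hφ hab)), fun s => hs ⟨s, h s.2⟩⟩

theorem admitted_of_subset_sub {n N : ℕ} (h : n ≤ N) (t : L N × Euc d)
    {P : Finset (L n × Euc d)} (hP : P ⊆ R.sub h t) : R.Admitted n P := by
  rw [admitted_iff]
  exact fun ε hε => ⟨N, h, t, fun s => s, Subtype.val_injective,
    fun s => ⟨hP s.2, by simpa using hε.le⟩⟩

/-- Nearby supertiles have nearby constituents. -/
theorem IsFusionRule.exists_differAtMost_sub (hR : R.IsFusionRule) {n : ℕ}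
    (t : L (n + 1) × Euc d) {ε : ℝ} (hε : 0 < ε) :
    ∃ η > 0, ∀ t', R.tileDist (n + 1) t t' ≤ η →
      R.DifferAtMost n ε (R.sub (Nat.le_succ n) t) (R.sub (Nat.le_succ n) t') := by
  obtain ⟨δ, hδ, h⟩ := hR.pieces_continuous n t.1 (ε / 2) (by positivity)
  obtain ⟨η, hη, h'⟩ := hR.exists_tileDist_le_imp_mem
    (Metric.ball_mem_nhds t (lt_min hδ (half_pos hε)))
  refine ⟨η, hη, fun t' ht' => ?_⟩
  have h1 := h' t' ht'
  rw [Metric.mem_ball, Prod.dist_eq, max_lt_iff, lt_min_iff, lt_min_iff, dist_comm t'.1,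
    dist_comm t'.2] at h1
  obtain ⟨e, he⟩ := (h t'.1 h1.1.1).shift t.2
  rw [sub_le_succ, sub_le_succ]
  -- the piece `s` is first moved along `e` and then by the difference of the control points
  have key : ∀ s : L n × Euc d, s ∈ (R.pieces n t'.1).map (shift t.2).toEmbedding ↔
      shift (t'.2 - t.2) s ∈ (R.pieces n t'.1).map (shift t'.2).toEmbedding := by
    intro s
    rw [mem_map_shift, mem_map_shift, shift_shift,
      show t'.2 - t.2 + -t'.2 = -t.2 by abel]
  refine ⟨e.trans (Equiv.subtypeEquiv (shift (t'.2 - t.2)) key), fun s => ?_⟩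
  refine (hR.tileDist_triangle n _ (e s) _).trans ?_
  have h2 : R.tileDist n (e s) (shift (t'.2 - t.2) (e s)) ≤ ε / 2 := by
    refine (tileDist_translate_le n _ _ _).trans ?_
    change dist _ (_ + (t'.2 - t.2)) ≤ _
    rw [dist_self_add_right, ← dist_eq_norm, dist_comm]
    exact h1.2.2.le
  have := he s
  simpa using (add_le_add this h2).trans (add_halves ε).le

/-- The constituents of an admitted collection are admitted: if the collection nearly occurs in a
supertile, then so do its constituents, since these depend continuously on the label. -/
theorem IsFusionRule.admitted_of_subset_subdivide (hR : R.IsFusionRule) {n : ℕ}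
    {Q : Finset (L (n + 1) × Euc d)} (hQ : R.Admitted (n + 1) Q) {P : Finset (L n × Euc d)}
    (hP : (P : Set (L n × Euc d)) ⊆ R.subdivide (Nat.le_succ n) Q) : R.Admitted n P := by
  rw [admitted_iff] at hQ ⊢
  intro ε hε
  have hη : ∃ η > 0, ∀ t ∈ Q, ∀ t', R.tileDist (n + 1) t t' ≤ η →
      R.DifferAtMost n ε (R.sub (Nat.le_succ n) t) (R.sub (Nat.le_succ n) t') := by
    choose η hη h using fun t => hR.exists_differAtMost_sub (n := n) t hε
    rcases Q.eq_empty_or_nonempty with rfl | hne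
    · exact ⟨1, one_pos, by simp⟩
    · obtain ⟨t₀, ht₀, hmin⟩ := Q.exists_min_image η hne
      exact ⟨η t₀, hη t₀, fun t ht t' htt' => h t t' (htt'.trans (hmin t ht))⟩
  obtain ⟨η, hη, h⟩ := hη
  obtain ⟨N, hN, w, φ, hφ, hw⟩ := hQ η hη
  have hmem : ∀ s : P, ∃ t : Q, (s : L n × Euc d) ∈ R.sub (Nat.le_succ n) t := by
    intro s
    obtain ⟨t, ht, hs⟩ := mem_subdivide.1 (hP s.2)
    exact ⟨⟨t, ht⟩, hs⟩
  choose τ hτ using hmem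
  choose e he using fun t : Q => h t t.2 (φ t) (hw t).2
  refine ⟨N, (Nat.le_succ n).trans hN, w, fun s => e (τ s) ⟨s, hτ s⟩, ?_, fun s => ⟨?_, ?_⟩⟩
  · intro s s' hss
    have hτs : τ s = τ s' := by
      refine hφ (hR.eq_of_mem_sub (h := Nat.le_succ n) (hR.nonOverlapping_sub hN w) (hw _).1
        (hw _).1 (e (τ s) ⟨s, hτ s⟩).2 ?_)
      rw [show ((e (τ s) ⟨s, hτ s⟩ : R.sub (Nat.le_succ n) (φ (τ s))) : L n × Euc d) =
        e (τ s') ⟨s', hτ s'⟩ from hss]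
      exact (e (τ s') ⟨s', hτ s'⟩).2
    have aux : ∀ (q q' : Q) (hq : (s : L n × Euc d) ∈ R.sub (Nat.le_succ n) q)
        (hq' : (s' : L n × Euc d) ∈ R.sub (Nat.le_succ n) q'), q = q' →
        ((e q ⟨s, hq⟩ : R.sub (Nat.le_succ n) (φ q)) : L n × Euc d) = e q' ⟨s', hq'⟩ →
        s = s' := by
      rintro q _ hq hq' rfl hqq
      have := (e q).injective (Subtype.ext hqq)
      have h3 := Subtype.mk.inj this
      exact Subtype.ext h3
    exact aux _ _ _ _ hτs hss
  · exact (mem_sub_trans (Nat.le_succ n) hN).2 ⟨_, (hw (τ s)).1, (e (τ s) ⟨s, hτ s⟩).2⟩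
  · exact he (τ s) ⟨s, hτ s⟩

/-- The assumptions on a fusion rule that are in force throughout. -/
structure IsRegular (R : FusionData d L) : Prop where
  fusion : R.IsFusionRule
  trim : R.SupertilesTrim
  vanHove : R.VanHove
  recognizable : R.Recognizable

/-- Control points of fusion tilings are uniformly discrete. -/
theorem SupertilesTrim.exists_dist_lt_imp_eq (h : R.SupertilesTrim) (n : ℕ) :
    ∃ r > 0, ∀ T ∈ R.Omega n, ∀ t ∈ T, ∀ t' ∈ T, dist t.2 t'.2 < r → t = t' := by
  obtain ⟨U, hU, ⟨u, hu⟩, hU'⟩ := h n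
  obtain ⟨r, hr, hrU⟩ := Metric.isOpen_iff.1 hU u hu
  refine ⟨r, hr, fun T hT t ht t' ht' htt => ?_⟩
  have := hU' _ (shift_mem_Omega hT (u - t.2)) _ (mem_image_of_mem _ ht) _
    (mem_image_of_mem _ ht') (by simpa using hu) (hrU ?_)
  · exact (shift _).injective this
  · have h1 : u = t.2 + (u - t.2) := by abel
    rw [Metric.mem_ball, shift_apply]
    nth_rewrite 2 [h1]
    rwa [dist_add_right, dist_comm]

theorem SupertilesTrim.finite_setOf_mem_closedBall (h : R.SupertilesTrim) {n : ℕ}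
    {T : Set (L n × Euc d)} (hT : T ∈ R.Omega n) (ρ : ℝ) :
    {t ∈ T | t.2 ∈ Metric.closedBall 0 ρ}.Finite := by
  obtain ⟨r, hr, hr'⟩ := h.exists_dist_lt_imp_eq n
  obtain ⟨s, -, hs⟩ := (isCompact_closedBall (0 : Euc d) ρ).elim_nhds_subcover
    (fun x => Metric.ball x (r / 2)) fun x _ => Metric.ball_mem_nhds x (half_pos hr)
  refine Set.Finite.subset (s := ⋃ x ∈ s, {t ∈ T | t.2 ∈ Metric.ball x (r / 2)}) ?_ ?_
  · refine s.finite_toSet.biUnion fun x _ => Set.Subsingleton.finite ?_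
    rintro t ⟨ht, htx⟩ t' ⟨ht', htx'⟩
    refine hr' T hT t ht t' ht' ?_
    rw [Metric.mem_ball] at htx htx'
    linarith [dist_triangle_right t.2 t'.2 x]
  · rintro t ⟨ht, htρ⟩
    obtain ⟨x, hx, htx⟩ := mem_iUnion₂.1 (hs htρ)
    exact mem_biUnion hx ⟨ht, htx⟩

variable [∀ n, CompactSpace (L n)]

/-- The members of a collection of tiles that meet the closed ball of radius `ρ` around `0`. -/
def near (R : FusionData d L) (n : ℕ) (T : Set (L n × Euc d)) (ρ : ℝ) : Set (L n × Euc d) :=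
  {t ∈ T | (Metric.closedBall 0 ρ ∩ R.placedSupp n t).Nonempty}

theorem IsRegular.finite_near (H : R.IsRegular) {n : ℕ} {T : Set (L n × Euc d)}
    (hT : T ∈ R.Omega n) (ρ : ℝ) : (R.near n T ρ).Finite := by
  obtain ⟨r, hr, hr'⟩ := H.fusion.exists_supp_subset_closedBall n
  refine (H.trim.finite_setOf_mem_closedBall hT (ρ + r)).subset ?_
  rintro t ⟨ht, y, hy, hyt⟩
  refine ⟨ht, ?_⟩
  have h1 := hr' t.1 (mem_placedSupp.1 hyt)
  rw [mem_closedBall_zero_iff] at hy h1 ⊢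
  calc ‖t.2‖ = ‖y - (y - t.2)‖ := by simp
    _ ≤ ‖y‖ + ‖y - t.2‖ := norm_sub_le _ _
    _ ≤ ρ + r := add_le_add hy h1

theorem closedBall_subset_region_near {n : ℕ} {T : Set (L n × Euc d)}
    (hT : R.region n T = univ) (ρ : ℝ) : Metric.closedBall 0 ρ ⊆ R.region n (R.near n T ρ) := by
  intro y hy
  obtain ⟨t, ht, hyt⟩ := mem_region.1 (hT ▸ mem_univ y : y ∈ R.region n T)
  exact mem_region.2 ⟨t, ⟨ht, y, hy, hyt⟩, hyt⟩

/-- A collection of tiles that covers a closed ball, each of which meets the ball, has connected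
union. -/
theorem IsFusionRule.isConnected_region (hR : R.IsFusionRule) {n : ℕ} {P : Set (L n × Euc d)}
    {ρ : ℝ} (hρ : 0 ≤ ρ) (hc : Metric.closedBall 0 ρ ⊆ R.region n P)
    (hm : ∀ t ∈ P, (Metric.closedBall 0 ρ ∩ R.placedSupp n t).Nonempty) :
    IsConnected (R.region n P) := by
  have hb : IsConnected (Metric.closedBall (0 : Euc d) ρ) :=
    (convex_closedBall 0 ρ).isConnected ⟨0, by simpa⟩
  have h0 : (0 : Euc d) ∈ Metric.closedBall (0 : Euc d) ρ := by simpa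
  refine ⟨⟨0, hc h0⟩, isPreconnected_of_forall 0 fun y hy => ?_⟩
  obtain ⟨t, ht, hyt⟩ := mem_region.1 hy
  exact ⟨Metric.closedBall 0 ρ ∪ R.placedSupp n t,
    union_subset hc (placedSupp_subset_region ht), Or.inl h0, Or.inr hyt,
    (hb.union (hm t ht) (hR.isConnected_placedSupp n t)).isPreconnected⟩

theorem IsRegular.isPatch_near (H : R.IsRegular) {n : ℕ} {T : Set (L n × Euc d)}
    (hT : T ∈ R.Omega n) {ρ : ℝ} (hρ : 0 ≤ ρ) :
    R.IsPatch n (H.finite_near hT ρ).toFinset := by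
  have hcov := closedBall_subset_region_near hT.1.2 ρ
  refine ⟨?_, ?_, ?_⟩
  · obtain ⟨t, ht, -⟩ := mem_region.1 (hcov (by simpa : (0 : Euc d) ∈ Metric.closedBall 0 ρ))
    exact ⟨t, by simpa using ht⟩
  · exact hT.1.1.mono fun t ht => by
      have : t ∈ R.near n T ρ := by simpa using ht
      exact this.1
  · rw [Set.Finite.coe_toFinset]
    exact H.fusion.isConnected_region hρ hcov fun t ht => ht.2

/-- All finite subsets of a fusion tiling are admitted, whether connected or not. -/
theorem IsRegular.admitted_of_subset (H : R.IsRegular) {n : ℕ} {T : Set (L n × Euc d)}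
    (hT : T ∈ R.Omega n) {P : Finset (L n × Euc d)} (hP : (P : Set (L n × Euc d)) ⊆ T) :
    R.Admitted n P := by
  have hρ : ∃ ρ : ℝ, 0 ≤ ρ ∧ (P : Set (L n × Euc d)) ⊆ R.near n T ρ := by
    have hb : Bornology.IsBounded (R.region n (P : Set (L n × Euc d))) :=
      (Bornology.isBounded_biUnion P.finite_toSet).2 fun t _ =>
        (isCompact_placedSupp n t).isBounded
    obtain ⟨ρ, hρ⟩ := hb.subset_closedBall 0
    refine ⟨max ρ 0, le_max_right _ _, fun t ht => ⟨hP ht, ?_⟩⟩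
    obtain ⟨y, hy⟩ := H.fusion.placedSupp_nonempty n t
    exact ⟨y, Metric.closedBall_subset_closedBall (le_max_left _ _)
      (hρ (placedSupp_subset_region ht hy)), hy⟩
  obtain ⟨ρ, hρ, hPρ⟩ := hρ
  refine (hT.2 _ ?_ (H.isPatch_near hT hρ)).mono (P := P) ?_
  · rw [Set.Finite.coe_toFinset]
    exact fun t ht => ht.1
  · intro t ht
    simpa using hPρ ht

theorem IsRegular.mem_Omega_iff (H : R.IsRegular) {n : ℕ} {T : Set (L n × Euc d)} :
    T ∈ R.Omega n ↔ R.IsTiling n T ∧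
      ∀ P : Finset (L n × Euc d), (P : Set (L n × Euc d)) ⊆ T → R.Admitted n P :=
  ⟨fun hT => ⟨hT.1, fun _ hP => H.admitted_of_subset hT hP⟩,
    fun hT => ⟨hT.1, fun P hP _ => hT.2 P hP⟩⟩

/-! ### The hierarchy of supertiles of a tiling -/

theorem IsRegular.subdivide_succ_mem_Omega (H : R.IsRegular) {n : ℕ}
    {T : Set (L (n + 1) × Euc d)} (hT : T ∈ R.Omega (n + 1)) :
    R.subdivide (Nat.le_succ n) T ∈ R.Omega n := by
  classical
  refine H.mem_Omega_iff.2 ⟨⟨H.fusion.nonOverlapping_subdivide_succ hT.1.1, ?_⟩, fun P hP => ?_⟩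
  · rw [region_subdivide, hT.1.2]
  · have hmem : ∀ s : P, ∃ t ∈ T, (s : L n × Euc d) ∈ R.sub (Nat.le_succ n) t := fun s =>
      mem_subdivide.1 (hP s.2)
    choose τ hτ hτs using hmem
    have hQ : ((Finset.univ.image τ : Finset _) : Set (L (n + 1) × Euc d)) ⊆ T := by
      intro t ht
      simp only [Finset.coe_image, Finset.coe_univ, image_univ, mem_range] at ht
      obtain ⟨s, rfl⟩ := ht
      exact hτ s
    refine H.fusion.admitted_of_subset_subdivide (H.admitted_of_subset hT hQ) fun s hs => ?_
    exact mem_subdivide.2 ⟨τ ⟨s, hs⟩, by simp, hτs ⟨s, hs⟩⟩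

theorem IsRegular.subdivide_mem_Omega (H : R.IsRegular) {n N : ℕ} (h : n ≤ N)
    {T : Set (L N × Euc d)} (hT : T ∈ R.Omega N) : R.subdivide h T ∈ R.Omega n := by
  induction N, h using Nat.le_induction with
  | base => rwa [subdivide_self]
  | succ N h ih =>
    rw [← subdivide_subdivide h (Nat.le_succ N)]
    exact ih (H.subdivide_succ_mem_Omega hT)

/-- Recognizability, iterated: a tiling in `Ω^{(n)}` has exactly one composition into supertiles of
any higher level. -/
theorem IsRegular.existsUnique_subdivide (H : R.IsRegular) {n N : ℕ} (h : n ≤ N)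
    {T : Set (L n × Euc d)} (hT : T ∈ R.Omega n) :
    ∃! T' : Set (L N × Euc d), T' ∈ R.Omega N ∧ R.subdivide h T' = T := by
  induction N, h using Nat.le_induction with
  | base =>
    refine ⟨T, ⟨hT, subdivide_self n T⟩, ?_⟩
    rintro T' ⟨-, h⟩
    rwa [subdivide_self] at h
  | succ N h ih =>
    obtain ⟨S, ⟨hS, hST⟩, hSu⟩ := ih
    obtain ⟨T', ⟨hT', hTS⟩, hTu⟩ := H.recognizable N S hS
    refine ⟨T', ⟨hT', ?_⟩, ?_⟩
    · change R.subdivide (h.trans (Nat.le_succ N)) T' = T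
      rw [← subdivide_subdivide h (Nat.le_succ N), hTS, hST]
    · rintro T'' ⟨hT'', h2⟩
      refine hTu T'' ⟨hT'', hSu _ ⟨H.subdivide_succ_mem_Omega hT'', ?_⟩⟩
      rw [subdivide_subdivide]
      exact h2

open Classical in
/-- The decomposition of a fusion tiling into `n`-supertiles, which exists and is unique for a
recognizable fusion rule. The value `∅` in the absence of such a decomposition plays no role. -/
def level (R : FusionData d L) (n : ℕ) (T : R.Hull) : Set (L n × Euc d) :=
  if h : ∃ T' ∈ R.Omega n, R.subdivide (Nat.zero_le n) T' = T.1 then h.choose else ∅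

theorem IsRegular.level_spec (H : R.IsRegular) (n : ℕ) (T : R.Hull) :
    R.level n T ∈ R.Omega n ∧ R.subdivide (Nat.zero_le n) (R.level n T) = T.1 := by
  have h : ∃ T' ∈ R.Omega n, R.subdivide (Nat.zero_le n) T' = T.1 :=
    (H.existsUnique_subdivide (Nat.zero_le n) T.2).exists
  rw [level, dif_pos h]
  exact h.choose_spec

theorem IsRegular.level_mem (H : R.IsRegular) (n : ℕ) (T : R.Hull) :
    R.level n T ∈ R.Omega n := (H.level_spec n T).1

theorem IsRegular.eq_level (H : R.IsRegular) {n : ℕ} {T : R.Hull} {T' : Set (L n × Euc d)}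
    (hT' : T' ∈ R.Omega n) (h : R.subdivide (Nat.zero_le n) T' = T.1) : T' = R.level n T :=
  (H.existsUnique_subdivide (Nat.zero_le n) T.2).unique ⟨hT', h⟩ (H.level_spec n T)

theorem IsRegular.level_zero (H : R.IsRegular) (T : R.Hull) : R.level 0 T = T.1 :=
  (H.eq_level T.2 (subdivide_self 0 T.1)).symm

theorem IsRegular.subdivide_level (H : R.IsRegular) {n N : ℕ} (h : n ≤ N) (T : R.Hull) :
    R.subdivide h (R.level N T) = R.level n T := by
  refine H.eq_level (H.subdivide_mem_Omega h (H.level_mem N T)) ?_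
  rw [subdivide_subdivide]
  exact (H.level_spec N T).2

theorem IsRegular.level_translate (H : R.IsRegular) (n : ℕ) (v : Euc d) (T : R.Hull) :
    R.level n (R.translate v T) = shift (-v) '' R.level n T := by
  refine (H.eq_level (shift_mem_Omega (H.level_mem n T) (-v)) ?_).symm
  rw [subdivide_shift, (H.level_spec n T).2]
  rfl

theorem IsRegular.level_nonOverlapping (H : R.IsRegular) (n : ℕ) (T : R.Hull) :
    R.NonOverlapping n (R.level n T) := (H.level_mem n T).1.1

theorem IsRegular.mem_supertileCylinder (H : R.IsRegular) {n : ℕ} {I : Set (L n)}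
    {U : Set (Euc d)} {T : R.Hull} :
    T ∈ R.supertileCylinder n I U ↔ ∃ t ∈ R.level n T, t.1 ∈ I ∧ t.2 ∈ U := by
  constructor
  · rintro ⟨T', hT', h, c, hc, v, hv, hcv⟩
    rw [H.eq_level hT' h] at hcv
    exact ⟨_, hcv, hc, hv⟩
  · rintro ⟨t, ht, h1, h2⟩
    exact ⟨_, H.level_mem n T, (H.level_spec n T).2, t.1, h1, t.2, h2, ht⟩

end Metric

variable [∀ n, MetricSpace (L n)] [∀ n, CompactSpace (L n)]

/-! ### Measurable enumeration of the tiles of a tiling -/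

/-- A countable Borel partition of `ℝ^d` into cells so small that no tiling in `Ω^{(n)}` has two
control points in the same cell. -/
structure IsCellPartition (R : FusionData d L) (n : ℕ) (C : ℕ → Set (Euc d)) : Prop where
  measurable : ∀ i, MeasurableSet (C i)
  disjoint : Pairwise (Function.onFun Disjoint C)
  cover : ∀ x, ∃ i, x ∈ C i
  bounded : ∀ i, Bornology.IsBounded (C i)
  trim : ∀ i, ∀ T ∈ R.Omega n, ∀ t ∈ T, ∀ t' ∈ T, t.2 ∈ C i → t'.2 ∈ C i → t = t'

theorem IsCellPartition.index_unique {n : ℕ} {C : ℕ → Set (Euc d)}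
    (hC : IsCellPartition R n C) {i j : ℕ} {x : Euc d} (hi : x ∈ C i) (hj : x ∈ C j) : i = j := by
  by_contra h
  exact disjoint_left.1 (hC.disjoint h) hi hj

theorem IsRegular.exists_small_balls (H : R.IsRegular) (n : ℕ) :
    ∃ r > 0, ∀ x : Euc d, ∀ T ∈ R.Omega n, ∀ t ∈ T, ∀ t' ∈ T,
      t.2 ∈ Metric.ball x r → t'.2 ∈ Metric.ball x r → t = t' := by
  obtain ⟨r, hr, h⟩ := H.trim.exists_dist_lt_imp_eq n
  refine ⟨r / 2, half_pos hr, fun x T hT t ht t' ht' h1 h2 => h T hT t ht t' ht' ?_⟩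
  rw [Metric.mem_ball] at h1 h2
  linarith [dist_triangle_right t.2 t'.2 x]

theorem IsRegular.exists_cellPartition (H : R.IsRegular) (n : ℕ) :
    ∃ C, IsCellPartition R n C := by
  obtain ⟨r, hr, h⟩ := H.exists_small_balls n
  have hsub : ∀ i, disjointed (fun i => Metric.ball (denseSeq (Euc d) i) r) i ⊆
      Metric.ball (denseSeq (Euc d) i) r := fun i => disjointed_subset _ i
  refine ⟨disjointed fun i => Metric.ball (denseSeq (Euc d) i) r,
    fun i => MeasurableSet.disjointed (fun _ => measurableSet_ball) i, disjoint_disjointed _,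
    fun x => ?_, fun i => Metric.isBounded_ball.subset (hsub i), ?_⟩
  · have : x ∈ ⋃ i, disjointed (fun i => Metric.ball (denseSeq (Euc d) i) r) i := by
      rw [iUnion_disjointed]
      obtain ⟨i, hi⟩ := (denseRange_denseSeq (Euc d)).exists_dist_lt x hr
      exact mem_iUnion.2 ⟨i, hi⟩
    exact mem_iUnion.1 this
  · exact fun i T hT t ht t' ht' h1 h2 => h _ T hT t ht t' ht' (hsub i h1) (hsub i h2)

variable [∀ n, MeasurableSpace (L n)] [∀ n, BorelSpace (L n)]

/-- A tiling-valued map is hit-measurable if the points whose tiling has a member in a given open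
set of tiles form a measurable set. -/
def HitMeasurable {Y : Type*} [MeasurableSpace Y] {n : ℕ} (τ : Y → Set (L n × Euc d)) : Prop :=
  ∀ V : Set (L n × Euc d), IsOpen V → MeasurableSet {y | ∃ t ∈ τ y, t ∈ V}

section Hit

variable {Y : Type*} [MeasurableSpace Y] {n : ℕ} {τ : Y → Set (L n × Euc d)}

/-- Inside a ball that holds at most one control point, hitting the complement of `B` is the
complement of hitting `B`, up to hitting anything at all. This extends hit-measurability from open
sets to all Borel sets. -/
theorem IsRegular.measurableSet_hit (H : R.IsRegular) (hτ : ∀ y, τ y ∈ R.Omega n)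
    (hm : HitMeasurable τ) {B : Set (L n × Euc d)} (hB : MeasurableSet B) :
    MeasurableSet {y | ∃ t ∈ τ y, t ∈ B} := by
  obtain ⟨r, hr, h⟩ := H.exists_small_balls n
  have key : ∀ x : Euc d, MeasurableSet {y | ∃ t ∈ τ y, t ∈ B ∧ t.2 ∈ Metric.ball x r} := by
    intro x
    have hop : IsOpen {t : L n × Euc d | t.2 ∈ Metric.ball x r} :=
      Metric.isOpen_ball.preimage continuous_snd
    induction B, hB using MeasurableSpace.induction_on_inter
      (BorelSpace.measurable_eq (α := L n × Euc d)) isPiSystem_isOpen with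
    | empty => simp
    | basic V hV => exact hm _ (IsOpen.inter hV hop)
    | compl B hB ih =>
      convert (hm _ hop).diff ih using 1
      ext y
      constructor
      · rintro ⟨t, ht, htB, htx⟩
        refine ⟨⟨t, ht, htx⟩, ?_⟩
        rintro ⟨t', ht', htB', htx'⟩
        rw [h x _ (hτ y) t ht t' ht' htx htx'] at htB
        exact htB htB'
      · rintro ⟨⟨t, ht, htx⟩, h2⟩
        exact ⟨t, ht, fun htB => h2 ⟨t, ht, htB, htx⟩, htx⟩
    | iUnion f hd hf ih =>
      convert MeasurableSet.iUnion ih using 1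
      ext y
      simp only [mem_iUnion, mem_ofPred_eq]
      constructor
      · rintro ⟨t, ht, ⟨i, hi⟩, htx⟩
        exact ⟨i, t, ht, hi, htx⟩
      · rintro ⟨i, t, ht, hi, htx⟩
        exact ⟨t, ht, ⟨i, hi⟩, htx⟩
  convert MeasurableSet.iUnion fun i => key (denseSeq (Euc d) i) using 1
  ext y
  simp only [mem_iUnion, mem_ofPred_eq]
  constructor
  · rintro ⟨t, ht, htB⟩
    obtain ⟨i, hi⟩ := (denseRange_denseSeq (Euc d)).exists_dist_lt t.2 hr
    exact ⟨i, t, ht, htB, hi⟩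
  · rintro ⟨i, t, ht, htB, -⟩
    exact ⟨t, ht, htB⟩

variable [∀ n, Nonempty (L n)]

/-- The tiles of a measurably varying tiling can be enumerated measurably: one tile for each cell
that contains a control point. -/
theorem IsRegular.exists_enumeration (H : R.IsRegular) (hτ : ∀ y, τ y ∈ R.Omega n)
    (hm : HitMeasurable τ) :
    ∃ (D : ℕ → Set Y) (x : ℕ → Y → L n × Euc d), (∀ i, MeasurableSet (D i)) ∧
      (∀ i, Measurable (x i)) ∧ (∀ i, ∀ y ∈ D i, x i y ∈ τ y) ∧
      ∀ y, ∀ t ∈ τ y, ∃! i, y ∈ D i ∧ x i y = t := by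
  classical
  obtain ⟨C, hC⟩ := H.exists_cellPartition n
  have hcell : ∀ i, MeasurableSet {t : L n × Euc d | t.2 ∈ C i} := fun i =>
    measurable_snd (hC.measurable i)
  let t₀ : L n × Euc d := (Classical.arbitrary _, 0)
  let D : ℕ → Set Y := fun i => {y | ∃ t ∈ τ y, t.2 ∈ C i}
  let x : ℕ → Y → L n × Euc d := fun i y => if h : y ∈ D i then h.choose else t₀
  have hx : ∀ i, ∀ y ∈ D i, x i y ∈ τ y ∧ (x i y).2 ∈ C i := by
    intro i y hy
    simp only [x, dif_pos hy]
    exact hy.choose_spec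
  have hD : ∀ i, MeasurableSet (D i) := fun i => H.measurableSet_hit hτ hm (hcell i)
  refine ⟨D, x, hD, fun i => ?_, fun i y hy => (hx i y hy).1, fun y t ht => ?_⟩
  · intro B hB
    have : x i ⁻¹' B = {y | ∃ t ∈ τ y, t ∈ B ∩ {t | t.2 ∈ C i}} ∪
        ((D i)ᶜ ∩ {_y | t₀ ∈ B}) := by
      ext y
      by_cases hy : y ∈ D i
      · have h1 := hx i y hy
        simp only [mem_preimage, mem_union, mem_inter_iff, mem_compl_iff, hy, not_true,
          false_and, or_false, mem_ofPred_eq]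
        constructor
        · intro h
          exact ⟨_, h1.1, h, h1.2⟩
        · rintro ⟨t, ht, htB, htC⟩
          rwa [hC.trim i _ (hτ y) _ h1.1 t ht h1.2 htC]
      · have h1 : x i y = t₀ := dif_neg hy
        simp only [mem_preimage, h1, mem_union, mem_inter_iff, mem_compl_iff, hy, not_false_eq_true,
          true_and, mem_ofPred_eq]
        constructor
        · exact Or.inr
        · rintro (⟨t, ht, -, htC⟩ | h)
          · exact absurd ⟨t, ht, htC⟩ hy
          · exact h
    rw [this]
    exact (H.measurableSet_hit hτ hm (hB.inter (hcell i))).union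
      ((hD i).compl.inter (MeasurableSet.const _))
  · obtain ⟨i, hi⟩ := hC.cover t.2
    have hy : y ∈ D i := ⟨t, ht, hi⟩
    have h1 := hx i y hy
    refine ⟨i, ⟨hy, hC.trim i _ (hτ y) _ h1.1 t ht h1.2 hi⟩, ?_⟩
    rintro j ⟨hj, hjt⟩
    have h2 := (hx j y hj).2
    rw [hjt] at h2
    exact hC.index_unique h2 hi

/-- Containing a finite configuration from a given Borel set is a measurable event. -/
theorem IsRegular.measurableSet_exists_tuple (H : R.IsRegular) (hτ : ∀ y, τ y ∈ R.Omega n)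
    (hm : HitMeasurable τ) {ι : Type*} [Finite ι] {G : Set (ι → L n × Euc d)}
    (hG : MeasurableSet G) : MeasurableSet {y | ∃ g ∈ G, ∀ i, g i ∈ τ y} := by
  obtain ⟨D, x, hD, hx, hxτ, hex⟩ := H.exists_enumeration hτ hm
  have : {y | ∃ g ∈ G, ∀ i, g i ∈ τ y} = ⋃ a : ι → ℕ,
      (⋂ i, D (a i)) ∩ (fun y i => x (a i) y) ⁻¹' G := by
    ext y
    simp only [mem_ofPred_eq, mem_iUnion, mem_inter_iff, mem_iInter, mem_preimage]
    constructor
    · rintro ⟨g, hg, hgy⟩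
      choose a ha _ using fun i => hex y (g i) (hgy i)
      refine ⟨a, fun i => (ha i).1, ?_⟩
      rwa [show (fun i => x (a i) y) = g from funext fun i => (ha i).2]
    · rintro ⟨a, ha, hg⟩
      exact ⟨_, hg, fun i => hxτ _ y (ha i)⟩
  rw [this]
  refine MeasurableSet.iUnion fun a => (MeasurableSet.iInter fun i => hD _).inter ?_
  exact measurable_pi_lambda _ (fun i => hx (a i)) hG

/-- Sums over the tiles of a measurably varying tiling are measurable. -/
theorem IsRegular.measurable_tsum (H : R.IsRegular) (hτ : ∀ y, τ y ∈ R.Omega n)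
    (hm : HitMeasurable τ) {g : L n × Euc d → Y → ℝ≥0∞} (hg : Measurable (Function.uncurry g)) :
    Measurable fun y => ∑' t : τ y, g t y := by
  classical
  obtain ⟨D, x, hD, hx, hxτ, hex⟩ := H.exists_enumeration hτ hm
  have : (fun y => ∑' t : τ y, g t y) =
      fun y => ∑' i, (D i).indicator (fun y => g (x i y) y) y := by
    funext y
    have hb : Function.Bijective (fun i : {i // y ∈ D i} => (⟨x i y, hxτ i y i.2⟩ : τ y)) := by
      constructor
      · intro i j hij
        have h1 := Subtype.mk.inj hij
        exact Subtype.ext ((hex y _ (hxτ i y i.2)).unique ⟨i.2, rfl⟩ ⟨j.2, h1.symm⟩)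
      · rintro ⟨t, ht⟩
        obtain ⟨i, hi, -⟩ := hex y t ht
        exact ⟨⟨i, hi.1⟩, Subtype.ext hi.2⟩
    rw [← (Equiv.ofBijective _ hb).tsum_eq fun t : τ y => g t y]
    refine (tsum_subtype {i | y ∈ D i} fun i => g (x i y) y).trans (tsum_congr fun i => ?_)
    simp [indicator]
  rw [this]
  exact Measurable.tsum fun i =>
    (hg.comp ((hx i).prodMk measurable_id)).indicator (hD i)

end Hit

/-! ### The Borel structure of the tiling space -/

theorem exists_of_tilingDist_lt {T T' : R.Hull} {ε : ℝ} (hε : ε ≤ 1)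
    (h : R.tilingDist T T' < ε) : ∃ η, 0 < η ∧ η < ε ∧ ∃ P P' : Finset (L 0 × Euc d),
    (P : Set (L 0 × Euc d)) ⊆ T.1 ∧ (P' : Set (L 0 × Euc d)) ⊆ T'.1 ∧
    Metric.closedBall 0 (1 / η) ⊆ R.region 0 P ∧ R.DifferAtMost 0 η P P' := by
  obtain ⟨η, hη, hηε⟩ := exists_lt_of_csInf_lt (insert_nonempty _ _) h
  rcases hη with rfl | ⟨h0, -, P, P', h1, h2, -, -, h3, -, h4⟩
  · exact absurd hηε (not_lt.2 hε)
  · exact ⟨η, h0, hηε, P, P', h1, h2, h3, h4⟩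

theorem tilingDist_le {T T' : R.Hull} {ε : ℝ} (h : 0 < ε ∧ ε ≤ 1 ∧ ∃ P P' : Finset (L 0 × Euc d),
    (P : Set (L 0 × Euc d)) ⊆ T.1 ∧ (P' : Set (L 0 × Euc d)) ⊆ T'.1 ∧
    R.IsPatch 0 P ∧ R.IsPatch 0 P' ∧
    Metric.closedBall 0 (1 / ε) ⊆ R.region 0 P ∧ Metric.closedBall 0 (1 / ε) ⊆ R.region 0 P' ∧
    R.DifferAtMost 0 ε P P') : R.tilingDist T T' ≤ ε := by
  refine csInf_le ⟨0, ?_⟩ (Or.inr h)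
  rintro x (rfl | hx)
  · exact zero_le_one
  · exact hx.1.le

/-- Containing a tile from a given open set is an open condition on tilings. -/
theorem IsFusionRule.isOpen_hit (hR : R.IsFusionRule) {V : Set (L 0 × Euc d)} (hV : IsOpen V) :
    IsOpen {T : R.Hull | ∃ t ∈ T.1, t ∈ V} := by
  rintro T ⟨t, ht, htV⟩
  obtain ⟨ε, hε, hεV⟩ := hR.exists_tileDist_le_imp_mem (hV.mem_nhds htV)
  obtain ⟨y, hy⟩ := hR.interior_placedSupp_nonempty 0 t
  refine ⟨min (min ε 1) (1 / (‖y‖ + 1)), by positivity, fun T' hT' => ?_⟩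
  obtain ⟨η, hη0, hη, P, P', hP, hP', hc, e, he⟩ := exists_of_tilingDist_lt
    ((min_le_left _ _).trans (min_le_right _ _)) hT'
  rw [lt_min_iff, lt_min_iff] at hη
  have hyb : y ∈ Metric.closedBall (0 : Euc d) (1 / η) := by
    rw [mem_closedBall_zero_iff]
    have := one_div_lt_one_div_of_lt hη0 hη.2
    rw [one_div_one_div] at this
    linarith
  obtain ⟨s, hs, hys⟩ := mem_region.1 (hc hyb)
  have hst := T.2.1.1.eq_of_mem_interior ht (hP hs) hy hys
  subst hst
  exact ⟨e ⟨t, hs⟩, hP' (e ⟨t, hs⟩).2, hεV _ ((he ⟨t, hs⟩).trans hη.1.1.le)⟩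

theorem IsFusionRule.hitMeasurable_val (hR : R.IsFusionRule) :
    HitMeasurable fun T : R.Hull => T.1 := fun _ hV => (hR.isOpen_hit hV).measurableSet

/-- The tiles that meet a closed ball are those that meet a slightly larger one. -/
theorem IsRegular.exists_near_eq (H : R.IsRegular) {n : ℕ} {T : Set (L n × Euc d)}
    (hT : T ∈ R.Omega n) (ρ : ℝ) :
    ∃ η > 0, ∀ q, ρ ≤ q → q ≤ ρ + η → R.near n T q = R.near n T ρ := by
  have h1 : ∀ t : L n × Euc d, ¬ (Metric.closedBall 0 ρ ∩ R.placedSupp n t).Nonempty →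
      ∃ η > 0, ¬ (Metric.closedBall 0 (ρ + η) ∩ R.placedSupp n t).Nonempty := by
    intro t ht
    obtain ⟨y, hy, hmin⟩ := (isCompact_placedSupp n t).exists_isMinOn
      (H.fusion.placedSupp_nonempty n t) continuous_norm.continuousOn
    have hyρ : ρ < ‖y‖ := by
      by_contra hle
      exact ht ⟨y, by simpa using hle, hy⟩
    refine ⟨(‖y‖ - ρ) / 2, by linarith, ?_⟩
    rintro ⟨z, hz, hzt⟩
    have h2 : ‖y‖ ≤ ‖z‖ := hmin hzt
    rw [mem_closedBall_zero_iff] at hz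
    linarith
  choose! η hη h using h1
  classical
  let F := (H.finite_near hT (ρ + 1)).toFinset.filter fun t =>
    ¬ (Metric.closedBall 0 ρ ∩ R.placedSupp n t).Nonempty
  have hF : ∃ δ > 0, δ ≤ 1 ∧ ∀ t ∈ F, δ ≤ η t := by
    rcases F.eq_empty_or_nonempty with he | hne
    · exact ⟨1, one_pos, le_rfl, by simp [he]⟩
    · obtain ⟨t₀, ht₀, hmin⟩ := F.exists_min_image η hne
      exact ⟨min (η t₀) 1, lt_min (hη t₀ (Finset.mem_filter.1 ht₀).2) one_pos, min_le_right _ _,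
        fun t ht => (min_le_left _ _).trans (hmin t ht)⟩
  obtain ⟨δ, hδ, hδ1, hδF⟩ := hF
  refine ⟨δ, hδ, fun q hq hq' => ?_⟩
  ext t
  constructor
  · rintro ⟨ht, y, hy, hyt⟩
    refine ⟨ht, ?_⟩
    by_contra hne
    have hy1 : y ∈ Metric.closedBall (0 : Euc d) (ρ + 1) :=
      Metric.closedBall_subset_closedBall (by linarith) hy
    have htF : t ∈ F := Finset.mem_filter.2 ⟨by simpa using ⟨ht, y, hy1, hyt⟩, hne⟩
    exact h t hne ⟨y, Metric.closedBall_subset_closedBall (by linarith [hδF t htF]) hy, hyt⟩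
  · rintro ⟨ht, y, hy, hyt⟩
    exact ⟨ht, y, Metric.closedBall_subset_closedBall hq hy, hyt⟩

theorem IsFusionRule.tileDist_pos (hR : R.IsFusionRule) {n : ℕ} {t s : L n × Euc d}
    (h : t ≠ s) : 0 < R.tileDist n t s := by
  obtain ⟨ε, hε, h'⟩ := hR.exists_tileDist_le_imp_mem (isOpen_compl_singleton.mem_nhds h)
  by_contra hle
  exact h' s ((not_lt.1 hle).trans hε.le) rfl

/-- The finite configurations of tiles that cover the closed ball of radius `q` and, robustly under
small motions that keep the ball covered, force a tiling to belong to `W`. -/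
def forcing (R : FusionData d L) (W : Set R.Hull) (k : ℕ) (q : ℝ) :
    Set (Fin k → L 0 × Euc d) :=
  {g | Metric.closedBall 0 q ⊆ ⋃ i, R.placedSupp 0 (g i) ∧
    ∃ δ > 0, ∀ g' : Fin k → L 0 × Euc d, Metric.closedBall 0 q ⊆ ⋃ i, R.placedSupp 0 (g' i) →
      (∀ i, R.tileDist 0 (g i) (g' i) < δ) → ∀ T : R.Hull, (∀ i, g' i ∈ T.1) → T ∈ W}

theorem IsFusionRule.measurableSet_forcing (hR : R.IsFusionRule) (W : Set R.Hull) (k : ℕ)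
    (q : ℝ) : MeasurableSet (R.forcing W k q) := by
  refine (hR.isClosed_subset_iUnion_placedSupp 0 _).measurableSet.inter (IsOpen.measurableSet ?_)
  refine isOpen_iff_mem_nhds.2 ?_
  rintro g ⟨δ, hδ, h⟩
  have : ∀ᶠ g'' in 𝓝 g, ∀ i, R.tileDist 0 (g i) (g'' i) < δ / 2 := eventually_all.2 fun i =>
    (continuous_apply i).continuousAt.eventually (hR.eventually_tileDist_lt (g i) (half_pos hδ))
  filter_upwards [this] with g'' hg''
  refine ⟨δ / 2, half_pos hδ, fun g' hg' hgg T hT => h g' hg' (fun i => ?_) T hT⟩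
  linarith [hR.tileDist_triangle 0 (g i) (g'' i) (g' i), hg'' i, hgg i]

/-- Every tiling in an open set `W` contains a configuration that forces membership in `W`: the tiles
that meet a ball, whose radius can be increased to a rational number `q` without meeting further
tiles. A motion that is small compared to the distances between these tiles keeps them distinct, and
one that is small compared to the increase of the radius keeps them in contact with the larger ball,
so that the moved tiles still form a patch. -/
theorem IsRegular.exists_mem_forcing (H : R.IsRegular) {W : Set R.Hull} (hW : IsOpen W)
    {T : R.Hull} (hT : T ∈ W) :
    ∃ (k : ℕ) (q : ℚ), ∃ g ∈ R.forcing W k q, ∀ i, g i ∈ T.1 := by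
  have hR := H.fusion
  obtain ⟨ε₀, hε₀, hεW⟩ := hW T hT
  obtain ⟨ε, hε, hε1, hεε⟩ : ∃ ε > 0, ε ≤ 1 ∧ ε < ε₀ :=
    ⟨min (ε₀ / 2) 1, by positivity, min_le_right _ _,
      (min_le_left _ _).trans_lt (half_lt_self hε₀)⟩
  obtain ⟨η, hη, hnear⟩ := H.exists_near_eq T.2 (1 / ε)
  obtain ⟨q, hq, hqη⟩ := exists_rat_btwn (lt_add_of_pos_right (1 / ε) hη)
  have hfin := H.finite_near T.2 (1 / ε)
  let P := hfin.toFinset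
  have hP : ∀ t, t ∈ P ↔ t ∈ R.near 0 T.1 (1 / ε) := fun t => by simp [P]
  let φ : Fin P.card ≃ P := P.equivFin.symm
  let g : Fin P.card → L 0 × Euc d := fun i => φ i
  have hgT : ∀ i, g i ∈ T.1 := fun i => ((hP _).1 (φ i).2).1
  have hginj : Function.Injective g := fun i j hij => φ.injective (Subtype.ext hij)
  have hcov : Metric.closedBall 0 (q : ℝ) ⊆ ⋃ i, R.placedSupp 0 (g i) := by
    intro y hy
    obtain ⟨t, ht, hyt⟩ := mem_region.1 (closedBall_subset_region_near T.2.1.2 _ hy)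
    rw [hnear q hq.le hqη.le] at ht
    refine mem_iUnion.2 ⟨φ.symm ⟨t, (hP t).2 ht⟩, ?_⟩
    simpa [g] using hyt
  have hq0 : (0 : ℝ) ≤ q := (by positivity : (0 : ℝ) ≤ 1 / ε).trans hq.le
  -- the tiles of the configuration are at mutual distance at least `2 * δ`
  have hsep : ∃ δ > 0, ∀ i j, i ≠ j → 2 * δ ≤ R.tileDist 0 (g i) (g j) := by
    have : ∀ p : Fin P.card × Fin P.card, ∃ δ > 0, p.1 ≠ p.2 →
        2 * δ ≤ R.tileDist 0 (g p.1) (g p.2) := by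
      intro p
      by_cases hp : p.1 = p.2
      · exact ⟨1, one_pos, fun h => absurd hp h⟩
      · have := hR.tileDist_pos (hginj.ne hp)
        exact ⟨_, half_pos this, fun _ => by linarith⟩
    choose δ hδ h using this
    rcases isEmpty_or_nonempty (Fin P.card × Fin P.card) with he | hne
    · exact ⟨1, one_pos, fun i j _ => (he.false (i, j)).elim⟩
    · obtain ⟨p, hp⟩ := Finite.exists_min δ
      exact ⟨δ p, hδ p, fun i j hij => by linarith [h (i, j) hij, hp (i, j)]⟩
  obtain ⟨δ₁, hδ₁, hsep⟩ := hsep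
  refine ⟨P.card, q, g, ⟨hcov, min δ₁ (min ε (q - 1 / ε)), by
    have : 0 < (q : ℝ) - 1 / ε := by linarith
    positivity, fun g' hg' hgg T' hT' => hεW T' (lt_of_le_of_lt (tilingDist_le ?_) hεε)⟩, hgT⟩
  have hg'inj : Function.Injective g' := by
    intro i j hij
    by_contra hne
    have h1 := (hgg i).trans_le (min_le_left _ _)
    have h2 := (hgg j).trans_le (min_le_left _ _)
    rw [tileDist_comm, ← hij] at h2
    linarith [hR.tileDist_triangle 0 (g i) (g' i) (g j), hsep i j hne]
  classical
  let P' : Finset (L 0 × Euc d) := Finset.univ.image g'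
  have hregP' : R.region 0 (P' : Set (L 0 × Euc d)) = ⋃ i, R.placedSupp 0 (g' i) := by
    simp [region, P']
  have hregP : R.region 0 (P : Set (L 0 × Euc d)) = R.region 0 (R.near 0 T.1 (1 / ε)) := by
    simp [P]
  have hqsub : Metric.closedBall (0 : Euc d) (1 / ε) ⊆ Metric.closedBall 0 (q : ℝ) :=
    Metric.closedBall_subset_closedBall hq.le
  have hP'T' : (P' : Set (L 0 × Euc d)) ⊆ T'.1 := by
    intro t ht
    obtain ⟨i, -, rfl⟩ := Finset.mem_image.1 (Finset.mem_coe.1 ht)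
    exact hT' i
  refine ⟨hε, hε1, P, P', fun t ht => ((hP t).1 ht).1, hP'T',
    H.isPatch_near T.2 (by positivity), ⟨?_, T'.2.1.1.mono hP'T', ?_⟩, ?_, ?_, ?_⟩
  · have h0 : (0 : Euc d) ∈ Metric.closedBall 0 (q : ℝ) := by simpa using hq0
    obtain ⟨i, -⟩ := mem_iUnion.1 (hg' h0)
    exact ⟨g' i, Finset.mem_image_of_mem _ (Finset.mem_univ i)⟩
  · refine hR.isConnected_region hq0 (hregP' ▸ hg') ?_
    intro t ht
    obtain ⟨i, -, rfl⟩ := Finset.mem_image.1 (Finset.mem_coe.1 ht)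
    obtain ⟨y, hy, hyt⟩ := ((hP _).1 (φ i).2).2
    obtain ⟨z, hz, hyz⟩ := hR.exists_mem_dist_lt
      ((hgg i).trans_le ((min_le_right _ _).trans (min_le_right _ _))) hyt
    refine ⟨z, ?_, hz⟩
    rw [Metric.mem_closedBall] at hy ⊢
    linarith [dist_triangle_left z 0 y]
  · rw [hregP]
    exact closedBall_subset_region_near T.2.1.2 _
  · rw [hregP']
    exact hqsub.trans hg'
  · refine differAtMost_image (fun t => g' (φ.symm t)) (fun a b hab => ?_) (fun t => ?_) ?_
    · exact φ.symm.injective (hg'inj hab)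
    · have := ((hgg (φ.symm t)).trans_le ((min_le_right _ _).trans (min_le_left _ _))).le
      simpa [g] using this
    · intro s
      simp only [P', Finset.mem_image, Finset.mem_univ, true_and]
      exact ⟨fun ⟨i, hi⟩ => ⟨φ i, by simpa using hi⟩, fun ⟨t, ht⟩ => ⟨_, ht⟩⟩

variable [∀ n, Nonempty (L n)]

/-- The Borel structure of the tiling metric is generated by the events that a tiling has a tile in
a given open set: an open set is a countable union of events that the tiling contains a
configuration from a Borel set of finite configurations. -/
theorem IsRegular.measurable_of_hitMeasurable (H : R.IsRegular) {Y : Type*} [MeasurableSpace Y]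
    {f : Y → R.Hull} (hf : HitMeasurable fun y => (f y).1) : Measurable f := by
  refine measurable_of_isOpen fun W hW => ?_
  have : f ⁻¹' W = ⋃ (k : ℕ) (q : ℚ), {y | ∃ g ∈ R.forcing W k q, ∀ i, g i ∈ (f y).1} := by
    ext y
    simp only [mem_preimage, mem_iUnion, mem_ofPred_eq]
    constructor
    · exact fun hy => H.exists_mem_forcing hW hy
    · rintro ⟨k, q, g, ⟨hg, δ, hδ, h⟩, hgy⟩
      exact h g hg (fun i => by simpa using hδ) (f y) hgy
  rw [this]
  exact MeasurableSet.iUnion fun k => MeasurableSet.iUnion fun q =>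
    H.measurableSet_exists_tuple (fun y => (f y).2) hf (H.fusion.measurableSet_forcing W k q)

/-! ### Counting measures -/

/-- The counting measure of a set of points. -/
def points {X : Type*} [MeasurableSpace X] (A : Set X) : Measure X :=
  Measure.sum fun a : A => Measure.dirac (a : X)

theorem lintegral_points {X : Type*} [MeasurableSpace X] [MeasurableSingletonClass X] (A : Set X)
    (f : X → ℝ≥0∞) : ∫⁻ x, f x ∂(points A) = ∑' a : A, f a := by
  rw [points, lintegral_sum_measure]
  exact tsum_congr fun a => lintegral_dirac _ _

theorem points_apply {X : Type*} [MeasurableSpace X] (A : Set X) {B : Set X}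
    (hB : MeasurableSet B) : points A B = ∑' a : A, B.indicator 1 (a : X) := by
  rw [points, Measure.sum_apply _ hB]
  exact tsum_congr fun a => Measure.dirac_apply' _ hB

open Classical in
theorem points_finset_apply {X : Type*} [MeasurableSpace X] (P : Finset X) {B : Set X}
    (hB : MeasurableSet B) : points (P : Set X) B = (P.filter (· ∈ B)).card := by
  rw [points_apply _ hB, Finset.tsum_subtype' P (B.indicator 1)]
  simp [indicator]

instance {X : Type*} [MeasurableSpace X] (P : Finset X) : IsFiniteMeasure (points (P : Set X)) := by
  constructor
  rw [points_finset_apply _ MeasurableSet.univ]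
  exact ENNReal.natCast_lt_top _

/-- A sum over the `n`-supertiles of a subdivision is a sum over the `N`-supertiles and their
constituents. -/
theorem IsFusionRule.tsum_subdivide (hR : R.IsFusionRule) {n N : ℕ} (h : n ≤ N)
    {T : Set (L N × Euc d)} (hT : R.NonOverlapping N T) (f : L n × Euc d → ℝ≥0∞) :
    ∑' s : R.subdivide h T, f s = ∑' t : T, ∑ s ∈ R.sub h t, f s := by
  have hb : Function.Bijective (fun p : Σ t : T, R.sub h (t : L N × Euc d) =>
      (⟨p.2, mem_subdivide.2 ⟨p.1, p.1.2, p.2.2⟩⟩ : R.subdivide h T)) := by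
    constructor
    · rintro ⟨⟨t, ht⟩, ⟨s, hs⟩⟩ ⟨⟨t', ht'⟩, ⟨s', hs'⟩⟩ hp
      have h1 : s = s' := Subtype.mk.inj hp
      subst h1
      have h2 := hR.eq_of_mem_sub hT ht ht' hs hs'
      subst h2
      rfl
    · rintro ⟨s, hs⟩
      obtain ⟨t, ht, hst⟩ := mem_subdivide.1 hs
      exact ⟨⟨⟨t, ht⟩, ⟨s, hst⟩⟩, rfl⟩
  rw [← (Equiv.ofBijective _ hb).tsum_eq fun s : R.subdivide h T => f s]
  refine (ENNReal.tsum_sigma' _).trans (tsum_congr fun t => ?_)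
  exact Finset.tsum_subtype (R.sub h (t : L N × Euc d)) f

/-- The number of constituents in an open set can only go up under small changes of a supertile. -/
theorem IsFusionRule.measurable_points_sub_succ (hR : R.IsFusionRule) (n : ℕ) :
    Measurable fun t : L (n + 1) × Euc d =>
      points (R.sub (Nat.le_succ n) t : Set (L n × Euc d)) := by
  classical
  have key : ∀ V : Set (L n × Euc d), IsOpen V → Measurable fun t : L (n + 1) × Euc d =>
      points (R.sub (Nat.le_succ n) t : Set (L n × Euc d)) V := by
    intro V hV
    refine LowerSemicontinuous.measurable fun t y hy => ?_
    have hε : ∃ ε > 0, ∀ s ∈ (R.sub (Nat.le_succ n) t).filter (· ∈ V),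
        ∀ s', R.tileDist n s s' ≤ ε → s' ∈ V := by
      have h1 : ∀ s, ∃ ε > 0, s ∈ V → ∀ s', R.tileDist n s s' ≤ ε → s' ∈ V := by
        intro s
        by_cases hs : s ∈ V
        · obtain ⟨ε, hε, h⟩ := hR.exists_tileDist_le_imp_mem (hV.mem_nhds hs)
          exact ⟨ε, hε, fun _ => h⟩
        · exact ⟨1, one_pos, fun h => absurd h hs⟩
      choose ε hε h1 using h1
      rcases ((R.sub (Nat.le_succ n) t).filter (· ∈ V)).eq_empty_or_nonempty with he | hne
      · exact ⟨1, one_pos, by simp [he]⟩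
      · obtain ⟨s₀, hs₀, hmin⟩ := Finset.exists_min_image _ ε hne
        exact ⟨ε s₀, hε s₀, fun s hs s' hss => h1 s (Finset.mem_filter.1 hs).2 s'
          (hss.trans (hmin s hs))⟩
    obtain ⟨ε, hε, hεV⟩ := hε
    obtain ⟨η, hη, h⟩ := hR.exists_differAtMost_sub t hε
    filter_upwards [hR.eventually_tileDist_lt t hη] with t' ht'
    refine lt_of_lt_of_le hy ?_
    rw [points_finset_apply _ hV.measurableSet, points_finset_apply _ hV.measurableSet]
    obtain ⟨e, he⟩ := h t' ht'.le
    refine Nat.cast_le.2 (Finset.card_le_card_of_injOn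
      (fun s => if hs : s ∈ R.sub (Nat.le_succ n) t then e ⟨s, hs⟩ else s) ?_ ?_)
    · intro s hs
      have hs1 := (Finset.mem_filter.1 hs).1
      simp only [dif_pos hs1, Finset.coe_filter]
      exact ⟨(e ⟨s, hs1⟩).2, hεV s hs _ (he ⟨s, hs1⟩)⟩
    · intro s hs s' hs' hss
      have hs1 := (Finset.mem_filter.1 hs).1
      have hs1' := (Finset.mem_filter.1 hs').1
      simp only [dif_pos hs1, dif_pos hs1'] at hss
      exact Subtype.mk.inj (e.injective (Subtype.ext hss))
  exact Measurable.measure_of_isPiSystem (BorelSpace.measurable_eq (α := L n × Euc d))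
    isPiSystem_isOpen key (key univ isOpen_univ)

theorem IsFusionRule.measurable_points_sub (hR : R.IsFusionRule) {n N : ℕ} (h : n ≤ N) :
    Measurable fun t : L N × Euc d => points (R.sub h t : Set (L n × Euc d)) := by
  induction N, h using Nat.le_induction with
  | base =>
    have : (fun t : L n × Euc d => points (R.sub (le_refl n) t : Set (L n × Euc d))) =
        Measure.dirac := by
      funext t
      ext B hB
      classical
      rw [points_finset_apply _ hB, sub_self, Finset.filter_singleton,
        Measure.dirac_apply' _ hB]
      by_cases ht : t ∈ B <;> simp [ht]
    rw [this]
    exact Measure.measurable_dirac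
  | succ N h ih =>
    have : (fun t : L (N + 1) × Euc d =>
        points (R.sub (Nat.le_succ_of_le h) t : Set (L n × Euc d))) = fun t =>
        (points (R.sub (Nat.le_succ N) t : Set (L N × Euc d))).bind
          fun u => points (R.sub h u : Set (L n × Euc d)) := by
      funext t
      ext B hB
      have e : (R.sub (Nat.le_succ_of_le h) t : Set (L n × Euc d)) =
          R.subdivide h (R.sub (Nat.le_succ N) t : Set (L N × Euc d)) := by
        rw [← subdivide_singleton (Nat.le_succ N), subdivide_subdivide, ← subdivide_singleton]
      rw [Measure.bind_apply hB ih.aemeasurable, lintegral_points, e, points_apply _ hB]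
      have h1 := hR.tsum_subdivide h (hR.nonOverlapping_sub (Nat.le_succ N) t)
        (B.indicator 1)
      refine h1.trans (tsum_congr fun u => ?_)
      rw [points_apply _ hB, Finset.tsum_subtype' _ (B.indicator 1)]
    rw [this]
    exact (Measure.measurable_bind' ih).comp (hR.measurable_points_sub_succ N)

theorem IsFusionRule.measurable_sum_sub (hR : R.IsFusionRule) {n N : ℕ} (h : n ≤ N)
    {f : L n × Euc d → ℝ≥0∞} (hf : Measurable f) :
    Measurable fun t : L N × Euc d => ∑ s ∈ R.sub h t, f s := by
  convert (Measure.measurable_lintegral hf).comp (hR.measurable_points_sub h) using 2 with t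
  simp only [Function.comp]
  rw [lintegral_points, Finset.tsum_subtype' _ f]

theorem IsFusionRule.measurableSet_sub_hit (hR : R.IsFusionRule) {n N : ℕ} (h : n ≤ N)
    {B : Set (L n × Euc d)} (hB : MeasurableSet B) :
    MeasurableSet {t : L N × Euc d | ∃ s ∈ R.sub h t, s ∈ B} := by
  have h1 := (hR.measurable_sum_sub h (f := B.indicator 1) (measurable_one.indicator hB))
    (measurableSet_singleton 0).compl
  convert h1 using 1
  ext t
  simp [indicator]

/-- The number of ordered `k`-tuples of constituents in a given Borel set depends measurably on the
supertile. -/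
theorem IsFusionRule.measurable_card_tuples (hR : R.IsFusionRule) {n N : ℕ} (h : n ≤ N) {k : ℕ}
    {G : Set (Fin k → L n × Euc d)} (hG : MeasurableSet G) :
    Measurable fun t : L N × Euc d =>
      points ((Fintype.piFinset fun _ : Fin k => R.sub h t : Finset _) :
        Set (Fin k → L n × Euc d)) G := by
  classical
  have key : ∀ B : Fin k → Set (L n × Euc d), (∀ i, MeasurableSet (B i)) →
      Measurable fun t : L N × Euc d =>
        points ((Fintype.piFinset fun _ : Fin k => R.sub h t : Finset _) :
          Set (Fin k → L n × Euc d)) (univ.pi B) := by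
    intro B hB
    have : ∀ t : L N × Euc d,
        points ((Fintype.piFinset fun _ : Fin k => R.sub h t : Finset _) :
          Set (Fin k → L n × Euc d)) (univ.pi B) =
        ∏ i, points (R.sub h t : Set (L n × Euc d)) (B i) := by
      intro t
      rw [points_finset_apply _ (MeasurableSet.univ_pi hB)]
      have h1 : (Fintype.piFinset fun _ : Fin k => R.sub h t).filter (· ∈ univ.pi B) =
          Fintype.piFinset fun i => (R.sub h t).filter (· ∈ B i) := by
        ext g
        simp [Fintype.mem_piFinset, forall_and]
      rw [h1, Fintype.card_piFinset, Nat.cast_prod]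
      exact Finset.prod_congr rfl fun i _ => (points_finset_apply _ (hB i)).symm
    simp only [this]
    exact Finset.measurable_prod _ fun i _ =>
      (Measure.measurable_coe (hB i)).comp (hR.measurable_points_sub h)
  refine (Measure.measurable_coe hG).comp ?_
  refine Measurable.measure_of_isPiSystem generateFrom_pi.symm isPiSystem_pi ?_ ?_
  · rintro _ ⟨B, hB, rfl⟩
    exact key B fun i => hB i (mem_univ i)
  · simpa using key (fun _ => univ) fun _ => MeasurableSet.univ

/-! ### Borel conditions on configurations of supertiles -/

/-- The overlapping pairs form a Borel set: two regular closed sets overlap if and only if some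
small ball is contained in one of them and meets the other. -/
theorem IsFusionRule.measurableSet_nonOverlapping_pair (hR : R.IsFusionRule) (n : ℕ) :
    MeasurableSet {p : (L n × Euc d) × (L n × Euc d) |
      R.placedSupp n p.1 ∩ R.placedSupp n p.2 ⊆
        frontier (R.placedSupp n p.1) ∩ frontier (R.placedSupp n p.2)} := by
  have key : MeasurableSet {p : (L n × Euc d) × (L n × Euc d) |
      (interior (R.placedSupp n p.1) ∩ R.placedSupp n p.2).Nonempty} := by
    have : {p : (L n × Euc d) × (L n × Euc d) |
        (interior (R.placedSupp n p.1) ∩ R.placedSupp n p.2).Nonempty} =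
        ⋃ (i : ℕ) (q : ℚ), {p | Metric.ball (denseSeq (Euc d) i) q ⊆ R.placedSupp n p.1} ∩
          {p | (Metric.ball (denseSeq (Euc d) i) q ∩ R.placedSupp n p.2).Nonempty} := by
      ext p
      simp only [mem_ofPred_eq, mem_iUnion, mem_inter_iff]
      constructor
      · rintro ⟨y, hy, hy2⟩
        obtain ⟨ε, hε, hb⟩ := Metric.isOpen_iff.1 isOpen_interior y hy
        obtain ⟨q, hq0, hq⟩ := exists_rat_btwn (half_pos hε)
        obtain ⟨i, hi⟩ := (denseRange_denseSeq (Euc d)).exists_dist_lt y hq0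
        refine ⟨i, q, fun z hz => interior_subset (hb ?_), y, hi, hy2⟩
        rw [Metric.mem_ball] at hz ⊢
        linarith [dist_triangle_right z y (denseSeq (Euc d) i)]
      · rintro ⟨i, q, h1, y, hy, hy2⟩
        exact ⟨y, interior_maximal h1 Metric.isOpen_ball hy, hy2⟩
    rw [this]
    exact MeasurableSet.iUnion fun i => MeasurableSet.iUnion fun q =>
      (measurable_fst (hR.isClosed_subset_placedSupp n _).measurableSet).inter
        (measurable_snd (hR.isOpen_inter_placedSupp_nonempty n Metric.isOpen_ball).measurableSet)
  have hswap := measurable_swap key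
  convert (key.union hswap).compl using 1
  ext p
  simp only [(isClosed_placedSupp n _).frontier_eq, mem_ofPred_eq, mem_compl_iff, mem_union,
    mem_preimage, Prod.fst_swap, Prod.snd_swap, not_or, not_nonempty_iff_eq_empty,
    eq_empty_iff_forall_notMem, mem_inter_iff, not_and, subset_def, Set.mem_sdiff]
  constructor
  · intro h
    exact ⟨fun y hy hy2 => (h y ⟨interior_subset hy, hy2⟩).1.2 hy,
      fun y hy hy1 => (h y ⟨hy1, interior_subset hy⟩).2.2 hy⟩
  · rintro ⟨h1, h2⟩ y ⟨hy1, hy2⟩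
    exact ⟨⟨hy1, fun h => h1 y h hy2⟩, ⟨hy2, fun h => h2 y h hy1⟩⟩

open Classical in
/-- Among the injective configurations, the admitted ones are those in the closure of the
configurations that occur in supertiles. -/
theorem IsFusionRule.admitted_image_iff (hR : R.IsFusionRule) {n : ℕ} {ι : Type*} [Fintype ι]
    {g : ι → L n × Euc d} (hg : Function.Injective g) :
    R.Admitted n (Finset.univ.image g) ↔ g ∈ closure {f : ι → L n × Euc d |
      Function.Injective f ∧ ∃ (N : ℕ) (h : n ≤ N) (t : L N × Euc d), ∀ i, f i ∈ R.sub h t} := by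
  have hmem : ∀ i, g i ∈ Finset.univ.image g := fun i =>
    Finset.mem_image_of_mem _ (Finset.mem_univ i)
  rw [admitted_iff, mem_closure_iff_nhds]
  constructor
  · intro hA V hV
    rw [nhds_pi, Filter.mem_pi'] at hV
    obtain ⟨I, W, hW, hWV⟩ := hV
    choose ε hε h using fun i => hR.exists_tileDist_le_imp_mem (hW i)
    obtain ⟨δ, hδ, hδε⟩ : ∃ δ > 0, ∀ i, δ ≤ ε i := by
      rcases isEmpty_or_nonempty ι with he | hne
      · exact ⟨1, one_pos, fun i => (he.false i).elim⟩
      · obtain ⟨i, hi⟩ := Finite.exists_min ε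
        exact ⟨ε i, hε i, hi⟩
    obtain ⟨N, hN, t, φ, hφ, ht⟩ := hA δ hδ
    refine ⟨fun i => φ ⟨g i, hmem i⟩, hWV fun i _ => h i _ ((ht ⟨g i, hmem i⟩).2.trans (hδε i)),
      fun i j hij => hg (Subtype.mk.inj (hφ hij)), N, hN, t, fun i => (ht _).1⟩
  · intro hA ε hε
    have : ∀ᶠ f in 𝓝 g, ∀ i, R.tileDist n (g i) (f i) < ε := eventually_all.2 fun i =>
      (continuous_apply i).continuousAt.eventually (hR.eventually_tileDist_lt (g i) hε)
    obtain ⟨f, hf, hfinj, N, hN, t, ht⟩ := hA _ this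
    have hinv : ∀ s : (Finset.univ.image g : Finset _), ∃ i, g i = s := fun s => by
      obtain ⟨i, -, hi⟩ := Finset.mem_image.1 s.2
      exact ⟨i, hi⟩
    choose ψ hψ using hinv
    refine ⟨N, hN, t, fun s => f (ψ s), ?_, fun s => ⟨ht _, ?_⟩⟩
    · intro s s' hss
      have := hfinj hss
      exact Subtype.ext (by rw [← hψ s, ← hψ s', this])
    · have := (hf (ψ s)).le
      rwa [hψ] at this

/-! ### The decomposition into `n`-supertiles is Borel -/

/-- The set of supertiles that is encoded by a sequence: the `i`-th term counts if its control point
lies in the `i`-th cell. -/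
def decode (C : ℕ → Set (Euc d)) {X : Type*} (s : ℕ → X × Euc d) : Set (X × Euc d) :=
  {t | ∃ i, s i = t ∧ t.2 ∈ C i}

/-- The sequences that encode tilings in `Ω^{(n)}`; the term `b i` stands for a cell without control
points. -/
def codes (R : FusionData d L) (n : ℕ) (C : ℕ → Set (Euc d)) (b : ℕ → L n × Euc d) :
    Set (ℕ → L n × Euc d) :=
  {s | (∀ i, (s i).2 ∈ C i ∨ s i = b i) ∧ decode C s ∈ R.Omega n}

theorem mem_decode {C : ℕ → Set (Euc d)} {X : Type*} {s : ℕ → X × Euc d} {t : X × Euc d} :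
    t ∈ decode C s ↔ ∃ i, s i = t ∧ t.2 ∈ C i := Iff.rfl

theorem IsRegular.measurableSet_codes (H : R.IsRegular) {n : ℕ} {C : ℕ → Set (Euc d)}
    (hC : IsCellPartition R n C) (b : ℕ → L n × Euc d) :
    MeasurableSet (R.codes n C b) := by
  classical
  have hR := H.fusion
  have hres : ∀ J : Finset ℕ, Measurable fun (s : ℕ → L n × Euc d) (i : J) => s i := fun J =>
    measurable_pi_lambda _ fun i => measurable_pi_apply (i : ℕ)
  have hcell : ∀ i, MeasurableSet {s : ℕ → L n × Euc d | (s i).2 ∈ C i} := fun i =>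
    (measurable_snd.comp (measurable_pi_apply i)) (hC.measurable i)
  -- the tiles do not overlap
  have h1 : MeasurableSet {s : ℕ → L n × Euc d | R.NonOverlapping n (decode C s)} := by
    have : {s : ℕ → L n × Euc d | R.NonOverlapping n (decode C s)} =
        ⋂ (i : ℕ) (j : ℕ), ({s | (s i).2 ∈ C i} ∩ {s | (s j).2 ∈ C j} ∩ {s | s i ≠ s j})ᶜ ∪
          (fun s => (s i, s j)) ⁻¹' {p : (L n × Euc d) × (L n × Euc d) |
            R.placedSupp n p.1 ∩ R.placedSupp n p.2 ⊆
              frontier (R.placedSupp n p.1) ∩ frontier (R.placedSupp n p.2)} := by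
      ext s
      simp only [mem_ofPred_eq, mem_iInter, mem_union, mem_compl_iff, mem_inter_iff, mem_preimage]
      constructor
      · intro h i j
        by_contra! h'
        exact h'.2 (h _ ⟨i, rfl, h'.1.1.1⟩ _ ⟨j, rfl, h'.1.1.2⟩ h'.1.2)
      · rintro h _ ⟨i, rfl, hi⟩ _ ⟨j, rfl, hj⟩ hne
        exact (h i j).resolve_left fun h' => h' ⟨⟨hi, hj⟩, hne⟩
    rw [this]
    refine MeasurableSet.iInter fun i => MeasurableSet.iInter fun j => ?_
    refine (((hcell i).inter (hcell j)).inter ?_).compl.union ?_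
    · exact (measurableSet_eq_fun (measurable_pi_apply i) (measurable_pi_apply j)).compl
    · exact ((measurable_pi_apply i).prodMk (measurable_pi_apply j))
        (hR.measurableSet_nonOverlapping_pair n)
  -- finitely many tiles cover any given ball
  have h2 : MeasurableSet {s : ℕ → L n × Euc d | ∀ m : ℕ, ∃ J : Finset ℕ,
      (∀ i ∈ J, (s i).2 ∈ C i) ∧
        Metric.closedBall 0 (m : ℝ) ⊆ ⋃ i : J, R.placedSupp n (s i)} := by
    have : {s : ℕ → L n × Euc d | ∀ m : ℕ, ∃ J : Finset ℕ, (∀ i ∈ J, (s i).2 ∈ C i) ∧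
        Metric.closedBall 0 (m : ℝ) ⊆ ⋃ i : J, R.placedSupp n (s i)} =
        ⋂ m : ℕ, ⋃ J : Finset ℕ, (⋂ i ∈ J, {s | (s i).2 ∈ C i}) ∩
          (fun s (i : J) => s i) ⁻¹' {f : J → L n × Euc d |
            Metric.closedBall 0 (m : ℝ) ⊆ ⋃ i : J, R.placedSupp n (f i)} := by
      ext s
      simp
    rw [this]
    refine MeasurableSet.iInter fun m => MeasurableSet.iUnion fun J => ?_
    refine (Finset.measurableSet_biInter _ fun i _ => hcell i).inter ?_
    exact hres J (hR.isClosed_subset_iUnion_placedSupp n _).measurableSet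
  -- all finite subsets are admitted
  have h3 : MeasurableSet {s : ℕ → L n × Euc d | ∀ J : Finset ℕ,
      (∀ i ∈ J, (s i).2 ∈ C i) → (fun i : J => s i) ∈ closure {f : J → L n × Euc d |
        Function.Injective f ∧
          ∃ (N : ℕ) (h : n ≤ N) (t : L N × Euc d), ∀ i, f i ∈ R.sub h t}} := by
    have : {s : ℕ → L n × Euc d | ∀ J : Finset ℕ,
        (∀ i ∈ J, (s i).2 ∈ C i) → (fun i : J => s i) ∈ closure {f : J → L n × Euc d |
          Function.Injective f ∧
            ∃ (N : ℕ) (h : n ≤ N) (t : L N × Euc d), ∀ i, f i ∈ R.sub h t}} =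
        ⋂ J : Finset ℕ, (⋂ i ∈ J, {s | (s i).2 ∈ C i})ᶜ ∪
          (fun s (i : J) => s i) ⁻¹' closure {f : J → L n × Euc d | Function.Injective f ∧
            ∃ (N : ℕ) (h : n ≤ N) (t : L N × Euc d), ∀ i, f i ∈ R.sub h t} := by
      ext s
      simp only [mem_ofPred_eq, mem_iInter, mem_union, mem_compl_iff, mem_preimage,
        imp_iff_not_or]
    rw [this]
    refine MeasurableSet.iInter fun J => ?_
    refine (Finset.measurableSet_biInter _ fun i _ => hcell i).compl.union ?_
    exact hres J isClosed_closure.measurableSet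
  have h0 : MeasurableSet {s : ℕ → L n × Euc d | ∀ i, (s i).2 ∈ C i ∨ s i = b i} := by
    have : {s : ℕ → L n × Euc d | ∀ i, (s i).2 ∈ C i ∨ s i = b i} =
        ⋂ i, ({s | (s i).2 ∈ C i} ∪ {s | s i = b i}) := by
      ext s
      simp
    rw [this]
    exact MeasurableSet.iInter fun i => (hcell i).union
      (measurableSet_eq_fun (measurable_pi_apply i) measurable_const)
  convert h0.inter (h1.inter (h2.inter h3)) using 1
  ext s
  refine and_congr_right fun hs0 => ?_
  rw [H.mem_Omega_iff]
  simp only [mem_inter_iff, mem_ofPred_eq]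
  have hinj : ∀ J : Finset ℕ, (∀ i ∈ J, (s i).2 ∈ C i) → Function.Injective fun i : J => s i := by
    intro J hJ i j hij
    have h4 := hJ j j.2
    rw [← show s i = s j from hij] at h4
    exact Subtype.ext (hC.index_unique (hJ i i.2) h4)
  constructor
  · rintro ⟨⟨hno, hcov⟩, hadm⟩
    have hΩ : decode C s ∈ R.Omega n := H.mem_Omega_iff.2 ⟨⟨hno, hcov⟩, hadm⟩
    refine ⟨hno, fun m => ?_, fun J hJ => ?_⟩
    · have hex : ∀ t ∈ decode C s, ∃ i, s i = t ∧ t.2 ∈ C i := fun t ht => ht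
      choose! idx hidx using hex
      refine ⟨(H.finite_near hΩ m).toFinset.image idx, ?_, ?_⟩
      · intro i hi
        obtain ⟨t, ht, rfl⟩ := Finset.mem_image.1 hi
        have ht' : t ∈ R.near n (decode C s) m := by simpa using ht
        rw [(hidx t ht'.1).1]
        exact (hidx t ht'.1).2
      · intro y hy
        obtain ⟨t, ht, hyt⟩ := mem_region.1 (closedBall_subset_region_near hcov m hy)
        refine mem_iUnion.2 ⟨⟨idx t, Finset.mem_image_of_mem _ (by simpa using ht)⟩, ?_⟩
        rwa [(hidx t ht.1).1]
    · rw [← hR.admitted_image_iff (hinj J hJ)]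
      refine hadm _ ?_
      intro t ht
      obtain ⟨i, -, rfl⟩ := Finset.mem_image.1 (Finset.mem_coe.1 ht)
      exact ⟨i, rfl, hJ i i.2⟩
  · rintro ⟨hno, hcov, hadm⟩
    refine ⟨⟨hno, eq_univ_of_forall fun y => ?_⟩, fun P hP => ?_⟩
    · obtain ⟨m, hm⟩ := exists_nat_ge ‖y‖
      obtain ⟨J, hJ, hJc⟩ := hcov m
      obtain ⟨i, hi⟩ := mem_iUnion.1 (hJc (by simpa using hm : y ∈ Metric.closedBall 0 (m : ℝ)))
      exact mem_region.2 ⟨s i, ⟨i, rfl, hJ i i.2⟩, hi⟩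
    · have hex : ∀ t ∈ P, ∃ i, s i = t ∧ t.2 ∈ C i := fun t ht => hP ht
      choose! idx hidx using hex
      have hJ : ∀ i ∈ P.image idx, (s i).2 ∈ C i := by
        intro i hi
        obtain ⟨t, ht, rfl⟩ := Finset.mem_image.1 hi
        rw [(hidx t ht).1]
        exact (hidx t ht).2
      have h5 := (hR.admitted_image_iff (hinj _ hJ)).2 (hadm _ hJ)
      refine h5.mono fun t ht => ?_
      exact Finset.mem_image.2 ⟨⟨idx t, Finset.mem_image_of_mem _ ht⟩, Finset.mem_univ _,
        (hidx t ht).1⟩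

/-- Countably many hitting events separate the tilings. -/
theorem IsRegular.countablySeparated_hull (H : R.IsRegular) :
    MeasurableSpace.CountablySeparated R.Hull := by
  obtain ⟨b, hbc, -, hb⟩ := exists_countable_basis (L 0 × Euc d)
  refine ⟨⟨⟨(fun V => {T : R.Hull | ∃ t ∈ T.1, t ∈ V}) '' b, hbc.image _, ?_, ?_⟩⟩⟩
  · rintro _ ⟨V, hV, rfl⟩
    exact (H.fusion.isOpen_hit (hb.isOpen hV)).measurableSet
  · intro T _ T' _ h
    have key : ∀ T T' : R.Hull, (∀ s ∈ (fun V => {T : R.Hull | ∃ t ∈ T.1, t ∈ V}) '' b,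
        T ∈ s ↔ T' ∈ s) → T.1 ⊆ T'.1 := by
      intro T T' h t ht
      by_contra ht'
      obtain ⟨r, hr, hball⟩ := H.exists_small_balls 0
      -- near `t` there is at most one tile of `T'`, which can be avoided
      have hW : ∃ W ∈ 𝓝 t, ∀ s ∈ T'.1, s ∉ W := by
        have hop : {s : L 0 × Euc d | s.2 ∈ Metric.ball t.2 r} ∈ 𝓝 t :=
          (Metric.isOpen_ball.preimage continuous_snd).mem_nhds (by simpa using hr)
        by_cases hex : ∃ s ∈ T'.1, s.2 ∈ Metric.ball t.2 r
        · obtain ⟨s, hs, hsr⟩ := hex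
          have hne : t ≠ s := fun h => ht' (h ▸ hs)
          refine ⟨_, inter_mem hop (isOpen_compl_singleton.mem_nhds hne), ?_⟩
          rintro s' hs' ⟨h1, h2⟩
          exact h2 (hball t.2 _ T'.2 s' hs' s hs h1 hsr)
        · exact ⟨_, hop, fun s hs h1 => hex ⟨s, hs, h1⟩⟩
      obtain ⟨W, hW, hWT⟩ := hW
      obtain ⟨V, hV, htV, hVW⟩ := hb.mem_nhds_iff.1 hW
      obtain ⟨s, hs, hsV⟩ := (h _ (mem_image_of_mem _ hV)).1 ⟨t, ht, htV⟩
      exact hWT s hs (hVW hsV)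
    exact Subtype.ext (subset_antisymm (key T T' h) (key T' T fun s hs => (h s hs).symm))

/-- The decomposition of a tiling into `n`-supertiles depends measurably on the tiling: subdivision
is an injective measurable map from the standard Borel space of codes of tilings in `Ω^{(n)}`, so
that images of Borel sets are Borel by the Lusin–Souslin theorem. -/
theorem IsRegular.hitMeasurable_level (hd : 0 < d) (H : R.IsRegular) (n : ℕ) :
    HitMeasurable (R.level n) := by
  have := H.countablySeparated_hull
  obtain ⟨C, hC⟩ := H.exists_cellPartition n
  have : Nonempty (Fin d) := ⟨⟨0, hd⟩⟩
  -- cells are bounded, and thus leave room for a point `b i` that marks an empty cell; this is where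
  -- the dimension must be positive
  have hb : ∀ i, ∃ b : L n × Euc d, b.2 ∉ C i := by
    intro i
    by_contra! h
    refine NormedSpace.unbounded_univ ℝ (Euc d) ((hC.bounded i).subset fun x _ => ?_)
    exact h (Classical.arbitrary _, x)
  choose b hb using hb
  have hD := H.measurableSet_codes hC b
  have : StandardBorelSpace (R.codes n C b) := hD.standardBorel
  let Φ : R.codes n C b → R.Hull := fun s =>
    ⟨R.subdivide (Nat.zero_le n) (decode C s.1), H.subdivide_mem_Omega _ s.2.2⟩
  have hhit : ∀ B : Set (L n × Euc d), MeasurableSet B →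
      MeasurableSet {s : R.codes n C b | ∃ t ∈ decode C s.1, t ∈ B} := by
    intro B hB
    have : {s : R.codes n C b | ∃ t ∈ decode C s.1, t ∈ B} =
        ⋃ i, (fun s : R.codes n C b => s.1 i) ⁻¹' (B ∩ {t | t.2 ∈ C i}) := by
      ext s
      simp only [mem_ofPred_eq, mem_iUnion, mem_preimage, mem_inter_iff, mem_decode]
      constructor
      · rintro ⟨t, ⟨i, rfl, hi⟩, htB⟩
        exact ⟨i, htB, hi⟩
      · rintro ⟨i, htB, hi⟩
        exact ⟨_, ⟨i, rfl, hi⟩, htB⟩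
    rw [this]
    exact MeasurableSet.iUnion fun i => ((measurable_pi_apply i).comp measurable_subtype_coe)
      (hB.inter (measurable_snd (hC.measurable i)))
  have hΦ : Measurable Φ := by
    refine H.measurable_of_hitMeasurable fun V hV => ?_
    convert hhit _ (H.fusion.measurableSet_sub_hit (Nat.zero_le n) hV.measurableSet) using 1
    ext s
    constructor
    · rintro ⟨t, ht, htV⟩
      obtain ⟨u, hu, htu⟩ := mem_subdivide.1 ht
      exact ⟨u, hu, t, htu, htV⟩
    · rintro ⟨u, hu, t, htu, htV⟩
      exact ⟨t, mem_subdivide.2 ⟨u, hu, htu⟩, htV⟩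
  have hlev : ∀ s, R.level n (Φ s) = decode C s.1 := fun s => (H.eq_level s.2.2 rfl).symm
  have hinj : Function.Injective Φ := by
    intro s s' hss
    have hdec : decode C s.1 = decode C s'.1 := by rw [← hlev, ← hlev, hss]
    have key : ∀ s s' : R.codes n C b, decode C s.1 = decode C s'.1 →
        ∀ i, (s.1 i).2 ∈ C i → s'.1 i = s.1 i := by
      intro s s' hdec i hi
      have h1 : s.1 i ∈ decode C s'.1 := hdec ▸ ⟨i, rfl, hi⟩
      obtain ⟨j, hj, hjC⟩ := h1
      rw [← hC.index_unique hjC hi]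
      rw [← hC.index_unique hjC hi] at hj
      exact hj
    refine Subtype.ext (funext fun i => ?_)
    rcases s.2.1 i with hi | hi
    · exact (key s s' hdec i hi).symm
    · rcases s'.2.1 i with hi' | hi'
      · exact key s' s hdec.symm i hi'
      · rw [hi, hi']
  intro V hV
  convert (hhit V hV.measurableSet).image_of_measurable_injOn hΦ hinj.injOn using 1
  ext T
  constructor
  · rintro ⟨t, ht, htV⟩
    let s : ℕ → L n × Euc d := fun i =>
      open Classical in if h : ∃ t ∈ R.level n T, t.2 ∈ C i then h.choose else b i
    have hs : ∀ i, (∃ t ∈ R.level n T, t.2 ∈ C i) → s i ∈ R.level n T ∧ (s i).2 ∈ C i := by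
      intro i h
      simp only [s, dif_pos h]
      exact h.choose_spec
    have hs' : ∀ i, (¬ ∃ t ∈ R.level n T, t.2 ∈ C i) → s i = b i := fun i h => by
      simp only [s, dif_neg h]
    have hdec : decode C s = R.level n T := by
      ext t
      constructor
      · rintro ⟨i, rfl, hi⟩
        by_cases h : ∃ t ∈ R.level n T, t.2 ∈ C i
        · exact (hs i h).1
        · rw [hs' i h] at hi
          exact absurd hi (hb i)
      · intro ht
        obtain ⟨i, hi⟩ := hC.cover t.2
        have h1 := hs i ⟨t, ht, hi⟩
        exact ⟨i, hC.trim i _ (H.level_mem n T) _ h1.1 t ht h1.2 hi, hi⟩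
    refine ⟨⟨s, fun i => ?_, hdec ▸ H.level_mem n T⟩, ⟨t, hdec ▸ ht, htV⟩, Subtype.ext ?_⟩
    · by_cases h : ∃ t ∈ R.level n T, t.2 ∈ C i
      · exact Or.inl (hs i h).2
      · exact Or.inr (hs' i h)
    · change R.subdivide _ (decode C s) = T.1
      rw [hdec, (H.level_spec n T).2]
  · rintro ⟨s, ⟨t, ht, htV⟩, rfl⟩
    exact ⟨t, by rwa [hlev], htV⟩

/-! ### Measurability of translations -/

theorem IsRegular.measurableSet_exists_mem (H : R.IsRegular) {Y : Type*} [MeasurableSpace Y]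
    {n : ℕ} {τ : Y → Set (L n × Euc d)} (hτ : ∀ y, τ y ∈ R.Omega n) (hm : HitMeasurable τ)
    {B : Set ((L n × Euc d) × Y)} (hB : MeasurableSet B) :
    MeasurableSet {y | ∃ t ∈ τ y, (t, y) ∈ B} := by
  have h := H.measurable_tsum hτ hm (g := fun t y => B.indicator 1 (t, y))
    (measurable_one.indicator hB) (measurableSet_singleton 0).compl
  convert h using 1
  ext y
  simp [ENNReal.tsum_eq_zero, indicator]

theorem IsRegular.measurable_translate_uncurry (H : R.IsRegular) :
    Measurable fun p : Euc d × R.Hull => R.translate p.1 p.2 := by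
  refine H.measurable_of_hitMeasurable fun V hV => ?_
  have h1 : HitMeasurable fun p : Euc d × R.Hull => p.2.1 := fun V hV =>
    measurable_snd (H.fusion.hitMeasurable_val V hV)
  have hB : MeasurableSet {q : (L 0 × Euc d) × (Euc d × R.Hull) | (q.1.1, q.1.2 - q.2.1) ∈ V} := by
    have : Measurable fun q : (L 0 × Euc d) × (Euc d × R.Hull) => (q.1.1, q.1.2 - q.2.1) := by
      fun_prop
    exact this hV.measurableSet
  convert H.measurableSet_exists_mem (fun p => p.2.2) h1 hB using 1
  ext p
  simp only [translate, mem_ofPred_eq, exists_mem_image]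
  simp [sub_eq_add_neg]

theorem IsRegular.measurable_translate (H : R.IsRegular) (v : Euc d) :
    Measurable (R.translate v) := by
  have h : Measurable fun T : R.Hull => ((v, T) : Euc d × R.Hull) := measurable_prodMk_left
  have h' := H.measurable_translate_uncurry.comp h
  exact h'

theorem IsRegular.map_translate (H : R.IsRegular) {μ : Measure R.Hull} (hμ : R.Invariant μ)
    (v : Euc d) : μ.map (R.translate v) = μ := by
  ext A hA
  rw [Measure.map_apply (H.measurable_translate v) hA, hμ v A hA]

/-! ### Intensities -/

/-- A measure on `Y × ℝ^d` that is invariant under translations of the second coordinate, and finite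
on a slab over an open set, is the product of a measure on `Y` with Lebesgue measure. -/
theorem exists_eq_prod_volume {Y : Type*} [MeasurableSpace Y] (Λ : Measure (Y × Euc d))
    (hΛ : ∀ v : Euc d, Λ.map (fun p => (p.1, p.2 + v)) = Λ) {U : Set (Euc d)} (hU : IsOpen U)
    (hne : U.Nonempty) (hfin : Λ (univ ×ˢ U) ≠ ∞) :
    ∃ ρ : Measure Y, IsFiniteMeasure ρ ∧ Λ = ρ.prod volume := by
  obtain ⟨u, hu⟩ := hne
  obtain ⟨r, hr, hrU⟩ := Metric.isOpen_iff.1 hU u hu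
  have htrans : ∀ (v : Euc d) (A : Set (Y × Euc d)), MeasurableSet A →
      Λ ((fun p => (p.1, p.2 + v)) ⁻¹' A) = Λ A := by
    intro v A hA
    conv_rhs => rw [← hΛ v]
    rw [Measure.map_apply (by fun_prop) hA]
  have hball : ∀ x : Euc d, Λ (univ ×ˢ Metric.ball x r) ≠ ∞ := by
    intro x
    rw [← htrans (x - u) _ (MeasurableSet.univ.prod measurableSet_ball)]
    refine ne_top_of_le_ne_top hfin (measure_mono ?_)
    rintro ⟨y, z⟩ ⟨-, hz⟩
    refine ⟨mem_univ _, hrU ?_⟩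
    simp only [Metric.mem_ball, dist_eq_norm] at hz ⊢
    convert hz using 2
    abel
  have hslab : ∀ (I : Set Y), MeasurableSet I → ∃ c : ℝ≥0∞, ∀ B : Set (Euc d), MeasurableSet B →
      Λ (I ×ˢ B) = c * volume B := by
    intro I hI
    let ν : Measure (Euc d) := (Λ.restrict (Prod.fst ⁻¹' I)).map Prod.snd
    have hν : ∀ B, MeasurableSet B → ν B = Λ (I ×ˢ B) := by
      intro B hB
      rw [Measure.map_apply measurable_snd hB, Measure.restrict_apply (measurable_snd hB)]
      congr 1
      ext ⟨y, z⟩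
      simp [and_comm]
    have hinv : ν.IsAddLeftInvariant := by
      refine ⟨fun v => ?_⟩
      ext B hB
      have hmeas : Measurable fun x : Euc d => v + x := by fun_prop
      rw [Measure.map_apply hmeas hB, hν B hB, hν _ (hmeas hB), ← htrans v _ (hI.prod hB)]
      congr 1
      ext ⟨y, z⟩
      simp [add_comm]
    have hfc : IsFiniteMeasureOnCompacts ν := by
      refine ⟨fun K hK => ?_⟩
      obtain ⟨s, -, hs⟩ := hK.elim_nhds_subcover (fun x => Metric.ball x r)
        fun x _ => Metric.ball_mem_nhds x hr
      refine (measure_mono hs).trans_lt ((measure_biUnion_finset_le s _).trans_lt ?_)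
      refine ENNReal.sum_lt_top.2 fun x _ => ?_
      rw [hν _ measurableSet_ball]
      exact (measure_mono (prod_mono (subset_univ _) subset_rfl)).trans_lt (hball x).lt_top
    have := Measure.isAddLeftInvariant_eq_smul ν (volume : Measure (Euc d))
    refine ⟨Measure.addHaarScalarFactor ν volume, fun B hB => ?_⟩
    rw [← hν B hB]
    conv_lhs => rw [this]
    rfl
  have hv0 : volume (Metric.ball u r) ≠ 0 := (Metric.measure_ball_pos volume u hr).ne'
  have hv1 : volume (Metric.ball u r) ≠ ∞ := measure_ball_lt_top.ne
  let ρ : Measure Y := (volume (Metric.ball u r))⁻¹ •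
    (Λ.restrict (univ ×ˢ Metric.ball u r)).map Prod.fst
  have hρ : ∀ I, MeasurableSet I → ρ I = (volume (Metric.ball u r))⁻¹ *
      Λ (I ×ˢ Metric.ball u r) := by
    intro I hI
    rw [Measure.smul_apply, Measure.map_apply measurable_fst hI,
      Measure.restrict_apply (measurable_fst hI), smul_eq_mul]
    congr 2
    ext ⟨y, z⟩
    simp
  have hρf : IsFiniteMeasure ρ := by
    refine ⟨?_⟩
    rw [hρ _ MeasurableSet.univ]
    exact ENNReal.mul_lt_top (ENNReal.inv_lt_top.2 (pos_iff_ne_zero.2 hv0)) (hball u).lt_top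
  refine ⟨ρ, hρf, (Measure.prod_eq fun I B hI hB => ?_).symm⟩
  obtain ⟨c, hc⟩ := hslab I hI
  rw [hρ I hI, hc B hB, hc _ measurableSet_ball, mul_left_comm, ENNReal.inv_mul_cancel hv0 hv1,
    mul_one]

/-- Sums over the `n`-supertiles of a random tiling have expectations given by the product of `ρ`
with Lebesgue measure. -/
def IsIntensity (R : FusionData d L) (μ : Measure R.Hull) (n : ℕ) (ρ : Measure (L n)) : Prop :=
  ∀ f : L n × Euc d → ℝ≥0∞, Measurable f →
    ∫⁻ T, ∑' t : R.level n T, f t ∂μ = ∫⁻ c, ∫⁻ x, f (c, x) ∂volume ∂ρ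

theorem IsRegular.measurable_tsum_level (hd : 0 < d) (H : R.IsRegular) {n : ℕ}
    {f : L n × Euc d → ℝ≥0∞} (hf : Measurable f) :
    Measurable fun T : R.Hull => ∑' t : R.level n T, f t :=
  H.measurable_tsum (H.level_mem n) (H.hitMeasurable_level hd n) (g := fun t _ => f t)
    (hf.comp measurable_fst)

/-- Each `n`-supertile `t` of `T` carries a mark `m t T` that does not change when both are
translated. The expected sum over the pairs of marks and control points is then an integral against
the product of a measure on the marks and Lebesgue measure. -/
theorem IsRegular.exists_palm (hd : 0 < d) (H : R.IsRegular) {μ : Measure R.Hull}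
    [IsProbabilityMeasure μ] (hμ : R.Invariant μ) (n : ℕ) {Y : Type*} [MeasurableSpace Y]
    (m : L n × Euc d → R.Hull → Y) (hm : Measurable (Function.uncurry m))
    (hinv : ∀ t T v, m (shift (-v) t) (R.translate v T) = m t T) :
    ∃ ρ : Measure Y, IsFiniteMeasure ρ ∧ ∀ f : Y × Euc d → ℝ≥0∞, Measurable f →
      ∫⁻ T, ∑' t : R.level n T, f (m t T, (t : L n × Euc d).2) ∂μ =
        ∫⁻ y, ∫⁻ x, f (y, x) ∂volume ∂ρ := by
  have hmeas : ∀ f : Y × Euc d → ℝ≥0∞, Measurable f →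
      Measurable fun T : R.Hull => ∑' t : R.level n T, f (m t T, (t : L n × Euc d).2) := by
    intro f hf
    exact H.measurable_tsum (H.level_mem n) (H.hitMeasurable_level hd n)
      (g := fun t T => f (m t T, t.2))
      (hf.comp (hm.prodMk (measurable_snd.comp measurable_fst)))
  let κ : R.Hull → Measure (Y × Euc d) := fun T =>
    Measure.sum fun t : R.level n T => Measure.dirac (m t T, (t : L n × Euc d).2)
  have hκf : ∀ T, ∀ f : Y × Euc d → ℝ≥0∞, Measurable f →
      ∫⁻ p, f p ∂(κ T) = ∑' t : R.level n T, f (m t T, (t : L n × Euc d).2) := by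
    intro T f hf
    rw [lintegral_sum_measure]
    exact tsum_congr fun t => lintegral_dirac' _ hf
  have hκ : Measurable κ := by
    refine Measure.measurable_of_measurable_coe _ fun B hB => ?_
    convert hmeas (B.indicator 1) (measurable_one.indicator hB) using 2 with T
    rw [← hκf T _ (measurable_one.indicator hB), lintegral_indicator_one hB]
  have hΛ : ∀ f : Y × Euc d → ℝ≥0∞, Measurable f → ∫⁻ p, f p ∂(μ.bind κ) =
      ∫⁻ T, ∑' t : R.level n T, f (m t T, (t : L n × Euc d).2) ∂μ := by
    intro f hf
    rw [Measure.lintegral_bind hκ.aemeasurable hf.aemeasurable]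
    exact lintegral_congr fun T => hκf T f hf
  obtain ⟨r, hr, hball⟩ := H.exists_small_balls n
  have hshift : ∀ v : Euc d, (μ.bind κ).map (fun p => (p.1, p.2 + v)) = μ.bind κ := by
    intro v
    refine Measure.ext_of_lintegral _ fun f hf => ?_
    have hsh : Measurable fun p : Y × Euc d => (p.1, p.2 + v) := by fun_prop
    rw [lintegral_map hf hsh, hΛ (fun p => f (p.1, p.2 + v)) (hf.comp hsh), hΛ f hf]
    conv_rhs => rw [← H.map_translate hμ (-v)]
    rw [lintegral_map (hmeas f hf) (H.measurable_translate (-v))]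
    refine lintegral_congr fun T => ?_
    have hb : Function.Bijective (fun t : R.level n T =>
        (⟨shift v t, by
          rw [H.level_translate, neg_neg]
          exact mem_image_of_mem _ t.2⟩ : R.level n (R.translate (-v) T))) := by
      constructor
      · intro t t' htt
        exact Subtype.ext ((shift v).injective (Subtype.mk.inj htt))
      · rintro ⟨s, hs⟩
        have hs' := hs
        rw [H.level_translate, neg_neg] at hs'
        obtain ⟨t, ht, rfl⟩ := hs'
        exact ⟨⟨t, ht⟩, rfl⟩
    rw [← (Equiv.ofBijective _ hb).tsum_eq fun t : R.level n (R.translate (-v) T) =>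
      f (m t (R.translate (-v) T), (t : L n × Euc d).2)]
    refine tsum_congr fun t => ?_
    have := hinv t T (-v)
    rw [neg_neg] at this
    simp only [Equiv.ofBijective_apply, this]
    rfl
  have hfin : (μ.bind κ) (univ ×ˢ Metric.ball 0 r) ≠ ∞ := by
    have h1 : (μ.bind κ) (univ ×ˢ Metric.ball 0 r) ≤ 1 := by
      have hB : MeasurableSet ((univ : Set Y) ×ˢ Metric.ball (0 : Euc d) r) :=
        MeasurableSet.univ.prod measurableSet_ball
      rw [← lintegral_indicator_one hB, hΛ _ (measurable_one.indicator hB)]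
      calc _ ≤ ∫⁻ _ : R.Hull, 1 ∂μ := lintegral_mono fun T => ?_
        _ = 1 := by simp
      by_cases hex : ∃ t : R.level n T, (t : L n × Euc d).2 ∈ Metric.ball (0 : Euc d) r
      · obtain ⟨t, ht⟩ := hex
        rw [tsum_eq_single t]
        · simp [indicator, ht]
        · intro s hs
          refine indicator_of_notMem (fun h => hs (Subtype.ext ?_)) _
          exact hball 0 _ (H.level_mem n T) s s.2 t t.2 h.2 ht
      · rw [ENNReal.tsum_eq_zero.2]
        · exact zero_le
        · exact fun t => indicator_of_notMem (fun h => hex ⟨t, h.2⟩) _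
    exact ne_top_of_le_ne_top ENNReal.one_ne_top h1
  obtain ⟨ρ, hρ, hρΛ⟩ := exists_eq_prod_volume (μ.bind κ) hshift
    (U := Metric.ball (0 : Euc d) r) Metric.isOpen_ball ⟨0, by simpa using hr⟩ hfin
  refine ⟨ρ, hρ, fun f hf => ?_⟩
  rw [← hΛ f hf, hρΛ, lintegral_prod f hf.aemeasurable]

theorem IsRegular.exists_isIntensity (hd : 0 < d) (H : R.IsRegular) {μ : Measure R.Hull}
    [IsProbabilityMeasure μ] (hμ : R.Invariant μ) (n : ℕ) :
    ∃ ρ : Measure (L n), IsFiniteMeasure ρ ∧ R.IsIntensity μ n ρ := by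
  obtain ⟨ρ, hρ, h⟩ := H.exists_palm hd hμ n (fun t _ => t.1)
    (measurable_fst.comp measurable_fst) fun _ _ _ => rfl
  exact ⟨ρ, hρ, fun f hf => h f hf⟩

/-! ### Supertiles around the origin -/

theorem volume_sub_preimage (y : Euc d) {A : Set (Euc d)} (hA : MeasurableSet A) :
    volume {x : Euc d | y - x ∈ A} = volume A :=
  (Measure.measurePreserving_sub_left volume y).measure_preimage hA.nullMeasurableSet

theorem volume_mem_placedSupp (n : ℕ) (c : L n) (y : Euc d) :
    volume {x : Euc d | y ∈ R.placedSupp n (c, x)} = volume (R.supp n c) := by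
  rw [← volume_sub_preimage y (isCompact_supp n c).measurableSet]
  simp only [mem_placedSupp]

theorem IsFusionRule.measurable_volume_supp (hR : R.IsFusionRule) (n : ℕ) :
    Measurable fun c : L n => volume (R.supp n c) := by
  have := measurable_measure_prodMk_left (ν := (volume : Measure (Euc d)))
    (hR.isClosed_mem_placedSupp n 0).measurableSet
  convert this using 2 with c
  exact (volume_mem_placedSupp n c 0).symm

theorem IsFusionRule.measurableSet_mem_frontier (hR : R.IsFusionRule) (n : ℕ) (y : Euc d) :
    MeasurableSet {t : L n × Euc d | y ∈ frontier (R.placedSupp n t)} := by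
  have : {t : L n × Euc d | y ∈ frontier (R.placedSupp n t)} =
      {t | y ∈ R.placedSupp n t} \
        ⋃ k : ℕ, {t | Metric.ball y (1 / ((k : ℝ) + 1)) ⊆ R.placedSupp n t} := by
    ext t
    rw [mem_ofPred_eq, (isClosed_placedSupp n t).frontier_eq]
    refine and_congr_right fun _ => not_congr ?_
    rw [mem_iUnion, mem_interior_iff_mem_nhds, Metric.mem_nhds_iff]
    constructor
    · rintro ⟨ε, hε, h⟩
      obtain ⟨k, hk⟩ := exists_nat_one_div_lt hε
      exact ⟨k, (Metric.ball_subset_ball hk.le).trans h⟩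
    · rintro ⟨k, hk⟩
      exact ⟨_, by positivity, hk⟩
  rw [this]
  exact (hR.isClosed_mem_placedSupp n y).measurableSet.diff
    (MeasurableSet.iUnion fun k => (hR.isClosed_subset_placedSupp n _).measurableSet)

theorem IsFusionRule.volume_mem_frontier (hR : R.IsFusionRule) (n : ℕ) (c : L n) (y : Euc d) :
    volume {x : Euc d | y ∈ frontier (R.placedSupp n (c, x))} = 0 := by
  rw [← hR.volume_frontier_supp n c, ← volume_sub_preimage y isClosed_frontier.measurableSet]
  congr 1
  ext x
  rw [mem_ofPred_eq, frontier_placedSupp, mem_ofPred_eq]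
  constructor
  · rintro ⟨z, hz, rfl⟩
    simpa using hz
  · exact fun h => ⟨_, h, by simp⟩

/-- If `A` has at most one element in `B`, the sum of the indicator function of `B` over `A` is the
truth value of the existence of such an element. -/
theorem tsum_indicator_eq_ite {X : Type*} (A B : Set X)
    (h : ∀ a ∈ A, ∀ b ∈ A, a ∈ B → b ∈ B → a = b)
    [Decidable (∃ a ∈ A, a ∈ B)] :
    ∑' a : A, B.indicator (1 : X → ℝ≥0∞) (a : X) = if ∃ a ∈ A, a ∈ B then 1 else 0 := by
  split_ifs with hex
  · obtain ⟨a, ha, haB⟩ := hex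
    rw [tsum_eq_single ⟨a, ha⟩]
    · exact indicator_of_mem haB _
    · intro b hb
      exact indicator_of_notMem (fun hbB => hb (Subtype.ext (h b b.2 a ha hbB haB))) _
  · exact ENNReal.tsum_eq_zero.2 fun a => indicator_of_notMem (fun haB => hex ⟨a, a.2, haB⟩) _

theorem IsIntensity.lintegral_indicator {μ : Measure R.Hull}
    {n : ℕ} {ρ : Measure (L n)} (hρ : R.IsIntensity μ n ρ) {B : Set (L n × Euc d)}
    (hB : MeasurableSet B) :
    ∫⁻ T, ∑' t : R.level n T, B.indicator 1 (t : L n × Euc d) ∂μ =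
      ∫⁻ c, volume {x | (c, x) ∈ B} ∂ρ := by
  rw [hρ _ (measurable_one.indicator hB)]
  refine lintegral_congr fun c => ?_
  exact lintegral_indicator_one (s := {x | (c, x) ∈ B}) (measurable_prodMk_left hB)

theorem IsRegular.ae_notMem_frontier (hd : 0 < d) (H : R.IsRegular) {μ : Measure R.Hull}
    {n : ℕ} {ρ : Measure (L n)} (hρ : R.IsIntensity μ n ρ) :
    ∀ᵐ T ∂μ, ∀ t ∈ R.level n T, (0 : Euc d) ∉ frontier (R.placedSupp n t) := by
  have hB := H.fusion.measurableSet_mem_frontier n (0 : Euc d)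
  have h := hρ.lintegral_indicator hB
  simp only [mem_ofPred_eq, H.fusion.volume_mem_frontier, lintegral_zero] at h
  rw [lintegral_eq_zero_iff (H.measurable_tsum_level hd (measurable_one.indicator hB))] at h
  filter_upwards [h] with T hT t ht h0
  have := ENNReal.tsum_eq_zero.1 hT ⟨t, ht⟩
  rw [indicator_of_mem (by exact h0)] at this
  exact one_ne_zero this

/-- The origin almost surely lies in exactly one `n`-supertile. -/
theorem IsRegular.ae_tsum_mem_placedSupp (hd : 0 < d) (H : R.IsRegular) {μ : Measure R.Hull}
    {n : ℕ} {ρ : Measure (L n)} (hρ : R.IsIntensity μ n ρ) :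
    ∀ᵐ T ∂μ, ∑' t : R.level n T,
      {t : L n × Euc d | (0 : Euc d) ∈ R.placedSupp n t}.indicator (1 : L n × Euc d → ℝ≥0∞) t = 1 := by
  classical
  filter_upwards [H.ae_notMem_frontier hd hρ] with T hT
  rw [tsum_indicator_eq_ite, if_pos]
  · have h0 : (0 : Euc d) ∈ R.region n (R.level n T) := (H.level_mem n T).1.2 ▸ mem_univ _
    exact mem_region.1 h0
  · intro a ha b hb ha0 hb0
    by_contra hne
    exact hT a ha (H.level_nonOverlapping n T a ha b hb hne ⟨ha0, hb0⟩).1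

/-- The expected number of `n`-supertiles that contain the origin is the total volume of the supports,
weighted by the intensity, and it is `1`. -/
theorem IsRegular.lintegral_volume_supp (hd : 0 < d) (H : R.IsRegular) {μ : Measure R.Hull}
    [IsProbabilityMeasure μ] {n : ℕ} {ρ : Measure (L n)} (hρ : R.IsIntensity μ n ρ) :
    ∫⁻ c, volume (R.supp n c) ∂ρ = 1 := by
  have h := hρ.lintegral_indicator (H.fusion.isClosed_mem_placedSupp n 0).measurableSet
  rw [lintegral_congr_ae (H.ae_tsum_mem_placedSupp hd hρ)] at h
  simp only [lintegral_const, measure_univ, mul_one, mem_ofPred_eq, volume_mem_placedSupp] at h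
  exact h.symm

/-! ### Frequency measures and transition consistency -/

/-- The value `b = ∞` is allowed: then `a = 0`, because the product is finite. -/
theorem ennreal_eq_div {a b c : ℝ≥0∞} (h : a * b = c) (hb : b ≠ 0) (hc : c ≠ ∞) : a = c / b := by
  rcases eq_or_ne b ∞ with rfl | hb'
  · have ha : a = 0 := by
      by_contra ha
      rw [ENNReal.mul_top ha] at h
      exact hc h.symm
    simp [ha]
  · rw [← h, ENNReal.mul_div_cancel_right hb hb']

/-- The expected number of supertiles with label in `I` and control point in `U` is `ρ I * Vol U`; when
at most one such supertile can occur, it is a probability. -/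
theorem IsRegular.isFrequencyMeasure (hd : 0 < d) (H : R.IsRegular) {μ : Measure R.Hull}
    [IsProbabilityMeasure μ] {n : ℕ} {ρ : Measure (L n)} (hρ : R.IsIntensity μ n ρ) :
    R.IsFrequencyMeasure μ n ρ := by
  classical
  intro I hI U hU hne htrim
  have hB : MeasurableSet (I ×ˢ U) := hI.prod hU.measurableSet
  have h := hρ.lintegral_indicator hB
  have h1 : ∀ T : R.Hull, ∑' t : R.level n T,
      (I ×ˢ U).indicator (1 : L n × Euc d → ℝ≥0∞) (t : L n × Euc d) =
      (R.supertileCylinder n I U).indicator 1 T := by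
    intro T
    rw [tsum_indicator_eq_ite]
    · simp only [indicator, H.mem_supertileCylinder, mem_prod, Pi.one_apply]
    · exact fun a ha b hb haB hbB => htrim _ (H.level_mem n T) a ha b hb haB.1 hbB.1 haB.2 hbB.2
  have h2 : MeasurableSet (R.supertileCylinder n I U) := by
    convert H.measurableSet_hit (H.level_mem n) (H.hitMeasurable_level hd n) hB using 1
    ext T
    rw [H.mem_supertileCylinder]
    rfl
  have h3 : ∀ c, volume {x | (c, x) ∈ I ×ˢ U} = I.indicator (fun _ => volume U) c := by
    intro c
    by_cases hc : c ∈ I <;> simp [hc]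
  simp only [h1, h3] at h
  rw [lintegral_indicator_one h2, lintegral_indicator_const hI, mul_comm] at h
  exact ennreal_eq_div h.symm (hU.measure_pos volume hne).ne' (measure_ne_top μ _)

theorem sum_sub_eq_sum_decomp {n N : ℕ} (h : n ≤ N) (c : L N) (x : Euc d)
    (f : L n × Euc d → ℝ≥0∞) :
    ∑ s ∈ R.sub h (c, x), f s = ∑ s ∈ R.decomp h c, f (s.1, s.2 + x) := by
  rw [sub, Finset.sum_map]
  rfl

theorem IsRegular.tsum_level (H : R.IsRegular) {n N : ℕ} (h : n ≤ N) (T : R.Hull)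
    (f : L n × Euc d → ℝ≥0∞) :
    ∑' s : R.level n T, f s = ∑' t : R.level N T, ∑ s ∈ R.sub h t, f s := by
  rw [← H.subdivide_level h T, H.fusion.tsum_subdivide h (H.level_nonOverlapping N T)]

open Classical in
theorem labelCount_eq {n N : ℕ} (h : n ≤ N) (I : Set (L n)) (c : L N) :
    R.labelCount h I c = ((R.decomp h c).filter (·.1 ∈ I)).card := by
  rw [labelCount, ← Set.ncard_coe_finset]
  congr 1
  ext t
  simp

theorem lintegral_sum_sub_prod {n N : ℕ} (h : n ≤ N) {I : Set (L n)} (hI : MeasurableSet I)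
    {U : Set (Euc d)} (hU : MeasurableSet U) (c : L N) :
    ∫⁻ x, ∑ s ∈ R.sub h (c, x), (I ×ˢ U).indicator (1 : L n × Euc d → ℝ≥0∞) s =
      R.labelCount h I c * volume U := by
  classical
  have h1 : ∀ s : L n × Euc d,
      (∫⁻ x : Euc d, (I ×ˢ U).indicator (1 : L n × Euc d → ℝ≥0∞) (s.1, s.2 + x)) =
      if s.1 ∈ I then volume U else 0 := by
    intro s
    split_ifs with hs
    · rw [← measure_preimage_add volume s.2 U, ← lintegral_indicator_one
        (measurable_const_add s.2 hU)]
      refine lintegral_congr fun x => ?_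
      simp [indicator, hs]
    · simp [indicator, hs]
  simp only [sum_sub_eq_sum_decomp]
  rw [lintegral_finsetSum]
  · simp only [h1]
    rw [← Finset.sum_filter, labelCount_eq]
    simp
  · intro s _
    exact (measurable_one.indicator (hI.prod hU)).comp
      (measurable_const.prodMk (measurable_const.add measurable_id))

/-- The intensities are transition consistent, as seen by counting the `n`-supertiles with control point
in the unit ball directly and through the `N`-supertiles that contain them. -/
theorem IsRegular.transition (H : R.IsRegular) {μ : Measure R.Hull}
    {n N : ℕ} (h : n ≤ N) {ρ : Measure (L n)} (hρ : R.IsIntensity μ n ρ) {ρ' : Measure (L N)}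
    (hρ' : R.IsIntensity μ N ρ') {I : Set (L n)} (hI : MeasurableSet I) :
    ρ I = ∫⁻ c, (R.labelCount h I c : ℝ≥0∞) ∂ρ' := by
  let U : Set (Euc d) := Metric.ball 0 1
  have hU0 : volume U ≠ 0 := (Metric.measure_ball_pos volume (0 : Euc d) one_pos).ne'
  have hU1 : volume U ≠ ∞ := measure_ball_lt_top.ne
  have hUm : MeasurableSet U := measurableSet_ball
  have h1 := hρ.lintegral_indicator (hI.prod hUm)
  have h3 : ∀ c, volume {x | (c, x) ∈ I ×ˢ U} = I.indicator (fun _ => volume U) c := by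
    intro c
    by_cases hc : c ∈ I <;> simp [hc]
  simp only [h3, H.tsum_level h] at h1
  have hm : Measurable ((I ×ˢ U).indicator (1 : L n × Euc d → ℝ≥0∞)) :=
    measurable_one.indicator (hI.prod hUm)
  rw [hρ' (fun t => ∑ s ∈ R.sub h t, (I ×ˢ U).indicator (1 : L n × Euc d → ℝ≥0∞) s)
    (H.fusion.measurable_sum_sub h hm), lintegral_indicator_const hI] at h1
  simp only [lintegral_sum_sub_prod h hI hUm] at h1
  rw [lintegral_mul_const' _ _ hU1, mul_comm] at h1
  exact ((ENNReal.mul_right_inj hU0 hU1).1 h1).symm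

/-! ### The van Hove property -/

/-- The largest proportion of the volume of an `n`-supertile that lies near its boundary. -/
def boundaryRatio (R : FusionData d L) (r : ℝ) (n : ℕ) : ℝ≥0∞ :=
  ⨆ c : L n, volume (Metric.cthickening r (frontier (R.supp n c))) / volume (R.supp n c)

/-- The van Hove property concerns one sequence of supertiles at a time. It holds uniformly, since it
can be applied to supertiles that almost attain the supremum. -/
theorem VanHove.tendsto_boundaryRatio (h : R.VanHove) {r : ℝ} (hr : 0 ≤ r) :
    Tendsto (R.boundaryRatio r) atTop (𝓝 0) := by
  -- the minimum with `1` covers the case of an infinite supremum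
  have hc : ∀ n, ∃ c : L n, min (R.boundaryRatio r n / 2) 1 ≤
      volume (Metric.cthickening r (frontier (R.supp n c))) / volume (R.supp n c) := by
    intro n
    rcases eq_or_ne (R.boundaryRatio r n) 0 with h0 | h0
    · exact ⟨Classical.arbitrary _, by simp [h0]⟩
    · have : min (R.boundaryRatio r n / 2) 1 < R.boundaryRatio r n := by
        rcases eq_or_ne (R.boundaryRatio r n) ∞ with h1 | h1
        · rw [h1]
          exact (min_le_right _ _).trans_lt ENNReal.one_lt_top
        · exact (min_le_left _ _).trans_lt (ENNReal.half_lt_self h0 h1)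
      obtain ⟨c, hc⟩ := lt_iSup_iff.1 this
      exact ⟨c, hc.le⟩
  choose c hc using hc
  have h1 : Tendsto (fun n => min (R.boundaryRatio r n / 2) 1) atTop (𝓝 0) :=
    tendsto_of_tendsto_of_tendsto_of_le_of_le tendsto_const_nhds (h c r hr)
      (fun _ => zero_le) hc
  have h2 : Tendsto (fun n => R.boundaryRatio r n / 2) atTop (𝓝 0) := by
    refine h1.congr' ?_
    filter_upwards [h1.eventually (gt_mem_nhds one_pos)] with n hn
    refine min_eq_left ?_
    by_contra! hlt
    rw [min_eq_right hlt.le] at hn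
    exact lt_irrefl _ hn
  have h3 := ENNReal.Tendsto.mul_const (b := 2) h2 (Or.inr (by simp))
  simpa [ENNReal.div_mul_cancel] using h3

theorem _root_.IsPreconnected.inter_frontier_nonempty_of_inter {X : Type*} [TopologicalSpace X]
    {s t : Set X} (ht : IsPreconnected t) (h1 : (t ∩ s).Nonempty) (h2 : (t ∩ sᶜ).Nonempty) :
    (t ∩ frontier s).Nonempty := by
  by_contra h
  have hf : ∀ x ∈ t, x ∉ frontier s := fun x hx hxf => h ⟨x, hx, hxf⟩
  have hs : ∀ x ∈ t, x ∈ s → x ∈ interior s := fun x hx hxs => by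
    by_contra hxi
    exact hf x hx ⟨subset_closure hxs, hxi⟩
  have hs' : ∀ x ∈ t, x ∉ s → x ∈ interior sᶜ := fun x hx hxs => by
    by_contra hxi
    rw [← frontier_compl] at hf
    exact hf x hx ⟨subset_closure hxs, hxi⟩
  obtain ⟨x, hx, hxs⟩ := h1
  obtain ⟨y, hy, hys⟩ := h2
  obtain ⟨z, -, hz, hz'⟩ := ht (interior s) (interior sᶜ) isOpen_interior isOpen_interior
    (fun z hz => (em (z ∈ s)).imp (hs z hz) (hs' z hz)) ⟨x, hx, hs x hx hxs⟩ ⟨y, hy, hs' y hy hys⟩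
  exact interior_subset hz' (interior_subset hz)

/-- If the origin lies in a supertile that does not contain the closed ball of radius `r`, then the
origin is near the boundary of the supertile. -/
theorem zero_mem_cthickening {n : ℕ} {t : L n × Euc d} {r : ℝ} (h0 : (0 : Euc d) ∈ R.placedSupp n t)
    (h : ¬ Metric.closedBall 0 r ⊆ R.placedSupp n t) :
    -t.2 ∈ Metric.cthickening r (frontier (R.supp n t.1)) := by
  obtain ⟨z, hz, hzt⟩ := not_subset.1 h
  have hseg : (segment ℝ (0 : Euc d) z ∩ frontier (R.placedSupp n t)).Nonempty :=
    (convex_segment (0 : Euc d) z).isPreconnected.inter_frontier_nonempty_of_inter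
      ⟨0, left_mem_segment ℝ 0 z, h0⟩ ⟨z, right_mem_segment ℝ 0 z, hzt⟩
  obtain ⟨y, hy, hyf⟩ := hseg
  rw [frontier_placedSupp] at hyf
  obtain ⟨w, hw, rfl⟩ := hyf
  refine Metric.mem_cthickening_of_dist_le _ w _ _ hw ?_
  have h1 : dist (w + t.2) 0 ≤ r := by
    have := (convex_closedBall (0 : Euc d) r).segment_subset (x := 0) (y := z)
      (by simpa using dist_nonneg.trans (Metric.mem_closedBall.1 hz)) hz hy
    exact this
  rw [dist_comm, dist_eq_norm, sub_neg_eq_add]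
  simpa using h1

/-- The `n`-supertile around the origin rarely fails to contain a given ball. -/
theorem IsRegular.lintegral_volume_bad_le (H : R.IsRegular) {n : ℕ} {ρ : Measure (L n)}
    (hρ : ∫⁻ c, volume (R.supp n c) ∂ρ = 1) (r : ℝ) :
    ∫⁻ c, volume {x : Euc d | (0 : Euc d) ∈ R.placedSupp n (c, x) ∧
      ¬ Metric.closedBall 0 r ⊆ R.placedSupp n (c, x)} ∂ρ ≤ R.boundaryRatio r n := by
  calc _ ≤ ∫⁻ c, R.boundaryRatio r n * volume (R.supp n c) ∂ρ := by
        refine lintegral_mono fun c => ?_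
        have h1 : volume {x : Euc d | (0 : Euc d) ∈ R.placedSupp n (c, x) ∧
            ¬ Metric.closedBall 0 r ⊆ R.placedSupp n (c, x)} ≤
            volume (Metric.cthickening r (frontier (R.supp n c))) := by
          rw [← volume_sub_preimage 0 Metric.isClosed_cthickening.measurableSet]
          refine measure_mono fun x hx => ?_
          have := zero_mem_cthickening hx.1 hx.2
          simpa using this
        refine h1.trans ?_
        have h2 : volume (Metric.cthickening r (frontier (R.supp n c))) / volume (R.supp n c) ≤
            R.boundaryRatio r n := le_iSup (fun c : L n =>
              volume (Metric.cthickening r (frontier (R.supp n c))) / volume (R.supp n c)) c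
        exact (ENNReal.div_le_iff (H.fusion.volume_supp_pos n c).ne' (volume_supp_ne_top n c)).1 h2
    _ = R.boundaryRatio r n := by
        rw [lintegral_const_mul _ (H.fusion.measurable_volume_supp n), hρ, mul_one]

theorem IsFusionRule.measurableSet_bad (hR : R.IsFusionRule) (n : ℕ) (r : ℝ) :
    MeasurableSet {t : L n × Euc d | (0 : Euc d) ∈ R.placedSupp n t ∧
      ¬ Metric.closedBall 0 r ⊆ R.placedSupp n t} :=
  (hR.isClosed_mem_placedSupp n 0).measurableSet.inter
    (hR.isClosed_subset_placedSupp n _).measurableSet.compl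

/-- Almost surely, every ball around the origin is contained in a single supertile of some level. -/
theorem IsRegular.ae_exists_closedBall_subset (hd : 0 < d) (H : R.IsRegular) {μ : Measure R.Hull}
    [IsProbabilityMeasure μ] {ρ : ∀ n, Measure (L n)} (hρ : ∀ n, R.IsIntensity μ n (ρ n)) :
    ∀ᵐ T ∂μ, ∀ m : ℕ, ∃ n, ∃ t ∈ R.level n T, Metric.closedBall 0 (m : ℝ) ⊆ R.placedSupp n t := by
  classical
  refine ae_all_iff.2 fun m => ?_
  rw [ae_iff]
  refine le_antisymm (ge_of_tendsto' (H.vanHove.tendsto_boundaryRatio (Nat.cast_nonneg m))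
    fun n => ?_) zero_le
  let B : Set (L n × Euc d) := {t | (0 : Euc d) ∈ R.placedSupp n t ∧
      ¬ Metric.closedBall 0 (m : ℝ) ⊆ R.placedSupp n t}
  have hB : MeasurableSet B := H.fusion.measurableSet_bad n m
  have h1 := (hρ n).lintegral_indicator hB
  have h2 := H.lintegral_volume_bad_le (H.lintegral_volume_supp hd (hρ n)) (m : ℝ)
  refine le_trans ?_ (h1.le.trans h2)
  have hm := H.measurableSet_hit (H.level_mem n) (H.hitMeasurable_level hd n) hB
  calc _ ≤ μ {T | ∃ t ∈ R.level n T, t ∈ B} := by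
        refine measure_mono fun T hT => ?_
        have h0 : (0 : Euc d) ∈ R.region n (R.level n T) := (H.level_mem n T).1.2 ▸ mem_univ _
        obtain ⟨t, ht, h0t⟩ := mem_region.1 h0
        exact ⟨t, ht, h0t, fun hsub => hT ⟨n, t, ht, hsub⟩⟩
    _ = ∫⁻ T, {T | ∃ t ∈ R.level n T, t ∈ B}.indicator 1 T ∂μ := (lintegral_indicator_one hm).symm
    _ ≤ _ := by
        refine lintegral_mono fun T => ?_
        by_cases hT : ∃ t ∈ R.level n T, t ∈ B
        · obtain ⟨t, ht, htB⟩ := hT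
          rw [indicator_of_mem (by exact ⟨t, ht, htB⟩)]
          refine le_trans ?_ (ENNReal.le_tsum ⟨t, ht⟩)
          rw [indicator_of_mem htB]
          exact le_rfl
        · rw [indicator_of_notMem (by exact hT)]
          exact zero_le

/-! ### Counting translates of patches -/

/-- All translates of members of `I` by elements of `V`. -/
def translates (I : Set (Finset (L 0 × Euc d))) (V : Set (Euc d)) : Set (Finset (L 0 × Euc d)) :=
  {S | ∃ P ∈ I, ∃ v ∈ V, S = P.map (shift v).toEmbedding}

/-- The number of subsets of `Q` that belong to `𝒮`. -/
def subsetCount {X : Type*} (𝒮 : Set (Finset X)) (Q : Finset X) : ℝ≥0∞ :=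
  ∑ S ∈ Q.powerset, 𝒮.indicator 1 S

open Classical in
/-- A `k`-element set is the range of `k!` injective tuples. -/
theorem card_filter_piFinset {X : Type*} [DecidableEq X] (𝒮 : Set (Finset X)) (Q : Finset X)
    {k : ℕ} {G : Set (Fin k → X)}
    (hG : ∀ f, f ∈ G ↔ Function.Injective f ∧ Finset.univ.image f ∈ 𝒮) :
    ((Fintype.piFinset fun _ : Fin k => Q).filter (· ∈ G)).card =
      k.factorial * ((Q.powersetCard k).filter (· ∈ 𝒮)).card := by
  have hmaps : ∀ f ∈ (Fintype.piFinset fun _ : Fin k => Q).filter (· ∈ G),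
      Finset.univ.image f ∈ (Q.powersetCard k).filter (· ∈ 𝒮) := by
    intro f hf
    rw [Finset.mem_filter, Fintype.mem_piFinset, hG] at hf
    rw [Finset.mem_filter, Finset.mem_powersetCard]
    refine ⟨⟨?_, ?_⟩, hf.2.2⟩
    · intro x hx
      obtain ⟨i, -, rfl⟩ := Finset.mem_image.1 hx
      exact hf.1 i
    · rw [Finset.card_image_of_injective _ hf.2.1, Finset.card_univ, Fintype.card_fin]
  rw [Finset.card_eq_sum_card_fiberwise hmaps, mul_comm, ← smul_eq_mul, ← Finset.sum_const]
  refine Finset.sum_congr rfl fun S hS => ?_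
  rw [Finset.mem_filter, Finset.mem_powersetCard] at hS
  have hcard : Fintype.card (Fin k ≃ S) = k.factorial := by
    have e : Fin k ≃ S := (S.equivFinOfCardEq hS.1.2).symm
    rw [Fintype.card_equiv e, Fintype.card_fin]
  rw [← hcard, ← Finset.card_univ]
  symm
  refine Finset.card_bij (fun e _ i => (e i : X)) ?_ ?_ ?_
  · intro e _
    have himg : Finset.univ.image (fun i => (e i : X)) = S := by
      ext x
      simp only [Finset.mem_image, Finset.mem_univ, true_and]
      exact ⟨fun ⟨i, hi⟩ => hi ▸ (e i).2, fun hx => ⟨e.symm ⟨x, hx⟩, by simp⟩⟩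
    rw [Finset.mem_filter, Finset.mem_filter, Fintype.mem_piFinset, hG]
    exact ⟨⟨fun i => hS.1.1 (e i).2, Subtype.val_injective.comp e.injective,
      by rw [himg]; exact hS.2⟩, himg⟩
  · intro e _ e' _ h
    ext i
    exact congrFun h i
  · intro f hf
    rw [Finset.mem_filter, Finset.mem_filter, hG] at hf
    obtain ⟨⟨-, hinj, -⟩, rfl⟩ := hf
    exact ⟨Equiv.ofBijective (fun i => ⟨f i, Finset.mem_image_of_mem f (Finset.mem_univ i)⟩)
      ⟨fun i j h => hinj (Subtype.mk.inj h), fun ⟨x, hx⟩ => by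
        obtain ⟨i, -, rfl⟩ := Finset.mem_image.1 hx
        exact ⟨i, rfl⟩⟩, Finset.mem_univ _, rfl⟩

open Classical in
/-- Subsets can be counted through ordered tuples of distinct elements, which turns the count into a
measurable function. -/
theorem subsetCount_eq_tsum {X : Type*} [DecidableEq X] [MeasurableSpace X]
    (𝒮 : Set (Finset X)) (Q : Finset X)
    (h𝒮 : ∀ k : ℕ, MeasurableSet
      {f : Fin k → X | Function.Injective f ∧ Finset.univ.image f ∈ 𝒮}) :
    subsetCount 𝒮 Q = ∑' k : ℕ, (k.factorial : ℝ≥0∞)⁻¹ *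
      points ((Fintype.piFinset fun _ : Fin k => Q : Finset _) : Set (Fin k → X))
        {f : Fin k → X | Function.Injective f ∧ Finset.univ.image f ∈ 𝒮} := by
  have h1 : ∀ k : ℕ, (k.factorial : ℝ≥0∞)⁻¹ *
      points ((Fintype.piFinset fun _ : Fin k => Q : Finset _) : Set (Fin k → X))
        {f : Fin k → X | Function.Injective f ∧ Finset.univ.image f ∈ 𝒮} =
      ∑ S ∈ Q.powersetCard k, 𝒮.indicator 1 S := by
    intro k
    rw [points_finset_apply _ (h𝒮 k), card_filter_piFinset
      (G := {f : Fin k → X | Function.Injective f ∧ Finset.univ.image f ∈ 𝒮})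
      𝒮 Q (fun _ => Iff.rfl), Nat.cast_mul, ← mul_assoc,
      ENNReal.inv_mul_cancel (by exact_mod_cast k.factorial_ne_zero) (ENNReal.natCast_ne_top _),
      one_mul]
    simp [indicator]
  simp only [h1]
  rw [subsetCount, Finset.sum_powerset, tsum_eq_sum]
  intro k hk
  rw [Finset.powersetCard_eq_empty.2 (by simpa using hk), Finset.sum_empty]

section PatchFamily

variable {I : Set (Finset (L 0 × Euc d))}

theorem IsPatchFamily.eq_of_map_eq (hI : R.IsPatchFamily I) {P Q : Finset (L 0 × Euc d)}
    (hP : P ∈ I) (hQ : Q ∈ I) {u v : Euc d}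
    (h : P.map (shift u).toEmbedding = Q.map (shift v).toEmbedding) : P = Q ∧ u = v := by
  have h1 : P.map (shift (u - v)).toEmbedding = Q := by
    have := congrArg (fun S => S.map (shift (-v)).toEmbedding) h
    simp only [map_shift_shift, add_neg_cancel, map_shift_zero, ← sub_eq_add_neg] at this
    exact this
  have h2 : u - v = 0 := hI.inequivalent P hP _ (h1 ▸ hQ)
  rw [h2, map_shift_zero] at h1
  exact ⟨h1, sub_eq_zero.1 h2⟩

open Classical in
/-- Translation is injective on pairs of a member of `I` and a vector, because the members of `I` are
inequivalent. Hence the translates are the image of a Borel set under an injective Borel map. -/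
theorem IsPatchFamily.measurableSet_translates (hI : R.IsPatchFamily I) {V : Set (Euc d)}
    (hV : MeasurableSet V) (k : ℕ) : MeasurableSet
      {f : Fin k → L 0 × Euc d | Function.Injective f ∧ Finset.univ.image f ∈ translates I V} := by
  let φ : (Fin k → L 0 × Euc d) × Euc d → (Fin k → L 0 × Euc d) := fun p i => shift p.2 (p.1 i)
  have hφ : Measurable φ := by
    refine measurable_pi_lambda _ fun i => ?_
    simp only [φ, shift_apply]
    fun_prop
  have himg : ∀ (f : Fin k → L 0 × Euc d) (v : Euc d),
      Finset.univ.image (fun i => shift v (f i)) =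
        (Finset.univ.image f).map (shift v).toEmbedding := by
    intro f v
    rw [Finset.map_eq_image, Finset.image_image]
    rfl
  have : StandardBorelSpace (Fin k → L 0 × Euc d) := StandardBorelSpace.pi_countable
  have hS := (hI.measurable k).prod hV
  have hinj : InjOn φ ({f : Fin k → L 0 × Euc d | Function.Injective f ∧
      Finset.univ.image f ∈ I} ×ˢ V) := by
    rintro ⟨f, u⟩ ⟨hf, -⟩ ⟨g, v⟩ ⟨hg, -⟩ h
    have h1 : u = v := (hI.eq_of_map_eq hf.2 hg.2 (by
      rw [← himg, ← himg]
      exact congrArg (fun f => Finset.univ.image f) h)).2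
    subst h1
    refine Prod.ext (funext fun i => ?_) rfl
    exact (shift u).injective (congrFun h i)
  convert hS.image_of_measurable_injOn hφ hinj using 1
  ext g
  constructor
  · rintro ⟨hg, P, hP, v, hv, h⟩
    have hfg : (fun i => shift v (shift (-v) (g i))) = g := by
      funext i
      rw [shift_shift, neg_add_cancel, shift_zero]
    refine ⟨(fun i => shift (-v) (g i), v), ⟨⟨(shift (-v)).injective.comp hg, ?_⟩, hv⟩, hfg⟩
    rw [himg, h, map_shift_shift, add_neg_cancel, map_shift_zero]
    exact hP
  · rintro ⟨⟨f, v⟩, ⟨⟨hf, hfI⟩, hv⟩, rfl⟩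
    exact ⟨(shift v).injective.comp hf, _, hfI, v, hv, himg f v⟩

theorem IsPatchFamily.measurable_subsetCount (hI : R.IsPatchFamily I) (hR : R.IsFusionRule)
    {V : Set (Euc d)} (hV : MeasurableSet V) {N : ℕ} (h : 0 ≤ N) :
    Measurable fun t : L N × Euc d => subsetCount (translates I V) (R.sub h t) := by
  classical
  simp only [subsetCount_eq_tsum _ _ (hI.measurableSet_translates hV)]
  exact Measurable.tsum fun k => measurable_const.mul
    (hR.measurable_card_tuples h (hI.measurableSet_translates hV k))

theorem patchCount_eq (n : ℕ) (c : L n) :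
    (R.patchCount I n c : ℝ≥0∞) =
      subsetCount (translates I univ) (R.decomp (Nat.zero_le n) c) := by
  classical
  have : {S : Finset (L 0 × Euc d) | S ⊆ R.decomp (Nat.zero_le n) c ∧
      ∃ P ∈ I, ∃ v : Euc d, S = P.map (shift v).toEmbedding} =
      ((R.decomp (Nat.zero_le n) c).powerset.filter (· ∈ translates I univ) : Finset _) := by
    ext S
    simp [translates]
  rw [patchCount, this, Set.ncard_coe_finset, subsetCount]
  simp [indicator]

theorem IsPatchFamily.measurable_patchCount (hI : R.IsPatchFamily I) (hR : R.IsFusionRule)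
    (n : ℕ) : Measurable fun c : L n => (R.patchCount I n c : ℝ≥0∞) := by
  have h := (hI.measurable_subsetCount hR MeasurableSet.univ (N := n) (Nat.zero_le n)).comp
    (measurable_prodMk_right (y := (0 : Euc d)))
  convert h using 2 with c
  rw [patchCount_eq, Function.comp, sub, map_shift_zero]

/-- Each translate of a member of `I` in the supertile is moved into `translates I U` by a set of
vectors that is itself a translate of `U`. -/
theorem IsPatchFamily.lintegral_subsetCount (hI : R.IsPatchFamily I) {U : Set (Euc d)}
    (hU : MeasurableSet U) (n : ℕ) (c : L n) :
    ∫⁻ x, subsetCount (translates I U) (R.sub (Nat.zero_le n) (c, x)) =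
      R.patchCount I n c * volume U := by
  classical
  have h1 : ∀ x : Euc d, subsetCount (translates I U) (R.sub (Nat.zero_le n) (c, x)) =
      ∑ S ∈ (R.decomp (Nat.zero_le n) c).powerset,
        (translates I U).indicator 1 (S.map (shift x).toEmbedding) := by
    intro x
    rw [subsetCount, sub]
    symm
    refine Finset.sum_bij (fun S _ => S.map (shift x).toEmbedding) ?_ ?_ ?_ fun _ _ => rfl
    · intro S hS
      exact Finset.mem_powerset.2 (Finset.map_subset_map.2 (Finset.mem_powerset.1 hS))
    · intro S _ S' _ h
      exact Finset.map_injective _ h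
    · intro S hS
      refine ⟨S.map (shift (-x)).toEmbedding, Finset.mem_powerset.2 ?_, ?_⟩
      · have := Finset.map_subset_map (f := (shift (X := L 0) (-x)).toEmbedding).2
          (Finset.mem_powerset.1 hS)
        rwa [map_shift_shift, add_neg_cancel, map_shift_zero] at this
      · rw [map_shift_shift, neg_add_cancel, map_shift_zero]
  have h2 : ∀ S : Finset (L 0 × Euc d), ∃ A : Set (Euc d), MeasurableSet A ∧
      volume A = (translates I univ).indicator 1 S * volume U ∧ ∀ x,
      (translates I U).indicator (1 : Finset (L 0 × Euc d) → ℝ≥0∞)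
        (S.map (shift x).toEmbedding) = A.indicator 1 x := by
    intro S
    by_cases hS : S ∈ translates I univ
    · obtain ⟨P, hP, w, -, rfl⟩ := id hS
      refine ⟨{x | w + x ∈ U}, measurable_const_add w hU, ?_, fun x => ?_⟩
      · rw [indicator_of_mem hS, Pi.one_apply, one_mul]
        exact measure_preimage_add volume w U
      · have : (P.map (shift w).toEmbedding).map (shift x).toEmbedding ∈ translates I U ↔
            w + x ∈ U := by
          rw [map_shift_shift]
          constructor
          · rintro ⟨Q, hQ, v, hv, h⟩
            exact (hI.eq_of_map_eq hP hQ h).2 ▸ hv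
          · exact fun h => ⟨P, hP, _, h, rfl⟩
        simp only [indicator, this, mem_ofPred_eq, Pi.one_apply]
    · refine ⟨∅, MeasurableSet.empty, by simp [hS], fun x => ?_⟩
      rw [indicator_of_notMem, indicator_empty]
      rintro ⟨P, hP, v, -, h⟩
      refine hS ⟨P, hP, v - x, mem_univ _, ?_⟩
      have := congrArg (fun S => S.map (shift (-x)).toEmbedding) h
      simp only [map_shift_shift, add_neg_cancel, map_shift_zero, ← sub_eq_add_neg] at this
      exact this
  choose A hA hvol hind using h2
  simp only [h1, hind]
  rw [lintegral_finsetSum _ fun S _ => measurable_one.indicator (hA S)]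
  simp only [lintegral_indicator_one (hA _), hvol]
  rw [← Finset.sum_mul, patchCount_eq, subsetCount]

/-- The tilings that contain a translate of a member of `I` by an element of `U` inside a single
`n`-supertile. -/
def innerCylinder (R : FusionData d L) (I : Set (Finset (L 0 × Euc d))) (U : Set (Euc d)) (n : ℕ) :
    Set R.Hull :=
  {T | ∃ t ∈ R.level n T, ∃ S ∈ translates I U, S ⊆ R.sub (Nat.zero_le n) t}

theorem mem_cylinder {U : Set (Euc d)} {T : R.Hull} :
    T ∈ R.cylinder I U ↔ ∃ S ∈ translates I U, (S : Set (L 0 × Euc d)) ⊆ T.1 := by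
  have key : ∀ (P : Finset (L 0 × Euc d)) (v : Euc d),
      (P : Set (L 0 × Euc d)) ⊆ (R.translate v T).1 ↔
        ((P.map (shift v).toEmbedding : Finset _) : Set (L 0 × Euc d)) ⊆ T.1 := by
    intro P v
    rw [Finset.coe_map]
    change _ ↔ shift v '' _ ⊆ _
    rw [image_subset_iff]
    refine forall₂_congr fun s _ => ?_
    change s ∈ shift (-v) '' T.1 ↔ _
    rw [mem_image_shift, neg_neg]
    rfl
  constructor
  · rintro ⟨P, hP, v, hv, h⟩
    exact ⟨_, ⟨P, hP, v, hv, rfl⟩, (key P v).1 h⟩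
  · rintro ⟨_, ⟨P, hP, v, hv, rfl⟩, h⟩
    exact ⟨P, hP, v, hv, (key P v).2 h⟩

theorem IsTrimWith.eq_of_subset {U : Set (Euc d)} (h : R.IsTrimWith I U) {T : R.Hull}
    {S S' : Finset (L 0 × Euc d)} (hS : S ∈ translates I U) (hS' : S' ∈ translates I U)
    (hST : (S : Set (L 0 × Euc d)) ⊆ T.1) (hST' : (S' : Set (L 0 × Euc d)) ⊆ T.1) : S = S' := by
  obtain ⟨P, hP, u, hu, rfl⟩ := hS
  obtain ⟨Q, hQ, v, hv, rfl⟩ := hS'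
  have key : ∀ (P : Finset (L 0 × Euc d)) (v : Euc d),
      ((P.map (shift v).toEmbedding : Finset _) : Set (L 0 × Euc d)) ⊆ T.1 →
        (P : Set (L 0 × Euc d)) ⊆ (R.translate v T).1 := by
    intro P v h s hs
    change s ∈ shift (-v) '' T.1
    rw [mem_image_shift, neg_neg]
    exact h (Finset.mem_coe.2 (Finset.mem_map_of_mem _ hs))
  obtain ⟨rfl, rfl⟩ := h.2.2 T P hP Q hQ u hu v hv (key P u hST) (key Q v hST')
  rfl

/-- By trimness at most one element of `translates I U` occurs in a tiling, so that the sum over all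
`n`-supertiles is `0` or `1`. -/
theorem IsRegular.tsum_subsetCount (H : R.IsRegular) (hI : R.IsPatchFamily I) {U : Set (Euc d)}
    (hU : R.IsTrimWith I U) (n : ℕ) (T : R.Hull) :
    ∑' t : R.level n T, subsetCount (translates I U) (R.sub (Nat.zero_le n) t) =
      (R.innerCylinder I U n).indicator 1 T := by
  classical
  have hsub : ∀ t ∈ R.level n T, ∀ S, S ⊆ R.sub (Nat.zero_le n) t →
      (S : Set (L 0 × Euc d)) ⊆ T.1 := by
    intro t ht S hS
    rw [← (H.level_spec n T).2]
    exact (Finset.coe_subset.2 hS).trans (coe_sub_subset_subdivide ht)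
  by_cases hT : T ∈ R.innerCylinder I U n
  · obtain ⟨t, ht, S, hS, hSt⟩ := id hT
    rw [indicator_of_mem hT, tsum_eq_single ⟨t, ht⟩, subsetCount,
      Finset.sum_eq_single_of_mem S (Finset.mem_powerset.2 hSt), indicator_of_mem hS]
    · rfl
    · intro S' hS' hne
      refine indicator_of_notMem (fun h => hne ?_) _
      exact hU.eq_of_subset h hS (hsub t ht S' (Finset.mem_powerset.1 hS')) (hsub t ht S hSt)
    · rintro ⟨t', ht'⟩ hne
      refine Finset.sum_eq_zero fun S' hS' => indicator_of_notMem (fun h => hne ?_) _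
      have h1 : S' ⊆ R.sub (Nat.zero_le n) t' := Finset.mem_powerset.1 hS'
      obtain rfl : S' = S := hU.eq_of_subset h hS (hsub t' ht' S' h1) (hsub t ht S hSt)
      have hne' : S'.Nonempty := by
        obtain ⟨P, hP, v, -, rfl⟩ := hS
        exact (hI.patch P hP).1.map
      obtain ⟨s, hs⟩ := hne'
      exact Subtype.ext
        (H.fusion.eq_of_mem_sub (H.level_nonOverlapping n T) ht' ht (h1 hs) (hSt hs))
  · rw [indicator_of_notMem hT]
    refine ENNReal.tsum_eq_zero.2 fun t => Finset.sum_eq_zero fun S hS => ?_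
    exact indicator_of_notMem (fun h => hT ⟨t, t.2, S, h, Finset.mem_powerset.1 hS⟩) _

/-- The identity behind the frequency formula: patches inside `n`-supertiles are counted by the
intensity of the `n`-supertiles. -/
theorem IsRegular.lintegral_patchCount (hd : 0 < d) (H : R.IsRegular) {μ : Measure R.Hull}
    {n : ℕ} {ρ : Measure (L n)} (hρ : R.IsIntensity μ n ρ) (hI : R.IsPatchFamily I)
    {U : Set (Euc d)} (hU : R.IsTrimWith I U) :
    (∫⁻ c, (R.patchCount I n c : ℝ≥0∞) ∂ρ) * volume U = μ (R.innerCylinder I U n) := by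
  have hUm := hU.1.measurableSet
  have hm := hI.measurable_subsetCount H.fusion hUm (N := n) (Nat.zero_le n)
  have h1 := hρ _ hm
  have h2 := H.measurable_tsum_level hd hm
  simp only [H.tsum_subsetCount hI hU, hI.lintegral_subsetCount hUm] at h1 h2
  have h3 : MeasurableSet (R.innerCylinder I U n) := by
    convert h2 (measurableSet_singleton 1) using 1
    ext T
    by_cases hT : T ∈ R.innerCylinder I U n <;> simp [hT]
  rw [lintegral_indicator_one h3, lintegral_mul_const _ (hI.measurable_patchCount H.fusion n)] at h1
  exact h1.symm

theorem IsRegular.monotone_innerCylinder (H : R.IsRegular) (U : Set (Euc d)) :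
    Monotone (R.innerCylinder I U) := by
  refine monotone_nat_of_le_succ fun n T => ?_
  rintro ⟨t, ht, S, hS, hSt⟩
  rw [← H.subdivide_level (Nat.le_succ n) T] at ht
  obtain ⟨t', ht', htt'⟩ := mem_subdivide.1 ht
  exact ⟨t', ht', S, hS, fun s hs => (mem_sub_trans _ (Nat.le_succ n)).2 ⟨t, htt', hSt hs⟩⟩

/-- A patch of a tiling lies in a ball around the origin, and hence almost surely in a single supertile
of some level. -/
theorem IsRegular.cylinder_ae_eq_iUnion (hd : 0 < d) (H : R.IsRegular) {μ : Measure R.Hull}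
    [IsProbabilityMeasure μ] {ρ : ∀ n, Measure (L n)} (hρ : ∀ n, R.IsIntensity μ n (ρ n))
    (U : Set (Euc d)) : μ (⋃ n, R.innerCylinder I U n) = μ (R.cylinder I U) := by
  refine le_antisymm (measure_mono (iUnion_subset fun n T => ?_)) (measure_mono_ae ?_)
  · rintro ⟨t, ht, S, hS, hSt⟩
    refine mem_cylinder.2 ⟨S, hS, ?_⟩
    rw [← (H.level_spec n T).2]
    exact (Finset.coe_subset.2 hSt).trans (coe_sub_subset_subdivide ht)
  · filter_upwards [H.ae_exists_closedBall_subset hd hρ] with T hT hTc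
    obtain ⟨S, hS, hST⟩ := mem_cylinder.1 hTc
    have hb : Bornology.IsBounded (R.region 0 (S : Set (L 0 × Euc d))) :=
      (Bornology.isBounded_biUnion S.finite_toSet).2 fun s _ => (isCompact_placedSupp 0 s).isBounded
    obtain ⟨r, hr⟩ := hb.subset_closedBall 0
    obtain ⟨m, hm⟩ := exists_nat_ge r
    obtain ⟨n, t, ht, hsub⟩ := hT m
    refine mem_iUnion.2 ⟨n, t, ht, S, hS, fun s hs => ?_⟩
    have h1 : s ∈ R.subdivide (Nat.zero_le n) (R.level n T) := by
      rw [(H.level_spec n T).2]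
      exact hST hs
    obtain ⟨t', ht', hst'⟩ := mem_subdivide.1 h1
    obtain ⟨y, hy⟩ := H.fusion.interior_placedSupp_nonempty 0 s
    have h2 : y ∈ R.placedSupp n t := hsub (Metric.closedBall_subset_closedBall hm
      (hr (placedSupp_subset_region hs (interior_subset hy))))
    rwa [← (H.level_nonOverlapping n T).eq_of_mem_interior ht' ht
      (interior_mono (placedSupp_subset_of_mem_sub hst') hy) h2]

end PatchFamily

/-- The sum of the patch counts against `ρ n` is the probability of `innerCylinder I U n`, divided by
the volume of `U`; these events increase to `cylinder I U` up to a null set. -/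
theorem IsRegular.frequencyFormula (hd : 0 < d) (H : R.IsRegular) {μ : Measure R.Hull}
    [IsProbabilityMeasure μ] {ρ : ∀ n, Measure (L n)} (hρ : ∀ n, R.IsIntensity μ n (ρ n)) :
    R.FrequencyFormula μ ρ := by
  intro I hI U hU
  have hU0 : volume U ≠ 0 := (hU.1.measure_pos volume hU.2.1).ne'
  have h1 : ∀ n, ∫⁻ c, (R.patchCount I n c : ℝ≥0∞) ∂(ρ n) =
      μ (R.innerCylinder I U n) / volume U := fun n =>
    ennreal_eq_div (H.lintegral_patchCount hd (hρ n) hI hU) hU0 (measure_ne_top μ _)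
  simp only [h1]
  rw [← H.cylinder_ae_eq_iUnion hd hρ U]
  exact ENNReal.Tendsto.div_const (tendsto_measure_iUnion_atTop (H.monotone_innerCylinder U))
    (Or.inr hU0)

/-- The frequency measures of an invariant measure. -/
theorem IsRegular.exists_frequencyMeasures (hd : 0 < d) (H : R.IsRegular) {μ : Measure R.Hull}
    [IsProbabilityMeasure μ] (hμ : R.Invariant μ) :
    ∃ ρ : ∀ n, Measure (L n), (∀ n, R.IsIntensity μ n (ρ n)) ∧
      (∀ n, R.IsFrequencyMeasure μ n (ρ n)) ∧
        R.VolumeNormalized ρ ∧ R.TransitionConsistent ρ ∧ R.FrequencyFormula μ ρ := by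
  choose ρ _ hρ using fun n => H.exists_isIntensity hd hμ n
  exact ⟨ρ, hρ, fun n => H.isFrequencyMeasure hd (hρ n), fun n => H.lintegral_volume_supp hd (hρ n),
    fun n N h I hI => H.transition h.le (hρ n) (hρ N) hI, H.frequencyFormula hd hρ⟩

/-! ### Markov chains with prescribed two-step marginals -/

open ProbabilityTheory in
/-- The chain starts from the first marginal of `J 0` and moves from `X n` to `X (n + 1)` according to
the conditional distribution of `J n`; its law exists by the Ionescu-Tulcea theorem. -/
theorem exists_measure_map_eq {X : ℕ → Type*} [∀ n, MeasurableSpace (X n)]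
    [∀ n, StandardBorelSpace (X n)] [∀ n, Nonempty (X n)] (J : ∀ n, Measure (X n × X (n + 1)))
    [∀ n, IsProbabilityMeasure (J n)] (hJ : ∀ n, (J n).snd = (J (n + 1)).fst) :
    ∃ ν : Measure (∀ n, X n), IsProbabilityMeasure ν ∧
      ∀ n, ν.map (fun x => (x n, x (n + 1))) = J n := by
  let last : ∀ n, (∀ i : Finset.Iic n, X i) → X n := fun n x => x ⟨n, Finset.mem_Iic.2 le_rfl⟩
  have hlast : ∀ n, Measurable (last n) := fun n => measurable_pi_apply _
  let κ : ∀ n, Kernel (∀ i : Finset.Iic n, X i) (X (n + 1)) := fun n =>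
    (J n).condKernel.comap (last n) (hlast n)
  let ν := Kernel.trajMeasure (J 0).fst κ
  have hstep : ∀ n, ν.map (fun x => x n) = (J n).fst →
      ν.map (fun x => (x n, x (n + 1))) = J n := by
    intro n hn
    have h1 := Kernel.map_frestrictLe_trajMeasure_compProd_eq_map_trajMeasure (κ := κ)
      (μ₀ := (J 0).fst) (a := n)
    have h2 : ν.map (fun x => (x n, x (n + 1))) =
        (ν.map fun x => (Preorder.frestrictLe n x, x (n + 1))).map
          (fun p => (last n p.1, p.2)) := by
      rw [Measure.map_map (by fun_prop) (by fun_prop)]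
      rfl
    rw [h2, ← h1, ← (J n).disintegrate (J n).condKernel]
    ext B hB
    rw [Measure.map_apply (by fun_prop) hB,
      Measure.compProd_apply (measurableSet_preimage (by fun_prop) hB), Measure.compProd_apply hB,
      ← hn, lintegral_map (Kernel.measurable_kernel_prodMk_left hB) (measurable_pi_apply n),
      lintegral_map (Kernel.measurable_kernel_prodMk_left
        (measurableSet_preimage (by fun_prop) hB)) (by fun_prop)]
    rfl
  have hfst : ∀ n, ν.map (fun x => x n) = (J n).fst := by
    intro n
    induction n with
    | zero =>
      have h1 : ν.map (Preorder.frestrictLe 0) =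
          (J 0).fst.map (MeasurableEquiv.piUnique fun i : Finset.Iic 0 => X i).symm := by
        rw [show ν = Kernel.traj κ 0 ∘ₘ (J 0).fst.map
          (MeasurableEquiv.piUnique fun i : Finset.Iic 0 => X i).symm from rfl,
          Measure.map_comp _ _ (by fun_prop), Kernel.traj_map_frestrictLe, Kernel.partialTraj_self,
          Measure.id_comp]
      have h2 : ν.map (fun x => x 0) = (ν.map (Preorder.frestrictLe 0)).map (last 0) := by
        rw [Measure.map_map (hlast 0) (by fun_prop)]
        rfl
      rw [h2, h1]
      exact (Measure.map_map (hlast 0)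
        (MeasurableEquiv.piUnique fun i : Finset.Iic 0 => X i).symm.measurable).trans Measure.map_id
    | succ n ih =>
      rw [← hJ n, ← hstep n ih, Measure.snd, Measure.map_map measurable_snd (by fun_prop)]
      rfl
  exact ⟨ν, inferInstance, fun n => hstep n (hfst n)⟩

/-! ### The measures of placed supertiles -/

/-- The volume of the support is a strictly positive density whose integral is finite. -/
theorem IsFusionRule.sigmaFinite (hR : R.IsFusionRule) {n : ℕ} {ρ : Measure (L n)}
    (hρ : ∫⁻ c, volume (R.supp n c) ∂ρ = 1) : SigmaFinite ρ := by
  have hm := hR.measurable_volume_supp n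
  have h0 : ∀ c : L n, volume (R.supp n c) ≠ 0 := fun c => (hR.volume_supp_pos n c).ne'
  have : IsFiniteMeasure (ρ.withDensity fun c => volume (R.supp n c)) :=
    isFiniteMeasure_withDensity (by rw [hρ]; exact ENNReal.one_ne_top)
  have h := withDensity_inv_same (μ := ρ) hm (ae_of_all _ h0)
    (ae_of_all _ fun c => volume_supp_ne_top n c)
  rw [← h]
  exact SigmaFinite.withDensity_of_ne_top (ae_of_all _ fun c => by simpa using h0 c)

theorem map_shift_prod {n : ℕ} (ρ : Measure (L n)) [SFinite ρ] (v : Euc d) :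
    (ρ.prod volume).map (shift v : L n × Euc d → L n × Euc d) = ρ.prod volume := by
  have h := (MeasurePreserving.id ρ).prod (measurePreserving_add_right (volume : Measure (Euc d)) v)
  exact h.map_eq

theorem IsFusionRule.measurableSet_mem_sub (hR : R.IsFusionRule) {n N : ℕ} (h : n ≤ N) :
    MeasurableSet {p : (L n × Euc d) × (L N × Euc d) | p.1 ∈ R.sub h p.2} := by
  obtain ⟨b, hbc, -, hb⟩ := exists_countable_basis (L n × Euc d)
  have : {p : (L n × Euc d) × (L N × Euc d) | p.1 ∈ R.sub h p.2} =
      ⋂ V ∈ b, {p | p.1 ∈ V → ∃ s ∈ R.sub h p.2, s ∈ V} := by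
    ext p
    simp only [mem_ofPred_eq, mem_iInter]
    refine ⟨fun hp V _ hV => ⟨p.1, hp, hV⟩, fun hp => ?_⟩
    by_contra hn
    obtain ⟨V, hV, hpV, hVs⟩ := hb.exists_subset_of_mem_open
      (show p.1 ∈ ((R.sub h p.2 : Set (L n × Euc d)))ᶜ from hn)
      (R.sub h p.2).finite_toSet.isClosed.isOpen_compl
    obtain ⟨s, hs, hsV⟩ := hp V hV hpV
    exact hVs hsV hs
  rw [this]
  refine MeasurableSet.biInter hbc fun V hV => ?_
  have h1 : MeasurableSet V := (hb.isOpen hV).measurableSet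
  have h2 : MeasurableSet {p : (L n × Euc d) × (L N × Euc d) | ∃ s ∈ R.sub h p.2, s ∈ V} :=
    (measurable_snd : Measurable (Prod.snd : (L n × Euc d) × (L N × Euc d) → L N × Euc d))
      (hR.measurableSet_sub_hit h h1)
  convert (measurableSet_preimage (measurable_fst (β := L N × Euc d)) h1).compl.union h2 using 1
  ext p
  simp [imp_iff_not_or]

/-- Transition consistency, for placed supertiles. -/
theorem IsFusionRule.lintegral_sum_sub (hR : R.IsFusionRule) {n N : ℕ} (h : n ≤ N)
    {ρ : Measure (L n)} [SigmaFinite ρ] {ρ' : Measure (L N)} [SFinite ρ']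
    (htr : ∀ I : Set (L n), MeasurableSet I → ρ I = ∫⁻ c, (R.labelCount h I c : ℝ≥0∞) ∂ρ')
    {f : L n × Euc d → ℝ≥0∞} (hf : Measurable f) :
    ∫⁻ t, ∑ s ∈ R.sub h t, f s ∂(ρ'.prod volume) = ∫⁻ s, f s ∂(ρ.prod volume) := by
  have hm := hR.measurable_points_sub (R := R) h
  have key : ρ.prod volume = (ρ'.prod volume).bind
      fun t : L N × Euc d => points (R.sub h t : Set (L n × Euc d)) := by
    refine Measure.prod_eq fun I U hI hU => ?_
    rw [Measure.bind_apply (hI.prod hU) hm.aemeasurable, htr I hI]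
    have hi : Measurable ((I ×ˢ U).indicator (1 : L n × Euc d → ℝ≥0∞)) :=
      measurable_one.indicator (hI.prod hU)
    have h1 : ∀ t : L N × Euc d, points (R.sub h t : Set (L n × Euc d)) (I ×ˢ U) =
        ∑ s ∈ R.sub h t, (I ×ˢ U).indicator (1 : L n × Euc d → ℝ≥0∞) s := by
      intro t
      rw [points_apply _ (hI.prod hU), Finset.tsum_subtype' _ ((I ×ˢ U).indicator 1)]
    simp only [h1]
    rw [lintegral_prod _ (hR.measurable_sum_sub h hi).aemeasurable]
    simp only [lintegral_sum_sub_prod h hI hU]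
    rw [lintegral_mul_const]
    have h2 : ∀ c : L N, (R.labelCount h I c : ℝ≥0∞) =
        ∑ s ∈ R.sub h (c, (0 : Euc d)), (I ×ˢ univ).indicator (1 : L n × Euc d → ℝ≥0∞) s := by
      classical
      intro c
      rw [labelCount_eq, sub, map_shift_zero]
      simp [indicator]
    simp only [h2]
    exact (hR.measurable_sum_sub h (measurable_one.indicator (hI.prod MeasurableSet.univ))).comp
      measurable_prodMk_right
  rw [key, Measure.lintegral_bind hm.aemeasurable hf.aemeasurable]
  refine lintegral_congr fun t => ?_
  rw [lintegral_points, Finset.tsum_subtype' _ f]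

theorem IsFusionRule.prod_frontier (hR : R.IsFusionRule) {n : ℕ} (ρ : Measure (L n)) [SFinite ρ]
    (y : Euc d) : (ρ.prod volume) {t : L n × Euc d | y ∈ frontier (R.placedSupp n t)} = 0 := by
  rw [Measure.prod_apply (hR.measurableSet_mem_frontier n y)]
  simp only [preimage_ofPred_eq, hR.volume_mem_frontier, lintegral_zero]

theorem IsFusionRule.prod_mem_placedSupp (hR : R.IsFusionRule) {n : ℕ} {ρ : Measure (L n)}
    [SFinite ρ] (hρ : ∫⁻ c, volume (R.supp n c) ∂ρ = 1) :
    (ρ.prod volume) {t : L n × Euc d | (0 : Euc d) ∈ R.placedSupp n t} = 1 := by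
  rw [Measure.prod_apply (hR.isClosed_mem_placedSupp n 0).measurableSet]
  simp only [preimage_ofPred_eq, volume_mem_placedSupp, hρ]

theorem IsFusionRule.measurableSet_mem_interior (hR : R.IsFusionRule) (n : ℕ) (y : Euc d) :
    MeasurableSet {t : L n × Euc d | y ∈ interior (R.placedSupp n t)} := by
  convert (hR.isClosed_mem_placedSupp n y).measurableSet.diff
    (hR.measurableSet_mem_frontier n y) using 1
  ext t
  rw [mem_ofPred_eq, ← self_sdiff_frontier]
  rfl

/-- The law of the supertile around the origin. -/
def rootMeasure (R : FusionData d L) (n : ℕ) (ρ : Measure (L n)) : Measure (L n × Euc d) :=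
  (ρ.prod volume).restrict {t | (0 : Euc d) ∈ interior (R.placedSupp n t)}

/-- The boundary of the supertile is negligible. -/
theorem IsFusionRule.rootMeasure_apply (hR : R.IsFusionRule) {n : ℕ} (ρ : Measure (L n))
    [SFinite ρ] {B : Set (L n × Euc d)} (hB : MeasurableSet B) :
    R.rootMeasure n ρ B = (ρ.prod volume) (B ∩ {t | (0 : Euc d) ∈ R.placedSupp n t}) := by
  rw [rootMeasure, Measure.restrict_apply hB]
  refine le_antisymm (measure_mono (inter_subset_inter_right _ fun t ht =>
    interior_subset (s := R.placedSupp n t) ht)) ?_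
  refine (measure_mono (t := B ∩ {t | (0 : Euc d) ∈ interior (R.placedSupp n t)} ∪
    {t | (0 : Euc d) ∈ frontier (R.placedSupp n t)}) ?_).trans
    ((measure_union_le _ _).trans (by rw [hR.prod_frontier, add_zero]))
  rintro t ⟨htB, ht⟩
  by_cases hf : (0 : Euc d) ∈ frontier (R.placedSupp n t)
  · exact Or.inr hf
  · refine Or.inl ⟨htB, ?_⟩
    change (0 : Euc d) ∈ interior _
    rw [← self_sdiff_frontier]
    exact ⟨ht, hf⟩

theorem IsFusionRule.isProbabilityMeasure_rootMeasure (hR : R.IsFusionRule) {n : ℕ}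
    {ρ : Measure (L n)} [SFinite ρ] (hρ : ∫⁻ c, volume (R.supp n c) ∂ρ = 1) :
    IsProbabilityMeasure (R.rootMeasure n ρ) := by
  constructor
  rw [hR.rootMeasure_apply ρ MeasurableSet.univ, univ_inter, hR.prod_mem_placedSupp hρ]

open ProbabilityTheory in
/-- The joint law of the supertiles of two consecutive levels around the origin. -/
theorem IsFusionRule.exists_coupling (hR : R.IsFusionRule) (n : ℕ)
    {ρ : Measure (L n)} {ρ' : Measure (L (n + 1))}
    (hρ : ∫⁻ c, volume (R.supp n c) ∂ρ = 1) (hρ' : ∫⁻ c, volume (R.supp (n + 1) c) ∂ρ' = 1)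
    (htr : ∀ I : Set (L n), MeasurableSet I →
      ρ I = ∫⁻ c, (R.labelCount (Nat.le_succ n) I c : ℝ≥0∞) ∂ρ') :
    ∃ J : Measure ((L n × Euc d) × (L (n + 1) × Euc d)), IsProbabilityMeasure J ∧
      J.fst = R.rootMeasure n ρ ∧ J.snd = R.rootMeasure (n + 1) ρ' ∧
      ∀ᵐ p ∂J, p.1 ∈ R.sub (Nat.le_succ n) p.2 := by
  classical
  have := hR.sigmaFinite hρ
  have := hR.sigmaFinite hρ'
  let h := Nat.le_succ n
  let A : Set (L n × Euc d) := {s | (0 : Euc d) ∈ interior (R.placedSupp n s)}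
  have hA : MeasurableSet A := hR.measurableSet_mem_interior n 0
  -- the constituents of a supertile whose interior contains the origin; there is at most one
  let κ : Kernel (L (n + 1) × Euc d) (L n × Euc d) :=
    Kernel.restrict ⟨fun t => points (R.sub h t : Set (L n × Euc d)), hR.measurable_points_sub h⟩ hA
  have hκ : ∀ t, ∀ B, MeasurableSet B →
      κ t B = ((R.sub h t).filter fun s => s ∈ B ∧ s ∈ A).card := by
    intro t B hB
    rw [Kernel.restrict_apply, Measure.restrict_apply hB]
    refine (points_finset_apply (R.sub h t) (hB.inter hA)).trans ?_
    congr!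
  have hκu : ∀ t, κ t univ = ((R.sub h t).filter (· ∈ A)).card := by
    intro t
    rw [hκ t _ MeasurableSet.univ]
    simp
  have hle : ∀ t, ((R.sub h t).filter (· ∈ A)).card ≤ 1 := by
    intro t
    refine Finset.card_le_one.2 fun a ha b hb => ?_
    rw [Finset.mem_filter] at ha hb
    exact (hR.nonOverlapping_sub h t).eq_of_mem_interior ha.1 hb.1 ha.2 (interior_subset hb.2)
  have : IsFiniteKernel κ := by
    refine ⟨⟨1, ENNReal.one_lt_top, fun t => ?_⟩⟩
    rw [hκu t]
    exact_mod_cast hle t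
  let J := ((ρ'.prod (volume : Measure (Euc d))) ⊗ₘ κ).map Prod.swap
  have hfst : J.fst = R.rootMeasure n ρ := by
    ext B hB
    rw [Measure.fst_apply hB, Measure.map_apply measurable_swap (measurable_fst hB),
      Measure.compProd_apply (measurable_swap (measurable_fst hB)), rootMeasure,
      Measure.restrict_apply hB, ← lintegral_indicator_one (hB.inter hA),
      ← hR.lintegral_sum_sub h htr (measurable_one.indicator (hB.inter hA))]
    refine lintegral_congr fun t => ?_
    refine (hκ t B hB).trans ?_
    simp [indicator, A]
  have hsnd : J.snd = R.rootMeasure (n + 1) ρ' := by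
    ext B hB
    rw [Measure.snd_apply hB, Measure.map_apply measurable_swap (measurable_snd hB),
      Measure.compProd_apply (measurable_swap (measurable_snd hB)), hR.rootMeasure_apply _ hB,
      ← lintegral_indicator_one (hB.inter (hR.isClosed_mem_placedSupp (n + 1) 0).measurableSet)]
    refine lintegral_congr_ae ?_
    -- almost surely the origin avoids the boundaries of the constituents
    have hnull : ∀ᵐ t ∂(ρ'.prod (volume : Measure (Euc d))), ∀ s ∈ R.sub h t,
        (0 : Euc d) ∉ frontier (R.placedSupp n s) := by
      have hm : Measurable ({s : L n × Euc d | (0 : Euc d) ∈ frontier (R.placedSupp n s)}.indicator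
          (1 : L n × Euc d → ℝ≥0∞)) :=
        measurable_one.indicator (hR.measurableSet_mem_frontier n 0)
      have h1 := hR.lintegral_sum_sub h htr hm
      rw [lintegral_indicator_one (hR.measurableSet_mem_frontier n 0), hR.prod_frontier,
        lintegral_eq_zero_iff (hR.measurable_sum_sub h hm)] at h1
      filter_upwards [h1] with t ht s hs h0
      have := Finset.sum_eq_zero_iff.1 ht s hs
      rw [indicator_of_mem (by exact h0)] at this
      exact one_ne_zero this
    filter_upwards [hnull] with t ht
    by_cases htB : t ∈ B ∩ {t | (0 : Euc d) ∈ R.placedSupp (n + 1) t}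
    · rw [indicator_of_mem htB]
      have h1 : (Prod.mk t ⁻¹' (Prod.swap ⁻¹' (Prod.snd ⁻¹' B)) : Set (L n × Euc d)) = univ :=
        eq_univ_of_forall fun s => htB.1
      rw [h1, hκu t]
      have h2 : (0 : Euc d) ∈ R.region n (R.sub h t : Set (L n × Euc d)) := by
        rw [region_sub]
        exact htB.2
      obtain ⟨s, hs, h0⟩ := mem_region.1 h2
      have h3 : s ∈ (R.sub h t).filter (· ∈ A) := by
        refine Finset.mem_filter.2 ⟨hs, ?_⟩
        change (0 : Euc d) ∈ interior _
        rw [← self_sdiff_frontier]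
        exact ⟨h0, ht s hs⟩
      have h4 := le_antisymm (hle t) (Finset.card_pos.2 ⟨s, h3⟩)
      rw [h4]
      simp
    · rw [indicator_of_notMem htB]
      by_cases htB' : t ∈ B
      · have h0 : (0 : Euc d) ∉ R.placedSupp (n + 1) t := fun h0 => htB ⟨htB', h0⟩
        refine le_antisymm ((measure_mono (subset_univ _)).trans ?_) zero_le
        rw [hκu t, Finset.filter_false_of_mem]
        · simp
        · exact fun s hs hsA => h0 (placedSupp_subset_of_mem_sub hs (interior_subset hsA))
      · have h1 : (Prod.mk t ⁻¹' (Prod.swap ⁻¹' (Prod.snd ⁻¹' B)) : Set (L n × Euc d)) = ∅ :=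
          eq_empty_of_forall_notMem fun s => htB'
        rw [h1, measure_empty]
  refine ⟨J, ⟨?_⟩, hfst, hsnd, ?_⟩
  · have := hR.isProbabilityMeasure_rootMeasure hρ
    rw [← Measure.fst_univ, hfst, measure_univ]
  · have hm := hR.measurableSet_mem_sub (R := R) h
    rw [ae_iff, show {p : (L n × Euc d) × (L (n + 1) × Euc d) | ¬ p.1 ∈ R.sub (Nat.le_succ n) p.2} =
      {p | p.1 ∈ R.sub h p.2}ᶜ from rfl, Measure.map_apply measurable_swap hm.compl,
      Measure.compProd_apply (measurable_swap hm.compl)]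
    rw [lintegral_eq_zero_iff (Kernel.measurable_kernel_prodMk_left (measurable_swap hm.compl))]
    refine ae_of_all _ fun t => ?_
    refine (hκ t _ (measurable_prodMk_left (measurable_swap hm.compl))).trans ?_
    rw [Finset.filter_false_of_mem]
    · simp
    · exact fun s hs hsA => hsA.1 hs

/-! ### Tilings as unions of growing supertiles -/

/-- The sequences of supertiles around the origin, one of each level and each a constituent of the
next, that exhaust `ℝ^d`. -/
def goodPaths (R : FusionData d L) : Set (∀ n, L n × Euc d) :=
  {y | (∀ n, y n ∈ R.sub (Nat.le_succ n) (y (n + 1))) ∧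
    (∀ n, (0 : Euc d) ∈ interior (R.placedSupp n (y n))) ∧
    ∀ m : ℕ, ∃ n, Metric.closedBall 0 (m : ℝ) ⊆ R.placedSupp n (y n)}

/-- The union of the decompositions of the supertiles `y N` into `n`-supertiles. -/
def pathTiling (R : FusionData d L) (n : ℕ) (y : ∀ n, L n × Euc d) : Set (L n × Euc d) :=
  {s | ∃ (N : ℕ) (h : n ≤ N), s ∈ R.sub h (y N)}

section Paths

variable {y : ∀ n, L n × Euc d}

theorem mem_sub_of_mem_goodPaths (hy : y ∈ R.goodPaths) {n N : ℕ} (h : n ≤ N) :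
    y n ∈ R.sub h (y N) := by
  induction N, h using Nat.le_induction with
  | base => simp
  | succ N h ih => exact (mem_sub_trans h (Nat.le_succ N)).2 ⟨y N, hy.1 N, ih⟩

theorem mem_sub_mono_of_mem_goodPaths (hy : y ∈ R.goodPaths) {n M N : ℕ} (h : n ≤ M) (h' : M ≤ N)
    {s : L n × Euc d} (hs : s ∈ R.sub h (y M)) : s ∈ R.sub (h.trans h') (y N) :=
  (mem_sub_trans h h').2 ⟨y M, mem_sub_of_mem_goodPaths hy h', hs⟩

theorem self_mem_pathTiling (n : ℕ) (y : ∀ n, L n × Euc d) : y n ∈ R.pathTiling n y :=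
  ⟨n, le_refl n, by simp⟩

theorem eventually_mem_sub_of_mem_pathTiling (hy : y ∈ R.goodPaths) {n : ℕ} {s : L n × Euc d}
    (hs : s ∈ R.pathTiling n y) : ∀ᶠ N in atTop, ∃ h : n ≤ N, s ∈ R.sub h (y N) := by
  obtain ⟨M, h, hs⟩ := hs
  filter_upwards [eventually_ge_atTop M] with N hN
  exact ⟨h.trans hN, mem_sub_mono_of_mem_goodPaths hy h hN hs⟩

theorem IsRegular.pathTiling_mem_Omega (H : R.IsRegular) (hy : y ∈ R.goodPaths) (n : ℕ) :
    R.pathTiling n y ∈ R.Omega n := by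
  refine H.mem_Omega_iff.2 ⟨⟨?_, eq_univ_of_forall fun x => ?_⟩, fun P hP => ?_⟩
  · intro s hs s' hs' hne
    obtain ⟨N, ⟨h, h1⟩, ⟨_, h2⟩⟩ := ((eventually_mem_sub_of_mem_pathTiling hy hs).and
      (eventually_mem_sub_of_mem_pathTiling hy hs')).exists
    exact H.fusion.nonOverlapping_sub h (y N) s h1 s' h2 hne
  · obtain ⟨m, hm⟩ := exists_nat_ge ‖x‖
    obtain ⟨N, hN⟩ := hy.2.2 m
    have hx : x ∈ R.placedSupp N (y N) := hN (by simpa using hm)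
    have hx' : x ∈ R.placedSupp (max n N) (y (max n N)) :=
      placedSupp_subset_of_mem_sub (mem_sub_of_mem_goodPaths hy (le_max_right n N)) hx
    rw [← region_sub (le_max_left n N)] at hx'
    obtain ⟨s, hs, hxs⟩ := mem_region.1 hx'
    exact mem_region.2 ⟨s, ⟨_, le_max_left n N, hs⟩, hxs⟩
  · obtain ⟨N, hN⟩ := ((eventually_ge_atTop n).and ((eventually_all_finset P).2 fun s hs =>
      eventually_mem_sub_of_mem_pathTiling hy (hP hs))).exists
    exact admitted_of_subset_sub hN.1 (y N) fun s hs => (hN.2 s hs).2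

theorem subdivide_pathTiling (hy : y ∈ R.goodPaths) {n m : ℕ} (h : n ≤ m) :
    R.subdivide h (R.pathTiling m y) = R.pathTiling n y := by
  ext s
  rw [mem_subdivide]
  constructor
  · rintro ⟨t, ⟨N, hN, ht⟩, hs⟩
    exact ⟨N, h.trans hN, (mem_sub_trans h hN).2 ⟨t, ht, hs⟩⟩
  · intro hs
    obtain ⟨N, hmN, hnN, hsN⟩ := ((eventually_ge_atTop m).and
      (eventually_mem_sub_of_mem_pathTiling hy hs)).exists
    obtain ⟨u, hu, hsu⟩ := (mem_sub_trans h hmN).1 hsN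
    exact ⟨u, ⟨N, hmN, hu⟩, hsu⟩

end Paths

/-- The tiling determined by a sequence of growing supertiles. -/
def IsRegular.pathHull (H : R.IsRegular) (y : R.goodPaths) : R.Hull :=
  ⟨R.pathTiling 0 y.1, H.pathTiling_mem_Omega y.2 0⟩

theorem IsRegular.level_pathHull (H : R.IsRegular) (n : ℕ) (y : R.goodPaths) :
    R.level n (H.pathHull y) = R.pathTiling n y.1 :=
  (H.eq_level (H.pathTiling_mem_Omega y.2 n) (subdivide_pathTiling y.2 _)).symm

theorem IsRegular.measurable_pathHull (H : R.IsRegular) : Measurable H.pathHull := by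
  refine H.measurable_of_hitMeasurable fun V hV => ?_
  have : {y : R.goodPaths | ∃ t ∈ (H.pathHull y).1, t ∈ V} =
      ⋃ N, (fun y : R.goodPaths => y.1 N) ⁻¹' {t | ∃ s ∈ R.sub (Nat.zero_le N) t, s ∈ V} := by
    ext y
    simp only [mem_ofPred_eq, mem_iUnion, mem_preimage]
    exact ⟨fun ⟨t, ⟨N, h, ht⟩, htV⟩ => ⟨N, t, ht, htV⟩,
      fun ⟨N, t, ht, htV⟩ => ⟨t, ⟨N, Nat.zero_le N, ht⟩, htV⟩⟩
  rw [this]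
  exact MeasurableSet.iUnion fun N => ((measurable_pi_apply N).comp measurable_subtype_coe)
    (H.fusion.measurableSet_sub_hit _ hV.measurableSet)

theorem IsFusionRule.measurableSet_goodPaths (hR : R.IsFusionRule) :
    MeasurableSet R.goodPaths := by
  have : R.goodPaths = (⋂ n, {y | y n ∈ R.sub (Nat.le_succ n) (y (n + 1))}) ∩
      ((⋂ n, {y | (0 : Euc d) ∈ interior (R.placedSupp n (y n))}) ∩
        ⋂ m : ℕ, ⋃ n, {y | Metric.closedBall 0 (m : ℝ) ⊆ R.placedSupp n (y n)}) := by
    ext y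
    simp [goodPaths]
  have hn : ∀ n, Measurable fun y : ∀ n, L n × Euc d => y n := fun n => measurable_pi_apply n
  rw [this]
  refine (MeasurableSet.iInter fun n => ?_).inter ((MeasurableSet.iInter fun n => ?_).inter
    (MeasurableSet.iInter fun m : ℕ => MeasurableSet.iUnion fun n => ?_))
  · have h : Measurable fun y : ∀ n, L n × Euc d => (y n, y (n + 1)) := by fun_prop
    exact h (hR.measurableSet_mem_sub (Nat.le_succ n))
  · have h := measurableSet_preimage (hn n) (hR.measurableSet_mem_interior n 0)
    exact h
  · exact measurableSet_preimage (hn n) (hR.isClosed_subset_placedSupp n _).measurableSet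

theorem IsRegular.prod_bad_le (H : R.IsRegular) {n : ℕ} {ρ : Measure (L n)} [SFinite ρ]
    (hρ : ∫⁻ c, volume (R.supp n c) ∂ρ = 1) (r : ℝ) :
    (ρ.prod volume) {t : L n × Euc d | (0 : Euc d) ∈ R.placedSupp n t ∧
      ¬ Metric.closedBall 0 r ⊆ R.placedSupp n t} ≤ R.boundaryRatio r n := by
  rw [Measure.prod_apply (H.fusion.measurableSet_bad n r)]
  exact H.lintegral_volume_bad_le hρ r

/-- Every ball around the origin is almost surely contained in one of the supertiles, since the
probability that the `n`-th supertile does not contain it tends to `0`. -/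
theorem IsRegular.ae_mem_goodPaths (H : R.IsRegular) {ρ : ∀ n, Measure (L n)}
    (hV : R.VolumeNormalized ρ) {ν : Measure (∀ n, L n × Euc d)}
    (hmarg : ∀ n, ν.map (fun y => y n) = R.rootMeasure n (ρ n))
    (hsub : ∀ n, ∀ᵐ y ∂ν, y n ∈ R.sub (Nat.le_succ n) (y (n + 1))) :
    ∀ᵐ y ∂ν, y ∈ R.goodPaths := by
  have := fun n => H.fusion.sigmaFinite (hV n)
  have hn : ∀ n, Measurable fun y : ∀ n, L n × Euc d => y n := fun n => measurable_pi_apply n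
  have hpre : ∀ (n : ℕ) (B : Set (L n × Euc d)), MeasurableSet B →
      ν {y | y n ∈ B} = R.rootMeasure n (ρ n) B := by
    intro n B hB
    rw [← hmarg n, Measure.map_apply (hn n) hB]
    rfl
  have h2 : ∀ n, ∀ᵐ y ∂ν, (0 : Euc d) ∈ interior (R.placedSupp n (y n)) := by
    intro n
    have hA := H.fusion.measurableSet_mem_interior n (0 : Euc d)
    refine (hpre n _ hA.compl).trans ?_
    rw [rootMeasure, Measure.restrict_apply hA.compl, compl_inter_self, measure_empty]
  have h3 : ∀ m : ℕ, ∀ᵐ y ∂ν, ∃ n, Metric.closedBall 0 (m : ℝ) ⊆ R.placedSupp n (y n) := by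
    intro m
    rw [ae_iff]
    refine le_antisymm (ge_of_tendsto' (H.vanHove.tendsto_boundaryRatio (Nat.cast_nonneg m))
      fun n => ?_) zero_le
    have hm : MeasurableSet {t : L n × Euc d | ¬ Metric.closedBall 0 (m : ℝ) ⊆
      R.placedSupp n t} := (H.fusion.isClosed_subset_placedSupp n _).measurableSet.compl
    refine (measure_mono fun y (hy : ¬ ∃ n, _) hyn => hy ⟨n, hyn⟩).trans ((hpre n _ hm).le.trans ?_)
    rw [H.fusion.rootMeasure_apply _ hm, inter_comm]
    exact H.prod_bad_le (hV n) m
  filter_upwards [ae_all_iff.2 hsub, ae_all_iff.2 h2, ae_all_iff.2 h3] with y a b c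
  exact ⟨a, b, c⟩

/-- The couplings of consecutive levels can be glued to the law of a random sequence of growing
supertiles around the origin. -/
theorem IsRegular.exists_measure_goodPaths (H : R.IsRegular) {ρ : ∀ n, Measure (L n)}
    (hV : R.VolumeNormalized ρ) (hT : R.TransitionConsistent ρ) :
    ∃ ν : Measure R.goodPaths, IsProbabilityMeasure ν ∧
      ∀ n, ν.map (fun y => y.1 n) = R.rootMeasure n (ρ n) := by
  have := fun n => H.fusion.sigmaFinite (hV n)
  choose J hJp hJ1 hJ2 hJs using fun n => H.fusion.exists_coupling n (hV n) (hV (n + 1))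
    fun I hI => hT n (n + 1) (Nat.lt_succ_self n) I hI
  have : ∀ n, StandardBorelSpace (L n × Euc d) := fun n => inferInstance
  obtain ⟨ν, hν, hνJ⟩ := exists_measure_map_eq J fun n => (hJ2 n).trans (hJ1 (n + 1)).symm
  have hn : ∀ n, Measurable fun y : ∀ n, L n × Euc d => y n := fun n => measurable_pi_apply n
  have hp : ∀ n, Measurable fun y : ∀ n, L n × Euc d => (y n, y (n + 1)) :=
    fun n => (hn n).prodMk (hn (n + 1))
  have hmarg : ∀ n, ν.map (fun y => y n) = R.rootMeasure n (ρ n) := by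
    intro n
    rw [← hJ1 n, ← hνJ n, Measure.fst, Measure.map_map measurable_fst (hp n)]
    rfl
  have hgood : ∀ᵐ y ∂ν, y ∈ R.goodPaths := by
    refine H.ae_mem_goodPaths hV hmarg fun n => ?_
    have h := hJs n
    rw [← hνJ n] at h
    exact ae_of_ae_map (hp n).aemeasurable h
  have hemb := MeasurableEmbedding.subtype_coe H.fusion.measurableSet_goodPaths
  have hval : (ν.comap ((↑) : R.goodPaths → ∀ n, L n × Euc d)).map (↑) = ν := by
    rw [hemb.map_comap, Subtype.range_coe]
    exact Measure.restrict_eq_self_of_ae_mem hgood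
  refine ⟨ν.comap (↑), ⟨?_⟩, fun n => ?_⟩
  · rw [← preimage_univ (f := ((↑) : R.goodPaths → ∀ n, L n × Euc d)),
      ← Measure.map_apply measurable_subtype_coe MeasurableSet.univ, hval, measure_univ]
  · rw [← hmarg n]
    conv_rhs => rw [← hval]
    rw [Measure.map_map (measurable_pi_apply n) measurable_subtype_coe]
    rfl

/-! ### Hitting events -/

/-- The tilings that have a tile in each of the members of `F`. -/
def hitSet (R : FusionData d L) (F : Set (Set (L 0 × Euc d))) : Set R.Hull :=
  {T | ∀ V ∈ F, ∃ t ∈ T.1, t ∈ V}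

/-- The events `hitSet F` for finite families `F` of open sets. -/
def hitEvents (R : FusionData d L) : Set (Set R.Hull) :=
  {E | ∃ F : Set (Set (L 0 × Euc d)), F.Finite ∧ (∀ V ∈ F, IsOpen V) ∧ E = R.hitSet F}

theorem isPiSystem_hitEvents : IsPiSystem R.hitEvents := by
  rintro _ ⟨F, hF, hFo, rfl⟩ _ ⟨F', hF', hFo', rfl⟩ -
  refine ⟨F ∪ F', hF.union hF', ?_, ?_⟩
  · rintro V (hV | hV)
    exacts [hFo V hV, hFo' V hV]
  · ext T
    simp only [hitSet, mem_inter_iff, mem_ofPred_eq, mem_union, or_imp, forall_and]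

theorem IsFusionRule.measurableSet_hitSet (hR : R.IsFusionRule) {F : Set (Set (L 0 × Euc d))}
    (hF : F.Finite) (hFo : ∀ V ∈ F, IsOpen V) : MeasurableSet (R.hitSet F) := by
  have : R.hitSet F = ⋂ V ∈ F, {T | ∃ t ∈ T.1, t ∈ V} := by
    ext T
    simp [hitSet]
  rw [this]
  exact MeasurableSet.biInter hF.countable fun V hV => (hR.isOpen_hit (hFo V hV)).measurableSet

theorem IsRegular.generateFrom_hitEvents (H : R.IsRegular) :
    (inferInstance : MeasurableSpace R.Hull) = MeasurableSpace.generateFrom R.hitEvents := by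
  refine le_antisymm (fun A hA => ?_) (MeasurableSpace.generateFrom_le ?_)
  · have h := @IsRegular.measurable_of_hitMeasurable d L R _ _ _ _ _ H R.Hull
      (MeasurableSpace.generateFrom R.hitEvents) id fun V hV =>
        MeasurableSpace.measurableSet_generateFrom ⟨{V}, finite_singleton V, by simpa using hV, by
          ext T
          simp [hitSet]⟩
    exact h hA
  · rintro _ ⟨F, hF, hFo, rfl⟩
    exact H.fusion.measurableSet_hitSet hF hFo

theorem IsRegular.measure_ext (H : R.IsRegular) {μ μ' : Measure R.Hull} [IsProbabilityMeasure μ]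
    [IsProbabilityMeasure μ'] (h : ∀ F : Set (Set (L 0 × Euc d)), F.Finite →
      (∀ V ∈ F, IsOpen V) → μ (R.hitSet F) = μ' (R.hitSet F)) : μ = μ' := by
  refine ext_of_generate_finite R.hitEvents H.generateFrom_hitEvents isPiSystem_hitEvents ?_
    (by simp)
  rintro _ ⟨F, hF, hFo, rfl⟩
  exact h F hF hFo

theorem isOpen_preimage_shift {X : Type*} [TopologicalSpace X] (v : Euc d) {V : Set (X × Euc d)}
    (hV : IsOpen V) : IsOpen (shift v ⁻¹' V) := by
  have : Continuous fun t : X × Euc d => (t.1, t.2 + v) := by fun_prop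
  exact hV.preimage this

theorem translate_translate (u v : Euc d) (T : R.Hull) :
    R.translate u (R.translate v T) = R.translate (u + v) T := by
  refine Subtype.ext ?_
  change shift (-u) '' (shift (-v) '' T.1) = shift (-(u + v)) '' T.1
  rw [image_image]
  simp only [shift_shift, neg_add_rev]

theorem translate_zero (T : R.Hull) : R.translate 0 T = T := by
  refine Subtype.ext ?_
  change shift (-0) '' T.1 = T.1
  rw [neg_zero]
  simp only [shift_zero, image_id']

theorem translate_preimage_hitSet (v : Euc d) (F : Set (Set (L 0 × Euc d))) :
    R.translate v ⁻¹' R.hitSet F = R.hitSet ((fun V => shift (-v) ⁻¹' V) '' F) := by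
  ext T
  simp only [hitSet, mem_preimage, mem_ofPred_eq, forall_mem_image]
  refine forall₂_congr fun V _ => ?_
  exact exists_mem_image

/-- The placed supertiles that have a tile in each of the members of `F`. -/
def subHitSet (R : FusionData d L) (N : ℕ) (F : Set (Set (L 0 × Euc d))) :
    Set (L N × Euc d) :=
  {t | ∀ V ∈ F, ∃ s ∈ R.sub (Nat.zero_le N) t, s ∈ V}

theorem IsFusionRule.measurableSet_subHitSet (hR : R.IsFusionRule) (N : ℕ)
    {F : Set (Set (L 0 × Euc d))} (hF : F.Finite) (hFo : ∀ V ∈ F, IsOpen V) :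
    MeasurableSet (R.subHitSet N F) := by
  have : R.subHitSet N F = ⋂ V ∈ F, {t | ∃ s ∈ R.sub (Nat.zero_le N) t, s ∈ V} := by
    ext T
    simp [subHitSet]
  rw [this]
  exact MeasurableSet.biInter hF.countable fun V hV =>
    hR.measurableSet_sub_hit _ (hFo V hV).measurableSet

theorem mem_subHitSet_image {N : ℕ} {F : Set (Set (L 0 × Euc d))} {v : Euc d} {t : L N × Euc d} :
    shift v t ∈ R.subHitSet N ((fun V => shift (-v) ⁻¹' V) '' F) ↔ t ∈ R.subHitSet N F := by
  simp only [subHitSet, mem_ofPred_eq, forall_mem_image]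
  refine forall₂_congr fun V _ => ?_
  rw [sub_shift]
  constructor
  · rintro ⟨s, hs, hsV⟩
    exact ⟨_, mem_map_shift.1 hs, hsV⟩
  · rintro ⟨s, hs, hsV⟩
    refine ⟨shift v s, Finset.mem_map_of_mem _ hs, ?_⟩
    rwa [mem_preimage, shift_shift, add_neg_cancel, shift_zero]

/-- The tiles of the random tiling that matter for a hitting event appear in the supertile around the
origin from some level on. -/
theorem IsRegular.tendsto_rootMeasure_subHitSet (H : R.IsRegular) {ρ : ∀ n, Measure (L n)}
    {ν : Measure R.goodPaths} (hν : ∀ n, ν.map (fun y => y.1 n) = R.rootMeasure n (ρ n))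
    {F : Set (Set (L 0 × Euc d))} (hF : F.Finite) (hFo : ∀ V ∈ F, IsOpen V) :
    Tendsto (fun N => R.rootMeasure N (ρ N) (R.subHitSet N F)) atTop
      (𝓝 (ν.map H.pathHull (R.hitSet F))) := by
  have h1 : ∀ N, R.rootMeasure N (ρ N) (R.subHitSet N F) =
      ν {y | y.1 N ∈ R.subHitSet N F} := by
    intro N
    rw [← hν N]
    exact Measure.map_apply ((measurable_pi_apply N).comp measurable_subtype_coe)
      (H.fusion.measurableSet_subHitSet N hF hFo)
  have h2 : H.pathHull ⁻¹' R.hitSet F = ⋃ N, {y : R.goodPaths | y.1 N ∈ R.subHitSet N F} := by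
    ext y
    rw [mem_preimage, mem_iUnion]
    constructor
    · intro hy
      refine ((eventually_all_finite hF).2 fun V hV => ?_).exists (f := atTop)
      obtain ⟨t, ht, htV⟩ := hy V hV
      filter_upwards [eventually_mem_sub_of_mem_pathTiling y.2 ht] with N hN
      exact ⟨t, hN.2, htV⟩
    · rintro ⟨N, hN⟩ V hV
      obtain ⟨s, hs, hsV⟩ := hN V hV
      exact ⟨s, ⟨N, _, hs⟩, hsV⟩
  simp only [h1]
  rw [Measure.map_apply H.measurable_pathHull (H.fusion.measurableSet_hitSet hF hFo), h2]
  refine tendsto_measure_iUnion_atTop (monotone_nat_of_le_succ fun N y hy V hV => ?_)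
  obtain ⟨s, hs, hsV⟩ := hy V hV
  exact ⟨s, mem_sub_mono_of_mem_goodPaths y.2 _ (Nat.le_succ N) hs, hsV⟩

/-- Up to a boundary effect, the law of the supertile around the origin does not change under
translations. -/
theorem IsRegular.rootMeasure_subHitSet_image_le (H : R.IsRegular) {N : ℕ} {ρ : Measure (L N)}
    (hρ : ∫⁻ c, volume (R.supp N c) ∂ρ = 1) {F : Set (Set (L 0 × Euc d))} (hF : F.Finite)
    (hFo : ∀ V ∈ F, IsOpen V) (v : Euc d) :
    R.rootMeasure N ρ (R.subHitSet N ((fun V => shift (-v) ⁻¹' V) '' F)) ≤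
      R.rootMeasure N ρ (R.subHitSet N F) + R.boundaryRatio ‖v‖ N := by
  have := H.fusion.sigmaFinite hρ
  have hFo' : ∀ V ∈ (fun V => shift (-v) ⁻¹' V) '' F, IsOpen (V : Set (L 0 × Euc d)) := by
    rintro _ ⟨V, hV, rfl⟩
    exact isOpen_preimage_shift (-v) (hFo V hV)
  have hm := H.fusion.measurableSet_subHitSet N hF hFo
  have hm' := H.fusion.measurableSet_subHitSet N (hF.image _) hFo'
  have h0 : ∀ y : Euc d, MeasurableSet {t : L N × Euc d | y ∈ R.placedSupp N t} := fun y =>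
    (H.fusion.isClosed_mem_placedSupp N y).measurableSet
  have hs : Measurable (shift v : L N × Euc d → L N × Euc d) := by
    have : Measurable fun t : L N × Euc d => (t.1, t.2 + v) := by fun_prop
    exact this
  have hmem : ∀ (y : Euc d) (t : L N × Euc d),
      y ∈ R.placedSupp N (shift v t) ↔ y - v ∈ R.placedSupp N t := by
    intro y t
    rw [mem_placedSupp, mem_placedSupp, sub_right_comm, sub_sub y]
    rfl
  have hpre : ∀ A : Set (L N × Euc d), MeasurableSet A →
      (ρ.prod volume) A = (ρ.prod volume) (shift v ⁻¹' A) := by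
    intro A hA
    conv_lhs => rw [← map_shift_prod ρ v]
    rw [Measure.map_apply hs hA]
  rw [H.fusion.rootMeasure_apply _ hm', H.fusion.rootMeasure_apply _ hm,
    hpre _ (hm'.inter (h0 0))]
  calc _ ≤ (ρ.prod volume) (R.subHitSet N F ∩ {t | (0 : Euc d) ∈ R.placedSupp N t} ∪
        shift v ⁻¹' {t : L N × Euc d | (0 : Euc d) ∈ R.placedSupp N t ∧
          v ∉ R.placedSupp N t}) := by
        refine measure_mono fun t ht => ?_
        have h1 := mem_subHitSet_image.1 ht.1
        by_cases h : (0 : Euc d) ∈ R.placedSupp N t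
        · exact Or.inl ⟨h1, h⟩
        · refine Or.inr ⟨ht.2, fun hv => h ?_⟩
          rw [hmem, _root_.sub_self] at hv
          exact hv
    _ ≤ _ := by
        refine (measure_union_le _ _).trans (add_le_add_right ?_ _)
        refine (hpre _ ((h0 0).inter (h0 v).compl)).ge.trans ?_
        refine (measure_mono ?_).trans (H.prod_bad_le hρ ‖v‖)
        exact fun t ht => ⟨ht.1, fun hsub => ht.2 (hsub (by simp))⟩

/-- In the limit the boundary effect disappears. An inequality for all translations suffices, since it
can also be applied to the opposite translation. -/
theorem IsRegular.invariant_map_pathHull (H : R.IsRegular) {ρ : ∀ n, Measure (L n)}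
    (hV : R.VolumeNormalized ρ) {ν : Measure R.goodPaths} [IsProbabilityMeasure ν]
    (hν : ∀ n, ν.map (fun y => y.1 n) = R.rootMeasure n (ρ n)) :
    R.Invariant (ν.map H.pathHull) := by
  have hle : ∀ (v : Euc d) (F : Set (Set (L 0 × Euc d))), F.Finite → (∀ V ∈ F, IsOpen V) →
      ν.map H.pathHull (R.hitSet ((fun V => shift (-v) ⁻¹' V) '' F)) ≤
        ν.map H.pathHull (R.hitSet F) := by
    intro v F hF hFo
    have h1 := H.tendsto_rootMeasure_subHitSet hν (hF.image fun V => shift (-v) ⁻¹' V)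
      (by rintro _ ⟨V, hV, rfl⟩; exact isOpen_preimage_shift (-v) (hFo V hV))
    have h2 := (H.tendsto_rootMeasure_subHitSet hν hF hFo).add
      (H.vanHove.tendsto_boundaryRatio (norm_nonneg v))
    rw [add_zero] at h2
    exact le_of_tendsto_of_tendsto' h1 h2 fun N =>
      H.rootMeasure_subHitSet_image_le (hV N) hF hFo v
  have : IsProbabilityMeasure (ν.map H.pathHull) :=
    Measure.isProbabilityMeasure_map H.measurable_pathHull.aemeasurable
  intro v A hA
  have hm := H.measurable_translate v
  have : IsProbabilityMeasure ((ν.map H.pathHull).map (R.translate v)) :=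
    Measure.isProbabilityMeasure_map hm.aemeasurable
  rw [← Measure.map_apply hm hA]
  congr 1
  refine H.measure_ext fun F hF hFo => ?_
  rw [Measure.map_apply hm (H.fusion.measurableSet_hitSet hF hFo), translate_preimage_hitSet]
  refine le_antisymm (hle v F hF hFo) ?_
  have h := hle (-v) ((fun V => shift (-v) ⁻¹' V) '' F) (hF.image _)
    (by rintro _ ⟨V, hV, rfl⟩; exact isOpen_preimage_shift (-v) (hFo V hV))
  rw [← translate_preimage_hitSet, ← translate_preimage_hitSet, ← preimage_comp] at h
  have h' : R.translate v ∘ R.translate (-v) = id := by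
    funext T
    rw [Function.comp_apply, translate_translate, add_neg_cancel, translate_zero, id]
  rw [h', preimage_id, translate_preimage_hitSet] at h
  exact h

/-! ### The intensities of the constructed measure -/

theorem IsFusionRule.volume_mem_interior (hR : R.IsFusionRule) (n : ℕ) (c : L n) (y : Euc d) :
    volume {x : Euc d | y ∈ interior (R.placedSupp n (c, x))} = volume (R.supp n c) := by
  rw [← volume_mem_placedSupp n c y]
  refine le_antisymm (measure_mono fun x hx => interior_subset (s := R.placedSupp n (c, x)) hx) ?_
  refine (measure_mono (t := {x | y ∈ interior (R.placedSupp n (c, x))} ∪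
    {x | y ∈ frontier (R.placedSupp n (c, x))}) fun x hx => ?_).trans
    ((measure_union_le _ _).trans (by rw [hR.volume_mem_frontier, add_zero]))
  by_cases hf : y ∈ frontier (R.placedSupp n (c, x))
  · exact Or.inr hf
  · refine Or.inl ?_
    change y ∈ interior _
    rw [← self_sdiff_frontier]
    exact ⟨hx, hf⟩

/-- The labels of the supertiles around the origin, weighted by inverse volume, recover the measure
on the labels. -/
theorem IsFusionRule.lintegral_interior_div_volume (hR : R.IsFusionRule) {n : ℕ} (ρ : Measure (L n))
    {I : Set (L n)} (hI : MeasurableSet I) :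
    ∫⁻ c, ∫⁻ x, {t : L n × Euc d | (0 : Euc d) ∈ interior (R.placedSupp n t)}.indicator
      (fun t => I.indicator (fun c => (volume (R.supp n c))⁻¹) t.1) (c, x) ∂volume ∂ρ = ρ I := by
  rw [← lintegral_indicator_one hI]
  refine lintegral_congr fun c => ?_
  have h1 : ∀ x : Euc d, {t : L n × Euc d | (0 : Euc d) ∈ interior (R.placedSupp n t)}.indicator
      (fun t => I.indicator (fun c => (volume (R.supp n c))⁻¹) t.1) (c, x) =
      {x : Euc d | (0 : Euc d) ∈ interior (R.placedSupp n (c, x))}.indicator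
        (fun _ => I.indicator (fun c => (volume (R.supp n c))⁻¹) c) x := fun x => rfl
  simp only [h1]
  have h2 : MeasurableSet {x : Euc d | (0 : Euc d) ∈ interior (R.placedSupp n (c, x))} :=
    measurable_prodMk_left (hR.measurableSet_mem_interior n 0)
  rw [lintegral_indicator_const h2,
    hR.volume_mem_interior]
  by_cases hc : c ∈ I
  · rw [indicator_of_mem hc, indicator_of_mem hc,
      ENNReal.inv_mul_cancel (hR.volume_supp_pos n c).ne' (volume_supp_ne_top n c)]
    rfl
  · rw [indicator_of_notMem hc, indicator_of_notMem hc, zero_mul]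

/-- The invariant measure has some intensity, which is computed from the supertile around the origin:
this supertile is `y n`, whose law is `rootMeasure n (ρ n)`. -/
theorem IsRegular.isIntensity_map_pathHull (hd : 0 < d) (H : R.IsRegular) {ρ : ∀ n, Measure (L n)}
    (hV : R.VolumeNormalized ρ) {ν : Measure R.goodPaths} [IsProbabilityMeasure ν]
    (hν : ∀ n, ν.map (fun y => y.1 n) = R.rootMeasure n (ρ n)) (n : ℕ) :
    R.IsIntensity (ν.map H.pathHull) n (ρ n) := by
  have : IsProbabilityMeasure (ν.map H.pathHull) :=
    Measure.isProbabilityMeasure_map H.measurable_pathHull.aemeasurable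
  have := H.fusion.sigmaFinite (hV n)
  obtain ⟨ρ', -, hρ'⟩ := H.exists_isIntensity hd (H.invariant_map_pathHull hV hν) n
  suffices h : ρ' = ρ n from h ▸ hρ'
  ext I hI
  let A : Set (L n × Euc d) := {t | (0 : Euc d) ∈ interior (R.placedSupp n t)}
  have hA : MeasurableSet A := H.fusion.measurableSet_mem_interior n 0
  let g : L n × Euc d → ℝ≥0∞ := fun t => I.indicator (fun c => (volume (R.supp n c))⁻¹) t.1
  have hg : Measurable g :=
    ((H.fusion.measurable_volume_supp n).inv.indicator hI).comp measurable_fst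
  have hf : Measurable (A.indicator g) := hg.indicator hA
  have h1 : ∀ y : R.goodPaths, ∑' t : R.level n (H.pathHull y), A.indicator g t = g (y.1 n) := by
    intro y
    have hy : y.1 n ∈ R.level n (H.pathHull y) := by
      rw [H.level_pathHull]
      exact self_mem_pathTiling n y.1
    rw [tsum_eq_single ⟨y.1 n, hy⟩]
    · exact indicator_of_mem (s := A) (y.2.2.1 n) g
    · intro t ht
      refine indicator_of_notMem (f := g) (fun htA => ht (Subtype.ext ?_))
      exact (H.level_nonOverlapping n _).eq_of_mem_interior t.2 hy htA
        (interior_subset (y.2.2.1 n))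
  have hn : Measurable fun y : R.goodPaths => y.1 n :=
    (measurable_pi_apply n).comp measurable_subtype_coe
  calc ρ' I = ∫⁻ T, ∑' t : R.level n T, A.indicator g t ∂(ν.map H.pathHull) := by
        rw [hρ' _ hf]
        exact (H.fusion.lintegral_interior_div_volume ρ' hI).symm
    _ = ∫⁻ t, g t ∂(R.rootMeasure n (ρ n)) := by
        rw [lintegral_map (H.measurable_tsum_level hd hf) H.measurable_pathHull, ← hν n,
          lintegral_map hg hn]
        exact lintegral_congr h1
    _ = ρ n I := by
        rw [rootMeasure, ← lintegral_indicator hA, lintegral_prod _ hf.aemeasurable]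
        exact H.fusion.lintegral_interior_div_volume (ρ n) hI

/-- Every volume normalized and transition consistent sequence comes from an invariant measure. -/
theorem IsRegular.exists_invariant (hd : 0 < d) (H : R.IsRegular) {ρ : ∀ n, Measure (L n)}
    (hV : R.VolumeNormalized ρ) (hT : R.TransitionConsistent ρ) :
    ∃ μ : Measure R.Hull, IsProbabilityMeasure μ ∧ R.Invariant μ ∧
      ∀ n, R.IsIntensity μ n (ρ n) := by
  obtain ⟨ν, hν, h⟩ := H.exists_measure_goodPaths hV hT
  exact ⟨ν.map H.pathHull, Measure.isProbabilityMeasure_map H.measurable_pathHull.aemeasurable,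
    H.invariant_map_pathHull hV h, H.isIntensity_map_pathHull hd hV h⟩

/-! ### Palm measures -/

theorem mem_translate {v : Euc d} {T : R.Hull} {s : L 0 × Euc d} :
    s ∈ (R.translate v T).1 ↔ shift v s ∈ T.1 := by
  change s ∈ shift (-v) '' T.1 ↔ _
  rw [mem_image_shift, neg_neg]

/-- `C` is the Palm measure of `μ`: the law of the tiling seen from a typical control point, with
total mass the mean number of control points per unit volume. -/
def IsPalm (R : FusionData d L) (μ C : Measure R.Hull) : Prop :=
  ∀ f : R.Hull × Euc d → ℝ≥0∞, Measurable f →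
    ∫⁻ T, ∑' t : T.1, f (R.translate (t : L 0 × Euc d).2 T, (t : L 0 × Euc d).2) ∂μ =
      ∫⁻ y, ∫⁻ x, f (y, x) ∂volume ∂C

theorem IsRegular.exists_isPalm (hd : 0 < d) (H : R.IsRegular) {μ : Measure R.Hull}
    [IsProbabilityMeasure μ] (hμ : R.Invariant μ) :
    ∃ C : Measure R.Hull, IsFiniteMeasure C ∧ R.IsPalm μ C := by
  have hm : Measurable (Function.uncurry fun (t : L 0 × Euc d) (T : R.Hull) =>
      R.translate t.2 T) := by
    have h := H.measurable_translate_uncurry.comp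
      ((measurable_snd.comp measurable_fst : Measurable fun p : (L 0 × Euc d) × R.Hull =>
        p.1.2).prodMk measurable_snd)
    exact h
  have hinv : ∀ (t : L 0 × Euc d) (T : R.Hull) (v : Euc d),
      R.translate (shift (-v) t).2 (R.translate v T) = R.translate t.2 T := by
    intro t T v
    rw [translate_translate]
    congr 1
    exact neg_add_cancel_right t.2 v
  obtain ⟨C, hC, h⟩ := H.exists_palm hd hμ 0 (fun t T => R.translate t.2 T) hm hinv
  refine ⟨C, hC, fun f hf => ?_⟩
  refine Eq.trans (lintegral_congr fun T => ?_) (h f hf)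
  rw [H.level_zero]

theorem IsRegular.eq_of_snd_eq (H : R.IsRegular) (T : R.Hull) {t t' : L 0 × Euc d} (ht : t ∈ T.1)
    (ht' : t' ∈ T.1) (h : t.2 = t'.2) : t = t' := by
  obtain ⟨r, hr, h'⟩ := H.trim.exists_dist_lt_imp_eq 0
  exact h' T.1 T.2 t ht t' ht' (by rwa [h, dist_self])

/-- The pairs of a tiling `y` with a tile at the origin and a vector `x` such that this tile, moved
by `x`, contains the origin, and `y + x` belongs to `E`. -/
def inversionSet (R : FusionData d L) (E : Set R.Hull) : Set (R.Hull × Euc d) :=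
  {p | (∃ s ∈ p.1.1, s.2 = 0 ∧ (0 : Euc d) ∈ R.placedSupp 0 (shift p.2 s)) ∧
    R.translate (-p.2) p.1 ∈ E}

theorem IsRegular.measurableSet_inversionSet (H : R.IsRegular) {E : Set R.Hull}
    (hE : MeasurableSet E) : MeasurableSet (R.inversionSet E) := by
  have h1 : MeasurableSet {q : (L 0 × Euc d) × (R.Hull × Euc d) |
      q.1.2 = 0 ∧ (0 : Euc d) ∈ R.placedSupp 0 (shift q.2.2 q.1)} := by
    have hm : Measurable fun q : (L 0 × Euc d) × (R.Hull × Euc d) =>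
        (q.1.1, q.1.2 + q.2.2) := by fun_prop
    have hs : Measurable fun q : (L 0 × Euc d) × (R.Hull × Euc d) => q.1.2 := by fun_prop
    exact (hs (measurableSet_singleton 0)).inter
      (hm (H.fusion.isClosed_mem_placedSupp 0 0).measurableSet)
  have h2 : MeasurableSet {p : R.Hull × Euc d | ∃ s ∈ p.1.1,
      s.2 = 0 ∧ (0 : Euc d) ∈ R.placedSupp 0 (shift p.2 s)} :=
    H.measurableSet_exists_mem (τ := fun p : R.Hull × Euc d => p.1.1) (fun p => p.1.2)
      (fun V hV => measurable_fst (H.fusion.hitMeasurable_val V hV)) h1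
  have h3 : Measurable fun p : R.Hull × Euc d => R.translate (-p.2) p.1 := by
    have h := H.measurable_translate_uncurry.comp
      ((measurable_snd.neg : Measurable fun p : R.Hull × Euc d => -p.2).prodMk measurable_fst)
    exact h
  exact h2.inter (h3 hE)

/-- An invariant measure is determined by its Palm measure. -/
theorem IsPalm.apply_eq (hd : 0 < d) (H : R.IsRegular) {μ C : Measure R.Hull}
    [IsProbabilityMeasure μ] (hμ : R.Invariant μ) (hC : R.IsPalm μ C) {E : Set R.Hull}
    (hE : MeasurableSet E) :
    μ E = ∫⁻ y, ∫⁻ x, (R.inversionSet E).indicator 1 (y, x) ∂volume ∂C := by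
  obtain ⟨ρ, -, hρ⟩ := H.exists_isIntensity hd hμ 0
  rw [← hC _ (measurable_one.indicator (H.measurableSet_inversionSet hE)),
    ← lintegral_indicator_one hE]
  refine lintegral_congr_ae ?_
  filter_upwards [H.ae_tsum_mem_placedSupp hd hρ] with T hT
  rw [H.level_zero] at hT
  have h1 : ∀ t : T.1, (R.inversionSet E).indicator (1 : R.Hull × Euc d → ℝ≥0∞)
      (R.translate (t : L 0 × Euc d).2 T, (t : L 0 × Euc d).2) =
      E.indicator 1 T *
        {t : L 0 × Euc d | (0 : Euc d) ∈ R.placedSupp 0 t}.indicator 1 (t : L 0 × Euc d) := by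
    intro t
    have h2 : R.translate (-(t : L 0 × Euc d).2) (R.translate (t : L 0 × Euc d).2 T) = T := by
      rw [translate_translate, neg_add_cancel, translate_zero]
    have h3 : (∃ s ∈ (R.translate (t : L 0 × Euc d).2 T).1, s.2 = 0 ∧
        (0 : Euc d) ∈ R.placedSupp 0 (shift (t : L 0 × Euc d).2 s)) ↔
          (0 : Euc d) ∈ R.placedSupp 0 (t : L 0 × Euc d) := by
      constructor
      · rintro ⟨s, hs, hs0, h⟩
        rwa [H.eq_of_snd_eq T (mem_translate.1 hs) t.2 (by simp [hs0])] at h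
      · intro h
        have hst :
            shift (t : L 0 × Euc d).2 (shift (-(t : L 0 × Euc d).2) (t : L 0 × Euc d)) = t := by
          rw [shift_shift, neg_add_cancel, shift_zero]
        refine ⟨shift (-(t : L 0 × Euc d).2) t, mem_translate.2 ?_, by simp, ?_⟩
        · rw [hst]
          exact t.2
        · rwa [hst]
    by_cases hTE : T ∈ E <;> by_cases h0 : (0 : Euc d) ∈ R.placedSupp 0 (t : L 0 × Euc d) <;>
      simp only [indicator, inversionSet, mem_ofPred_eq, h2, h3, hTE, h0] <;> simp
  simp only [h1]
  rw [ENNReal.tsum_mul_left, hT, mul_one]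

/-! ### Rooted patches -/

/-- The tilings that contain a member of `I`. -/
def containing (R : FusionData d L) (I : Set (Finset (L 0 × Euc d))) : Set R.Hull :=
  {T | ∃ P ∈ I, (P : Set (L 0 × Euc d)) ⊆ T.1}

theorem IsRegular.measurableSet_containing (H : R.IsRegular) {I : Set (Finset (L 0 × Euc d))}
    (hI : R.IsPatchFamily I) : MeasurableSet (R.containing I) := by
  classical
  have : R.containing I = ⋃ k : ℕ, {T : R.Hull | ∃ g ∈ {f : Fin k → L 0 × Euc d |
      Function.Injective f ∧ Finset.univ.image f ∈ I}, ∀ i, g i ∈ T.1} := by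
    ext T
    simp only [containing, mem_ofPred_eq, mem_iUnion]
    constructor
    · rintro ⟨P, hP, hPT⟩
      let e := P.equivFin.symm
      refine ⟨P.card, fun i => e i, ⟨Subtype.val_injective.comp e.injective, ?_⟩,
        fun i => hPT (e i).2⟩
      have himg : Finset.univ.image (fun i => (e i : L 0 × Euc d)) = P := by
        ext x
        simp only [Finset.mem_image, Finset.mem_univ, true_and]
        exact ⟨fun ⟨i, hi⟩ => hi ▸ (e i).2, fun hx => ⟨e.symm ⟨x, hx⟩, by simp⟩⟩
      rwa [himg]
    · rintro ⟨k, g, ⟨-, hg⟩, h⟩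
      refine ⟨_, hg, ?_⟩
      rw [Finset.coe_image]
      rintro _ ⟨i, -, rfl⟩
      exact h i
  rw [this]
  exact MeasurableSet.iUnion fun k => H.measurableSet_exists_tuple (fun T : R.Hull => T.2)
    H.fusion.hitMeasurable_val (by convert hI.measurable k)

theorem lintegral_indicator_prod {Y : Type*} [MeasurableSpace Y] (C : Measure Y) {A : Set Y}
    (hA : MeasurableSet A) {U : Set (Euc d)} (hU : MeasurableSet U) :
    ∫⁻ y, ∫⁻ x, (A ×ˢ U).indicator (1 : Y × Euc d → ℝ≥0∞) (y, x) ∂volume ∂C =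
      C A * volume U := by
  simp only [indicator_prod_one]
  rw [← lintegral_indicator_one hA, ← lintegral_indicator_one hU,
    ← lintegral_mul_const _ (measurable_one.indicator hA)]
  exact lintegral_congr fun y => lintegral_const_mul _ (measurable_one.indicator hU)

/-- The Palm measure of the tilings that contain one of a set of patches with a tile at the origin
is a frequency. -/
theorem IsPalm.mul_volume_eq (H : R.IsRegular) {μ C : Measure R.Hull}
    (hC : R.IsPalm μ C) {I : Set (Finset (L 0 × Euc d))} (hI : R.IsPatchFamily I)
    (hroot : ∀ P ∈ I, ∃ t ∈ P, t.2 = 0) {U : Set (Euc d)} (hU : R.IsTrimWith I U) :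
    C (R.containing I) * volume U = μ (R.cylinder I U) := by
  have hA := H.measurableSet_containing hI
  have h := hC _ (measurable_one.indicator (hA.prod hU.1.measurableSet))
  have h1 : ∀ T : R.Hull, ∑' t : T.1, (R.containing I ×ˢ U).indicator (1 : R.Hull × Euc d → ℝ≥0∞)
      (R.translate (t : L 0 × Euc d).2 T, (t : L 0 × Euc d).2) =
        (R.cylinder I U).indicator 1 T := by
    intro T
    by_cases hT : T ∈ R.cylinder I U
    · obtain ⟨P, hP, v, hv, hPT⟩ := id hT
      obtain ⟨s, hs, hs0⟩ := hroot P hP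
      have hsT := mem_translate.1 (hPT hs)
      have hsv : (shift v s).2 = v := by simp [hs0]
      rw [indicator_of_mem hT, tsum_eq_single ⟨_, hsT⟩]
      · have hmem : (R.translate (shift v s).2 T, (shift v s).2) ∈ R.containing I ×ˢ U := by
          rw [hsv]
          exact ⟨⟨P, hP, hPT⟩, hv⟩
        exact indicator_of_mem hmem _
      · rintro ⟨t, ht⟩ hne
        refine indicator_of_notMem (f := (1 : R.Hull × Euc d → ℝ≥0∞)) ?_
        rintro ⟨⟨Q, hQ, hQT⟩, htU⟩
        refine hne (Subtype.ext (H.eq_of_snd_eq T ht hsT ?_))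
        rw [hsv]
        exact (hU.2.2 T Q hQ P hP _ htU v hv hQT hPT).2
    · rw [indicator_of_notMem hT]
      refine ENNReal.tsum_eq_zero.2 fun t => ?_
      refine indicator_of_notMem (f := (1 : R.Hull × Euc d → ℝ≥0∞)) ?_
      rintro ⟨⟨P, hP, hPT⟩, htU⟩
      exact hT ⟨P, hP, _, htU, hPT⟩
  have h2 : MeasurableSet (R.cylinder I U) := by
    have hg : Measurable (Function.uncurry fun (t : L 0 × Euc d) (T : R.Hull) =>
        (R.containing I ×ˢ U).indicator (1 : R.Hull × Euc d → ℝ≥0∞) (R.translate t.2 T, t.2)) := by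
      have hm : Measurable fun p : (L 0 × Euc d) × R.Hull =>
          (R.translate p.1.2 p.2, p.1.2) :=
        (H.measurable_translate_uncurry.comp
          ((measurable_snd.comp measurable_fst).prodMk measurable_snd)).prodMk
            (measurable_snd.comp measurable_fst)
      exact (measurable_one.indicator (hA.prod hU.1.measurableSet)).comp hm
    have h3 := H.measurable_tsum (fun T : R.Hull => T.2) H.fusion.hitMeasurable_val hg
    simp only [h1] at h3
    convert h3 (measurableSet_singleton 1) using 1
    ext T
    by_cases hT : T ∈ R.cylinder I U <;> simp [hT]
  simp only [h1] at h
  rw [lintegral_indicator_one h2] at h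
  rw [h, lintegral_indicator_prod C hA hU.1.measurableSet]

/-! ### The lexicographic order -/

/-- Negativity with respect to the lexicographic order on `ℝ^d`. -/
def LexNeg (x : Euc d) : Prop := ∃ i, (∀ j < i, x j = 0) ∧ x i < 0

theorem not_lexNeg_zero : ¬ LexNeg (0 : Euc d) := by
  rintro ⟨i, -, h⟩
  exact lt_irrefl _ h

theorem LexNeg.add {x y : Euc d} (hx : LexNeg x) (hy : LexNeg y) : LexNeg (x + y) := by
  obtain ⟨i, hi, hi'⟩ := hx
  obtain ⟨k, hk, hk'⟩ := hy
  rcases lt_trichotomy i k with h | rfl | h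
  · refine ⟨i, fun j hj => ?_, ?_⟩
    · simp [hi j hj, hk j (hj.trans h)]
    · simpa [hk i h] using hi'
  · refine ⟨i, fun j hj => ?_, ?_⟩
    · simp [hi j hj, hk j hj]
    · simpa using add_neg hi' hk'
  · refine ⟨k, fun j hj => ?_, ?_⟩
    · simp [hi j (hj.trans h), hk j hj]
    · simpa [hi k h] using hk'

theorem lexNeg_or_lexNeg_neg {x : Euc d} (hx : x ≠ 0) : LexNeg x ∨ LexNeg (-x) := by
  classical
  have hne : (Finset.univ.filter fun i => x i ≠ 0).Nonempty := by
    by_contra h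
    refine hx (PiLp.ext fun i => ?_)
    by_contra hi
    exact h ⟨i, by simpa using hi⟩
  obtain ⟨i, hi, hmin⟩ := Finset.exists_min_image _ id hne
  have h0 : ∀ j < i, x j = 0 := by
    intro j hj
    by_contra hjx
    exact absurd (hmin j (by simpa using hjx)) (not_le.2 hj)
  rcases lt_or_gt_of_ne (Finset.mem_filter.1 hi).2 with h | h
  · exact Or.inl ⟨i, h0, h⟩
  · exact Or.inr ⟨i, fun j hj => by simp [h0 j hj], by simpa using h⟩

theorem measurableSet_lexNeg : MeasurableSet {x : Euc d | LexNeg x} := by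
  have hm : ∀ i, Measurable fun x : Euc d => x i := fun i => by fun_prop
  have : {x : Euc d | LexNeg x} = ⋃ i, (⋂ j, ⋂ (_ : j < i), {x : Euc d | x j = 0}) ∩
      {x : Euc d | x i < 0} := by
    ext x
    simp [LexNeg]
  rw [this]
  exact MeasurableSet.iUnion fun i => (MeasurableSet.iInter fun j => MeasurableSet.iInter fun _ =>
    hm j (measurableSet_singleton 0)).inter (hm i measurableSet_Iio)

open Classical in
/-- The number of tiles of `P` whose control point precedes the origin. -/
def rank (P : Finset (L 0 × Euc d)) : ℕ := (P.filter fun t => LexNeg t.2).card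

/-- A translation that takes a patch with a control point at the origin to another one moves the
origin to a different position in the order of the control points. -/
theorem eq_zero_of_rank_map_eq {P : Finset (L 0 × Euc d)} {v : Euc d} (h0 : ∃ t ∈ P, t.2 = 0)
    (hv : ∃ t ∈ P.map (shift v).toEmbedding, t.2 = 0)
    (h : rank (P.map (shift v).toEmbedding) = rank P) : v = 0 := by
  classical
  by_contra hne
  have h1 : rank (P.map (shift v).toEmbedding) = (P.filter fun t => LexNeg (t.2 + v)).card := by
    rw [rank, Finset.filter_map, Finset.card_map]
    rfl
  obtain ⟨t, ht, ht0⟩ := h0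
  obtain ⟨s, hs, hs0⟩ := hv
  obtain ⟨s, hsP, rfl⟩ := Finset.mem_map.1 hs
  have hs0 : s.2 + v = 0 := hs0
  rw [h1, rank] at h
  -- a translation by a negative vector can only increase the set of negative control points, and adds
  -- the one at the origin; a translation by a positive vector is the opposite case
  rcases lexNeg_or_lexNeg_neg hne with hv | hv
  · have hsub : (P.filter fun t => LexNeg t.2) ⊂ P.filter fun t => LexNeg (t.2 + v) := by
      refine Finset.ssubset_iff_subset_ne.2 ⟨fun u hu => ?_, fun heq => ?_⟩
      · rw [Finset.mem_filter] at hu ⊢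
        exact ⟨hu.1, hu.2.add hv⟩
      · have : t ∈ P.filter fun t => LexNeg t.2 := by
          rw [heq, Finset.mem_filter, ht0, zero_add]
          exact ⟨ht, hv⟩
        rw [Finset.mem_filter, ht0] at this
        exact not_lexNeg_zero this.2
    exact (Finset.card_lt_card hsub).ne' h
  · have hsub : (P.filter fun t => LexNeg (t.2 + v)) ⊂ P.filter fun t => LexNeg t.2 := by
      refine Finset.ssubset_iff_subset_ne.2 ⟨fun u hu => ?_, fun heq => ?_⟩
      · rw [Finset.mem_filter] at hu ⊢
        exact ⟨hu.1, by simpa using hu.2.add hv⟩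
      · have : s ∈ P.filter fun t => LexNeg (t.2 + v) := by
          rw [heq, Finset.mem_filter, eq_neg_of_add_eq_zero_left hs0]
          exact ⟨hsP, hv⟩
        rw [Finset.mem_filter, hs0] at this
        exact not_lexNeg_zero this.2
    exact (Finset.card_lt_card hsub).ne h

/-! ### Blocks -/

section Blocks

variable {F : Set (Set (L 0 × Euc d))} {k j : ℕ}

/-- The patches that cover the open ball of radius `k + 1` around the origin, all of whose tiles meet
this ball, with a tile at the origin that is preceded by exactly `j` control points, and with a tile
in each member of `F`. -/
def blocks (R : FusionData d L) (F : Set (Set (L 0 × Euc d))) (k j : ℕ) :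
    Set (Finset (L 0 × Euc d)) :=
  {P | R.NonOverlapping 0 P ∧ Metric.ball 0 ((k : ℝ) + 1) ⊆ R.region 0 P ∧
    (∀ t ∈ P, (Metric.ball 0 ((k : ℝ) + 1) ∩ R.placedSupp 0 t).Nonempty) ∧
    (∃ t ∈ P, t.2 = 0) ∧ (∀ V ∈ F, ∃ t ∈ P, t ∈ V) ∧ rank P = j}

theorem IsFusionRule.isPatch_of_mem_blocks (hR : R.IsFusionRule) {P : Finset (L 0 × Euc d)}
    (hP : P ∈ R.blocks F k j) : R.IsPatch 0 P := by
  obtain ⟨h1, h2, h3, ⟨t, ht, -⟩, -, -⟩ := hP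
  have hk : (0 : ℝ) < (k : ℝ) + 1 := by positivity
  refine ⟨⟨t, ht⟩, h1, hR.isConnected_region hk.le ?_ fun t ht =>
    (h3 t ht).mono (inter_subset_inter_left _ Metric.ball_subset_closedBall)⟩
  have hclosed : IsClosed (R.region 0 (P : Set (L 0 × Euc d))) :=
    P.finite_toSet.isClosed_biUnion fun t _ => isClosed_placedSupp 0 t
  rw [← closure_ball (0 : Euc d) hk.ne']
  exact hclosed.closure_subset_iff.2 h2

theorem measurableSet_injective {X : Type*} [MeasurableSpace X] [MeasurableEq X] (m : ℕ) :
    MeasurableSet {f : Fin m → X | Function.Injective f} := by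
  have : {f : Fin m → X | Function.Injective f} =
      ⋂ (a) (b), ⋂ (_ : a ≠ b), {f : Fin m → X | f a = f b}ᶜ := by
    ext f
    simp only [mem_iInter, Function.Injective, mem_ofPred_eq, mem_compl_iff]
    exact ⟨fun h a b hab hf => hab (h hf), fun h a b hf => by_contra fun hab => h a b hab hf⟩
  rw [this]
  exact MeasurableSet.iInter fun a => MeasurableSet.iInter fun b => MeasurableSet.iInter fun _ =>
    (measurableSet_eq_fun (measurable_pi_apply a) (measurable_pi_apply b)).compl

open Classical in
theorem IsFusionRule.measurableSet_blocks (hR : R.IsFusionRule) (hF : F.Finite)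
    (hFo : ∀ V ∈ F, IsOpen V) (m : ℕ) : MeasurableSet
      {f : Fin m → L 0 × Euc d | Function.Injective f ∧ Finset.univ.image f ∈ R.blocks F k j} := by
  have hm : ∀ i, Measurable fun f : Fin m → L 0 × Euc d => f i := fun i => measurable_pi_apply i
  have h1 : MeasurableSet {f : Fin m → L 0 × Euc d | ∀ a b, f a ≠ f b →
      R.placedSupp 0 (f a) ∩ R.placedSupp 0 (f b) ⊆
        frontier (R.placedSupp 0 (f a)) ∩ frontier (R.placedSupp 0 (f b))} := by
    have : {f : Fin m → L 0 × Euc d | ∀ a b, f a ≠ f b →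
      R.placedSupp 0 (f a) ∩ R.placedSupp 0 (f b) ⊆
        frontier (R.placedSupp 0 (f a)) ∩ frontier (R.placedSupp 0 (f b))} =
        ⋂ (a) (b), ({f : Fin m → L 0 × Euc d | f a = f b} ∪
          {f | R.placedSupp 0 (f a) ∩ R.placedSupp 0 (f b) ⊆
            frontier (R.placedSupp 0 (f a)) ∩ frontier (R.placedSupp 0 (f b))}) := by
      ext f
      simp only [mem_ofPred_eq, mem_iInter, mem_union]
      exact forall₂_congr fun a b => or_iff_not_imp_left.symm
    rw [this]
    exact MeasurableSet.iInter fun a => MeasurableSet.iInter fun b =>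
      (measurableSet_eq_fun (hm a) (hm b)).union
        (measurableSet_preimage ((hm a).prodMk (hm b)) (hR.measurableSet_nonOverlapping_pair 0))
  have h2 : MeasurableSet {f : Fin m → L 0 × Euc d |
      Metric.ball 0 ((k : ℝ) + 1) ⊆ ⋃ i, R.placedSupp 0 (f i)} :=
    (hR.isClosed_subset_iUnion_placedSupp 0 _).measurableSet
  have h3 : MeasurableSet {f : Fin m → L 0 × Euc d | ∀ i,
      (Metric.ball 0 ((k : ℝ) + 1) ∩ R.placedSupp 0 (f i)).Nonempty} := by
    rw [ofPred_forall]
    refine MeasurableSet.iInter fun i => ?_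
    have h := measurableSet_preimage (hm i)
      (hR.isOpen_inter_placedSupp_nonempty 0
        (Metric.isOpen_ball (x := 0) (ε := (k : ℝ) + 1))).measurableSet
    exact h
  have h4 : MeasurableSet {f : Fin m → L 0 × Euc d | ∃ i, (f i).2 = 0} := by
    rw [ofPred_exists]
    exact MeasurableSet.iUnion fun i =>
      (measurable_snd.comp (hm i)) (measurableSet_singleton (0 : Euc d))
  have h5 : MeasurableSet {f : Fin m → L 0 × Euc d | ∀ V ∈ F, ∃ i, f i ∈ V} := by
    have : {f : Fin m → L 0 × Euc d | ∀ V ∈ F, ∃ i, f i ∈ V} =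
        ⋂ V ∈ F, ⋃ i, {f : Fin m → L 0 × Euc d | f i ∈ V} := by
      ext f
      simp
    rw [this]
    exact MeasurableSet.biInter hF.countable fun V hV => MeasurableSet.iUnion fun i =>
      hm i (hFo V hV).measurableSet
  have h6 : MeasurableSet {f : Fin m → L 0 × Euc d |
      (∑ i, if LexNeg (f i).2 then 1 else 0) = j} := by
    have : Measurable fun f : Fin m → L 0 × Euc d => ∑ i, if LexNeg (f i).2 then 1 else 0 :=
      Finset.measurable_sum _ fun i _ => by
        have h := measurableSet_preimage (measurable_snd.comp (hm i)) measurableSet_lexNeg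
        exact Measurable.ite h measurable_const measurable_const
    exact this (measurableSet_singleton j)
  convert (measurableSet_injective (X := L 0 × Euc d) m).inter
    (h1.inter (h2.inter (h3.inter (h4.inter (h5.inter h6))))) using 1
  ext f
  refine and_congr_right fun hf => ?_
  have hmem : ∀ p : L 0 × Euc d → Prop,
      (∃ t ∈ Finset.univ.image f, p t) ↔ ∃ i, p (f i) := fun p => by simp
  have hrank : rank (Finset.univ.image f) = ∑ i, if LexNeg (f i).2 then 1 else 0 := by
    rw [rank, Finset.filter_image, Finset.card_image_of_injective _ hf, Finset.card_filter]
  refine and_congr ?_ (and_congr ?_ (and_congr ?_ (and_congr (hmem _) (and_congr ?_ ?_))))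
  · simp [NonOverlapping]
  · simp [region]
  · simp
  · exact forall₂_congr fun V _ => hmem _
  · rw [hrank]
    rfl

/-- No two blocks are translates of each other, because they have a control point at the origin and
the same rank of the origin. -/
theorem IsFusionRule.isPatchFamily_blocks (hR : R.IsFusionRule) (hF : F.Finite)
    (hFo : ∀ V ∈ F, IsOpen V) (k j : ℕ) : R.IsPatchFamily (R.blocks F k j) where
  patch _ hP := hR.isPatch_of_mem_blocks hP
  inequivalent _ hP _ hv := eq_zero_of_rank_map_eq hP.2.2.2.1 hv.2.2.2.1
    (hv.2.2.2.2.2.trans hP.2.2.2.2.2.symm)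
  measurable := hR.measurableSet_blocks hF hFo

/-- A block in a tiling consists of all tiles that meet the ball. -/
theorem IsFusionRule.mem_block_iff (hR : R.IsFusionRule) {P : Finset (L 0 × Euc d)}
    (hP : P ∈ R.blocks F k j) {T : R.Hull} (hPT : (P : Set (L 0 × Euc d)) ⊆ T.1)
    {t : L 0 × Euc d} :
    t ∈ P ↔ t ∈ T.1 ∧ (Metric.ball 0 ((k : ℝ) + 1) ∩ R.placedSupp 0 t).Nonempty := by
  refine ⟨fun ht => ⟨hPT ht, hP.2.2.1 t ht⟩, ?_⟩
  rintro ⟨ht, y, hyb, hyt⟩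
  rw [← hR.closure_interior_placedSupp] at hyt
  obtain ⟨z, hzb, hzt⟩ := mem_closure_iff.1 hyt _ Metric.isOpen_ball hyb
  obtain ⟨s, hs, hzs⟩ := mem_region.1 (hP.2.1 hzb)
  rwa [T.2.1.1.eq_of_mem_interior ht (hPT hs) hzt hzs]

/-- Two blocks in the same tiling whose root tiles have nearby control points have the same root tile,
and then they consist of the same tiles. -/
theorem IsRegular.exists_isTrimWith_blocks (H : R.IsRegular) (F : Set (Set (L 0 × Euc d)))
    (k j : ℕ) : ∃ r > 0, R.IsTrimWith (R.blocks F k j) (Metric.ball 0 r) := by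
  obtain ⟨r, hr, h⟩ := H.exists_small_balls 0
  refine ⟨r, hr, Metric.isOpen_ball, Metric.nonempty_ball.2 hr, ?_⟩
  intro T P hP Q hQ u hu v hv hPT hQT
  obtain ⟨s, hs, hs0⟩ := hP.2.2.2.1
  obtain ⟨t, ht, ht0⟩ := hQ.2.2.2.1
  have hsu : (shift u s).2 = u := by simp [hs0]
  have htv : (shift v t).2 = v := by simp [ht0]
  have h1 := h 0 T.1 T.2 _ (mem_translate.1 (hPT hs)) _ (mem_translate.1 (hQT ht))
    (by rwa [hsu]) (by rwa [htv])
  have huv : u = v := by rw [← hsu, h1, htv]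
  subst huv
  refine ⟨?_, rfl⟩
  ext x
  rw [H.fusion.mem_block_iff hP hPT, H.fusion.mem_block_iff hQ hQT]

/-- The tilings with a tile at the origin and a tile in each member of `F`, all of which meet the
ball of radius `k + 1`. -/
def blockEvent (R : FusionData d L) (F : Set (Set (L 0 × Euc d))) (k : ℕ) : Set R.Hull :=
  {T | (∃ t ∈ T.1, (Metric.ball 0 ((k : ℝ) + 1) ∩ R.placedSupp 0 t).Nonempty ∧ t.2 = 0) ∧
    ∀ V ∈ F, ∃ t ∈ T.1, (Metric.ball 0 ((k : ℝ) + 1) ∩ R.placedSupp 0 t).Nonempty ∧ t ∈ V}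

/-- The block of a tiling consists of the tiles that meet the ball, and it has some rank `j`. -/
theorem IsRegular.iUnion_containing_blocks (H : R.IsRegular) (F : Set (Set (L 0 × Euc d)))
    (k : ℕ) : ⋃ j, R.containing (R.blocks F k j) = R.blockEvent F k := by
  classical
  ext T
  rw [mem_iUnion]
  constructor
  · rintro ⟨j, P, hP, hPT⟩
    obtain ⟨-, -, h3, ⟨t, ht, ht0⟩, h5, -⟩ := hP
    refine ⟨⟨t, hPT ht, h3 t ht, ht0⟩, fun V hV => ?_⟩
    obtain ⟨s, hs, hsV⟩ := h5 V hV
    exact ⟨s, hPT hs, h3 s hs, hsV⟩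
  · rintro ⟨⟨t, ht, htb, ht0⟩, hF⟩
    have hfin : {t ∈ T.1 | (Metric.ball 0 ((k : ℝ) + 1) ∩ R.placedSupp 0 t).Nonempty}.Finite :=
      (H.finite_near T.2 ((k : ℝ) + 1)).subset fun t ht =>
        ⟨ht.1, ht.2.mono (inter_subset_inter_left _ Metric.ball_subset_closedBall)⟩
    refine ⟨_, hfin.toFinset, ⟨?_, ?_, ?_, ⟨t, ?_, ht0⟩, fun V hV => ?_, rfl⟩, ?_⟩
    · rw [hfin.coe_toFinset]
      exact T.2.1.1.mono fun t ht => ht.1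
    · rw [hfin.coe_toFinset]
      intro y hy
      obtain ⟨s, hs, hys⟩ := mem_region.1 (T.2.1.2 ▸ mem_univ y : y ∈ R.region 0 T.1)
      exact mem_region.2 ⟨s, ⟨hs, y, hy, hys⟩, hys⟩
    · exact fun s hs => (hfin.mem_toFinset.1 hs).2
    · exact hfin.mem_toFinset.2 ⟨ht, htb⟩
    · obtain ⟨s, hs, hsb, hsV⟩ := hF V hV
      exact ⟨s, hfin.mem_toFinset.2 ⟨hs, hsb⟩, hsV⟩
    · rw [hfin.coe_toFinset]
      exact fun t ht => ht.1

theorem IsFusionRule.pairwise_disjoint_containing_blocks (hR : R.IsFusionRule)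
    (F : Set (Set (L 0 × Euc d))) (k : ℕ) :
    Pairwise (Function.onFun Disjoint fun j => R.containing (R.blocks F k j)) := by
  intro i j hij
  refine disjoint_left.2 ?_
  rintro T ⟨P, hP, hPT⟩ ⟨Q, hQ, hQT⟩
  refine hij ?_
  have : P = Q := by
    ext x
    rw [hR.mem_block_iff hP hPT, hR.mem_block_iff hQ hQT]
  rw [← hP.2.2.2.2.2, this, hQ.2.2.2.2.2]

theorem monotone_blockEvent (F : Set (Set (L 0 × Euc d))) : Monotone (R.blockEvent F) := by
  intro k l hkl T hT
  have hsub : Metric.ball (0 : Euc d) ((k : ℝ) + 1) ⊆ Metric.ball 0 ((l : ℝ) + 1) :=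
    Metric.ball_subset_ball (by simpa using hkl)
  obtain ⟨⟨t, ht, htb, ht0⟩, hF⟩ := hT
  refine ⟨⟨t, ht, htb.mono (inter_subset_inter_left _ hsub), ht0⟩, fun V hV => ?_⟩
  obtain ⟨s, hs, hsb, hsV⟩ := hF V hV
  exact ⟨s, hs, hsb.mono (inter_subset_inter_left _ hsub), hsV⟩

theorem IsFusionRule.iUnion_blockEvent (hR : R.IsFusionRule) (hF : F.Finite) :
    ⋃ k, R.blockEvent F k = R.hitSet F ∩ {T | ∃ t ∈ T.1, t.2 = 0} := by
  ext T
  rw [mem_iUnion]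
  constructor
  · rintro ⟨k, ⟨t, ht, -, ht0⟩, h⟩
    refine ⟨fun V hV => ?_, t, ht, ht0⟩
    obtain ⟨s, hs, -, hsV⟩ := h V hV
    exact ⟨s, hs, hsV⟩
  · rintro ⟨h, t, ht, ht0⟩
    have key : ∀ t : L 0 × Euc d, ∀ᶠ k : ℕ in atTop,
        (Metric.ball 0 ((k : ℝ) + 1) ∩ R.placedSupp 0 t).Nonempty := by
      intro t
      obtain ⟨y, hy⟩ := hR.placedSupp_nonempty 0 t
      filter_upwards [eventually_ge_atTop ⌈‖y‖⌉₊] with k hk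
      refine ⟨y, ?_, hy⟩
      rw [mem_ball_zero_iff]
      have := Nat.ceil_le.1 hk
      linarith
    refine ((key t).and ((eventually_all_finite hF).2 fun V hV => ?_)).exists.imp fun k hk =>
      ⟨⟨t, ht, hk.1, ht0⟩, hk.2⟩
    obtain ⟨s, hs, hsV⟩ := h V hV
    filter_upwards [key s] with k hk
    exact ⟨s, hs, hk, hsV⟩

end Blocks

/-! ### Uniqueness -/

theorem IsRegular.measurableSet_rooted (H : R.IsRegular) :
    MeasurableSet {T : R.Hull | ∃ t ∈ T.1, t.2 = 0} :=
  H.measurableSet_hit (fun T : R.Hull => T.2) H.fusion.hitMeasurable_val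
    (measurable_snd (measurableSet_singleton (0 : Euc d)))

/-- The Palm measure is concentrated on the tilings with a tile at the origin. -/
theorem IsPalm.apply_rooted_compl (H : R.IsRegular) {μ C : Measure R.Hull} (hC : R.IsPalm μ C) :
    C {T : R.Hull | ∃ t ∈ T.1, t.2 = 0}ᶜ = 0 := by
  have hm := H.measurableSet_rooted.compl
  obtain ⟨U, hU, hU0⟩ : ∃ U : Set (Euc d), MeasurableSet U ∧ volume U ≠ 0 :=
    ⟨univ, MeasurableSet.univ, (isOpen_univ.measure_pos volume univ_nonempty).ne'⟩
  have h := hC _ (measurable_one.indicator (hm.prod hU))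
  have h1 : ∀ T : R.Hull, ∑' t : T.1, ({T : R.Hull | ∃ t ∈ T.1, t.2 = 0}ᶜ ×ˢ U).indicator
      (1 : R.Hull × Euc d → ℝ≥0∞) (R.translate (t : L 0 × Euc d).2 T, (t : L 0 × Euc d).2) = 0 := by
    intro T
    refine ENNReal.tsum_eq_zero.2 fun t => indicator_of_notMem (f := (1 : R.Hull × Euc d → ℝ≥0∞)) ?_
    rintro ⟨hn, -⟩
    refine hn ⟨shift (-(t : L 0 × Euc d).2) t, mem_translate.2 ?_, by simp⟩
    rw [shift_shift, neg_add_cancel, shift_zero]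
    exact t.2
  simp only [h1, lintegral_zero] at h
  rw [lintegral_indicator_prod C hm hU] at h
  exact (mul_eq_zero.1 h.symm).resolve_right hU0

/-- Invariant measures with the same patch frequencies have the same Palm measure. -/
theorem IsPalm.eq_of_frequencyFormula (H : R.IsRegular) {μ μ' C C' : Measure R.Hull}
    [IsFiniteMeasure C] (hC : R.IsPalm μ C) (hC' : R.IsPalm μ' C') {ρ : ∀ n, Measure (L n)}
    (hμ : R.FrequencyFormula μ ρ) (hμ' : R.FrequencyFormula μ' ρ) : C = C' := by
  have hR := H.fusion
  have key : ∀ F : Set (Set (L 0 × Euc d)), F.Finite → (∀ V ∈ F, IsOpen V) →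
      C (R.hitSet F) = C' (R.hitSet F) := by
    intro F hF hFo
    have h1 : ∀ k j, C (R.containing (R.blocks F k j)) = C' (R.containing (R.blocks F k j)) := by
      intro k j
      obtain ⟨r, hr, hU⟩ := H.exists_isTrimWith_blocks F k j
      have hI := hR.isPatchFamily_blocks hF hFo k j
      have h := tendsto_nhds_unique (hμ _ hI _ hU) (hμ' _ hI _ hU)
      have hroot : ∀ P ∈ R.blocks F k j, ∃ t ∈ P, t.2 = 0 := fun P hP => hP.2.2.2.1
      have hU0 : volume (Metric.ball (0 : Euc d) r) ≠ 0 :=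
        (Metric.measure_ball_pos volume (0 : Euc d) hr).ne'
      have hU1 : volume (Metric.ball (0 : Euc d) r) ≠ ∞ := measure_ball_lt_top.ne
      rwa [← hC.mul_volume_eq H hI hroot hU, ← hC'.mul_volume_eq H hI hroot hU,
        ENNReal.mul_div_cancel_right hU0 hU1, ENNReal.mul_div_cancel_right hU0 hU1] at h
    have h2 : ∀ k, C (R.blockEvent F k) = C' (R.blockEvent F k) := by
      intro k
      have hm := fun j => H.measurableSet_containing (hR.isPatchFamily_blocks hF hFo k j)
      rw [← H.iUnion_containing_blocks F k,
        measure_iUnion (hR.pairwise_disjoint_containing_blocks F k) hm,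
        measure_iUnion (hR.pairwise_disjoint_containing_blocks F k) hm]
      exact tsum_congr fun j => h1 k j
    have h3 : ∀ {ν : Measure R.Hull}, ν {T : R.Hull | ∃ t ∈ T.1, t.2 = 0}ᶜ = 0 →
        ν (R.hitSet F) = ν (⋃ k, R.blockEvent F k) := by
      intro ν hν
      rw [hR.iUnion_blockEvent hF]
      exact (measure_inter_conull hν).symm
    rw [h3 (hC.apply_rooted_compl H), h3 (hC'.apply_rooted_compl H)]
    refine tendsto_nhds_unique (tendsto_measure_iUnion_atTop (monotone_blockEvent F)) ?_
    simp only [Function.comp_def, h2]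
    exact tendsto_measure_iUnion_atTop (monotone_blockEvent F)
  refine ext_of_generate_finite R.hitEvents H.generateFrom_hitEvents isPiSystem_hitEvents ?_ ?_
  · rintro _ ⟨F, hF, hFo, rfl⟩
    exact key F hF hFo
  · have h : R.hitSet ∅ = univ := by
      ext T
      simp [hitSet]
    rw [← h]
    exact key ∅ finite_empty (by simp)

/-- An invariant probability measure is determined by the frequencies of patches. -/
theorem IsRegular.eq_of_frequencyFormula (hd : 0 < d) (H : R.IsRegular) {μ μ' : Measure R.Hull}
    [IsProbabilityMeasure μ] [IsProbabilityMeasure μ'] (hμ : R.Invariant μ) (hμ' : R.Invariant μ')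
    {ρ : ∀ n, Measure (L n)} (h : R.FrequencyFormula μ ρ) (h' : R.FrequencyFormula μ' ρ) :
    μ = μ' := by
  obtain ⟨C, _, hC⟩ := H.exists_isPalm hd hμ
  obtain ⟨C', _, hC'⟩ := H.exists_isPalm hd hμ'
  obtain rfl : C = C' := hC.eq_of_frequencyFormula H hC' h h'
  ext E hE
  rw [hC.apply_eq hd H hμ hE, hC'.apply_eq hd H hμ' hE]

end FusionData

end Fusion

end

theorem mainTheorem1 {d : ℕ} (hd : 0 < d) {L : ℕ → Type*} [∀ n, MetricSpace (L n)]
    [∀ n, CompactSpace (L n)] [∀ n, Nonempty (L n)] [∀ n, MeasurableSpace (L n)]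
    [∀ n, BorelSpace (L n)] (R : Fusion.FusionData d L) (hR : R.IsFusionRule)
    (hTrim : R.SupertilesTrim) (hVH : R.VanHove) (hRec : R.Recognizable) :
    (∀ μ : Measure R.Hull, IsProbabilityMeasure μ → R.Invariant μ →
      ∃ ρ : ∀ n, Measure (L n), (∀ n, R.IsFrequencyMeasure μ n (ρ n)) ∧
        R.VolumeNormalized ρ ∧ R.TransitionConsistent ρ ∧ R.FrequencyFormula μ ρ) ∧
    (∀ ρ : ∀ n, Measure (L n), R.VolumeNormalized ρ → R.TransitionConsistent ρ →
      ∃ μ : Measure R.Hull, IsProbabilityMeasure μ ∧ R.Invariant μ ∧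
        (∀ n, R.IsFrequencyMeasure μ n (ρ n)) ∧ R.FrequencyFormula μ ρ ∧
        ∀ μ' : Measure R.Hull, IsProbabilityMeasure μ' → R.Invariant μ' →
          R.FrequencyFormula μ' ρ → μ' = μ) := by
  have H : R.IsRegular := ⟨hR, hTrim, hVH, hRec⟩
  refine ⟨fun μ hμ hinv => ?_, fun ρ hV hT => ?_⟩
  · obtain ⟨ρ, -, h⟩ := H.exists_frequencyMeasures hd hinv
    exact ⟨ρ, h⟩
  · obtain ⟨μ, hμ, hinv, hρ⟩ := H.exists_invariant hd hV hT
    have hf := H.frequencyFormula hd hρ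
    exact ⟨μ, hμ, hinv, fun n => H.isFrequencyMeasure hd (hρ n), hf, fun μ' _ hinv' hf' =>
      H.eq_of_frequencyFormula hd hinv' hinv hf' hf⟩
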